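/- Let $G=(V,E)$ be a connected simple undirected graph with $n$ vertices and $m$ edges, vertex weights $w_v>0$ and edge lengths $l(e)>0$. A point of $G$ is a vertex or a point in the interior of an edge (regarded as a segment of length $l(e)$), and $d(x,v)$ is the shortest path distance between a point $x$ and a vertex $v$. A shortest path tree of $x$ is a spanning tree, rooted at $x$, that contains a shortest path from $x$ to every vertex; if $x$ is interior to an edge, then $x$ is a dummy vertex of the tree that subdivides this edge, and as a subgraph of $G$ the tree is obtained by suppressing this dummy vertex (deleting it, and restoring the subdivided edge if both of its halves are in the tree). For $1\le k\le n$ let $$\phi(x,G)=\min_{T^k}\ \max_{v\in V(T^k)} w_v\,d(x,v),$$ where $T^k$ ranges over the subtrees with $k$ vertices of the shortest path trees of $x$ in $G$, and let $\lambda^*=\min_x\phi(x,G)$ over all points $x$ of $G$. For a real number $\lambda$, a point $x$ covers a set of vertices if $w_v d(x,v)\le\lambda$ for all its members $v$. For an edge $e$ with a chosen first end vertex and $t\in[0,l(e)]$, let $f(e,t)$ be the largest number of vertices of a subtree that is covered by the point $x$ of $e$ at distance $t$ from that end vertex, and whose vertices together with $x$ (as a dummy vertex if $x$ is interior to $e$)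 induce a connected subtree in a shortest path tree of $x$ ($f(e,t)=0$ if there is none). Computations are on a real RAM (unit-cost exact real arithmetic $+,-,\times,/$ and comparisons, and integers of $O(\log(n+m))$ bits). The input consists of the list of edges with their lengths, the vertex weights, the distance matrix $(d(u,v))_{u,v\in V}$ and $\lambda$ (together with $k$ in (1) and an edge $e$ in (2)). Then: 1. The minimum $\lambda^*$ exists, and there is an algorithm that, given $G$, $k$ and any real $\lambda$, decides whether $\lambda\ge\lambda^*$ in $O(mn\log n+m^2\log n)$ time (in constant time if $n=1$). 2. For every edge $e$ and every real $\lambda$, the function $t\mapsto f(e,t)$ on $[0,l(e)]$ is piecewise constant with $O(n)$ breakpoints (points near which it is not constant), and there is an algorithm that, given $G$, $e$ and $\lambda$, computes the sorted list of all its breakpoints, its values at them, and its values before, between and after them in $O((m+n)\log n)$ time. -/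

import Mathlib

namespace KCenter

open Set Filter Topology

/-! ### Weighted graphs, distances, shortest path trees -/

section Walks

variable {V : Type*}

/-- The length of a walk, where the edge between `a` and `b` has length `len a b`. -/
def walkLength {H : SimpleGraph V} (len : V → V → ℝ) : {a b : V} → H.Walk a b → ℝ
  | _, _, .nil => 0
  | _, _, .cons (u := u) (v := v) _ p => len u v + walkLength len p

/-- The shortest path distance of `H` with edge lengths `len`. -/
noncomputable def graphDist (H : SimpleGraph V) (len : V → V → ℝ) (a b : V) : ℝ :=
  sInf {c | ∃ p : H.Walk a b, c = walkLength len p}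

/-- `T` is a shortest path tree of `H` rooted at `r`: a spanning tree of `H` in which the distance
from `r` to every vertex is the distance in `H`. -/
def IsShortestPathTree (H : SimpleGraph V) (len : V → V → ℝ) (r : V) (T : SimpleGraph V) : Prop :=
  T ≤ H ∧ T.IsTree ∧ ∀ v, graphDist T len r v = graphDist H len r v

end Walks

/-- A connected simple undirected graph with positive vertex weights and positive edge lengths. -/
structure Network (V : Type*) where
  graph : SimpleGraph V
  connected : graph.Connected
  weight : V → ℝ
  weight_pos : ∀ v, 0 < weight v
  len : V → V → ℝ
  len_symm : ∀ u v, len u v = len v u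
  len_pos : ∀ u v, graph.Adj u v → 0 < len u v

namespace Network

variable {V : Type*} [DecidableEq V] (N : Network V)

/-- A point of the network: a vertex, or the interior point of the edge `uv` at distance `t` from
`u` along this edge. -/
inductive Point (N : Network V) : Type _
  | vertex (v : V) : Point N
  | inner (u v : V) (adj : N.graph.Adj u v) (t : ℝ) (pos : 0 < t) (lt : t < N.len u v) : Point N

/-- The point of the edge `uv` at distance `t` from `u`, for `0 ≤ t ≤ len u v`. -/
noncomputable def edgePoint (u v : V) (adj : N.graph.Adj u v) (t : ℝ) : N.Point :=
  if h0 : 0 < t then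
    if h1 : t < N.len u v then .inner u v adj t h0 h1 else .vertex v
  else .vertex u

/-- The graph with the edge `uv` subdivided by one dummy vertex, `none`. -/
def subdivision (u v : V) : SimpleGraph (Option V) where
  Adj
    | some a, some b => N.graph.Adj a b ∧ s(a, b) ≠ s(u, v)
    | some a, none => a = u ∨ a = v
    | none, some b => b = u ∨ b = v
    | none, none => False
  symm := ⟨by
    rintro (_ | a) (_ | b) h
    · exact h
    · exact h
    · exact h
    · exact ⟨h.1.symm, by rw [Sym2.eq_swap]; exact h.2⟩⟩
  loopless := ⟨by
    rintro (_ | a) h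
    · exact h
    · exact N.graph.loopless.irrefl a h.1⟩

/-- The edge lengths after subdividing `uv` at distance `t` from `u`. -/
noncomputable def subdivisionLen (u v : V) (t : ℝ) : Option V → Option V → ℝ
  | some a, some b => N.len a b
  | some a, none => if a = u then t else N.len u v - t
  | none, some b => if b = u then t else N.len u v - t
  | none, none => 0

/-- The graph on `V` obtained by suppressing the dummy vertex: its two incident edges, if both are
present, are merged into one edge. -/
def suppress (T : SimpleGraph (Option V)) : SimpleGraph V where
  Adj a b := a ≠ b ∧ (T.Adj (some a) (some b) ∨ (T.Adj none (some a) ∧ T.Adj none (some b)))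
  symm := ⟨fun _ _ h => ⟨h.1.symm, h.2.imp (fun h => h.symm) (fun h => ⟨h.2, h.1⟩)⟩⟩
  loopless := ⟨fun _ h => h.1 rfl⟩

/-- The distance between a point and a vertex. -/
noncomputable def dist : N.Point → V → ℝ
  | .vertex u, v => graphDist N.graph N.len u v
  | .inner a b _ t _ _, v => graphDist (N.subdivision a b) (N.subdivisionLen a b t) none (some v)

/-- The shortest path trees of a point, as subgraphs of the graph (without a dummy vertex). -/
def shortestPathTrees : N.Point → Set (SimpleGraph V)
  | .vertex u => {T | IsShortestPathTree N.graph N.len u T}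
  | .inner a b _ t _ _ =>
      {T | ∃ T', IsShortestPathTree (N.subdivision a b) (N.subdivisionLen a b t) none T' ∧
        T = suppress T'}

/-- `φ(x, G)`: the minimum, over all `k`-subtrees `K` of shortest path trees of `x`, of the maximum
weighted distance from `x` to a vertex of `K`. -/
noncomputable def phi (k : ℕ) (x : N.Point) : ℝ :=
  sInf {c | ∃ T ∈ N.shortestPathTrees x, ∃ K : T.Subgraph, K.coe.IsTree ∧ K.verts.ncard = k ∧
    c = sSup ((fun v => N.weight v * N.dist x v) '' K.verts)}

/-- `λ*`: the minimum of `φ(x, G)` over all points `x`. -/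
noncomputable def lambdaStar (k : ℕ) : ℝ :=
  sInf (Set.range (N.phi k))

/-- `S` together with the point `x` induces a connected subtree in a shortest path tree of `x`;
here an interior point of an edge is a dummy vertex of its shortest path trees. -/
def IsSelfInclusive : N.Point → Set V → Prop
  | .vertex u, S => u ∈ S ∧ ∃ T, IsShortestPathTree N.graph N.len u T ∧ (T.induce S).Connected
  | .inner a b _ t _ _, S =>
      ∃ T, IsShortestPathTree (N.subdivision a b) (N.subdivisionLen a b t) none T ∧
        (T.induce (insert none (some '' S))).Connected

/-- The number of vertices of a largest self-inclusive subtree of `x` that `x` covers under `lam`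
(`0` if there is none). -/
noncomputable def largestCovered (lam : ℝ) (x : N.Point) : ℕ :=
  sSup {c | ∃ S : Set V, N.IsSelfInclusive x S ∧ (∀ v ∈ S, N.weight v * N.dist x v ≤ lam) ∧
    c = S.ncard}

end Network

/-- The breakpoints of a function on `[0, L]`: the points near which it is not constant. -/
def breakpoints (f : ℝ → ℕ) (L : ℝ) : Set ℝ :=
  {t | t ∈ Icc 0 L ∧ ¬ ∀ᶠ t' in 𝓝[Icc 0 L] t, f t' = f t}

/-! ### A real random access machine

The memory consists of arrays of natural numbers and arrays of real numbers; the name of an array is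
part of the program, an index into it is computed. Every arithmetic operation, comparison, memory
access and literal costs one step. Stored natural numbers and the indices of stores are
bounded by the word bound `W`; a computation that exceeds it is stuck. -/

structure Memory where
  nat : ℕ → ℕ → ℕ
  real : ℕ → ℕ → ℝ

namespace Memory

def setNat (s : Memory) (a i x : ℕ) : Memory :=
  { s with nat := Function.update s.nat a (Function.update (s.nat a) i x) }

noncomputable def setReal (s : Memory) (a i : ℕ) (x : ℝ) : Memory :=
  { s with real := Function.update s.real a (Function.update (s.real a) i x) }

end Memory

/-- Expressions for natural numbers. -/
inductive NatExpr : Type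
  | lit (c : ℕ)
  | load (a : ℕ) (i : NatExpr)
  | add (e f : NatExpr)
  | sub (e f : NatExpr)
  | mul (e f : NatExpr)
  | div (e f : NatExpr)

namespace NatExpr

def eval (s : Memory) : NatExpr → ℕ
  | lit c => c
  | load a i => s.nat a (i.eval s)
  | add e f => e.eval s + f.eval s
  | sub e f => e.eval s - f.eval s
  | mul e f => e.eval s * f.eval s
  | div e f => e.eval s / f.eval s

def cost : NatExpr → ℕ
  | lit _ => 1
  | load _ i => i.cost + 1
  | add e f => e.cost + f.cost + 1
  | sub e f => e.cost + f.cost + 1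
  | mul e f => e.cost + f.cost + 1
  | div e f => e.cost + f.cost + 1

end NatExpr

/-- Expressions for real numbers. There is no rounding operation. -/
inductive RealExpr : Type
  | lit (c : ℚ)
  | load (a : ℕ) (i : NatExpr)
  | add (e f : RealExpr)
  | sub (e f : RealExpr)
  | mul (e f : RealExpr)
  | div (e f : RealExpr)

namespace RealExpr

noncomputable def eval (s : Memory) : RealExpr → ℝ
  | lit c => (c : ℝ)
  | load a i => s.real a (i.eval s)
  | add e f => e.eval s + f.eval s
  | sub e f => e.eval s - f.eval s
  | mul e f => e.eval s * f.eval s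
  | div e f => e.eval s / f.eval s

def cost : RealExpr → ℕ
  | lit _ => 1
  | load _ i => i.cost + 1
  | add e f => e.cost + f.cost + 1
  | sub e f => e.cost + f.cost + 1
  | mul e f => e.cost + f.cost + 1
  | div e f => e.cost + f.cost + 1

end RealExpr

/-- Tests. -/
inductive Test : Type
  | natLe (e f : NatExpr)
  | realLe (e f : RealExpr)
  | not (b : Test)
  | and (b c : Test)

namespace Test

def eval (s : Memory) : Test → Prop
  | natLe e f => e.eval s ≤ f.eval s
  | realLe e f => e.eval s ≤ f.eval s
  | not b => ¬ b.eval s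
  | and b c => b.eval s ∧ c.eval s

def cost : Test → ℕ
  | natLe e f => e.cost + f.cost + 1
  | realLe e f => e.cost + f.cost + 1
  | not b => b.cost + 1
  | and b c => b.cost + c.cost + 1

end Test

/-- Programs. -/
inductive Program : Type
  | skip
  | storeNat (a : ℕ) (i e : NatExpr)
  | storeReal (a : ℕ) (i : NatExpr) (e : RealExpr)
  | seq (p q : Program)
  | branch (b : Test) (p q : Program)
  | loop (b : Test) (p : Program)

open Program in
/-- `Runs W p s s' t`: with word bound `W`, the program `p` started in memory `s` halts in memory
`s'` after exactly `t` steps. (`loop b p` repeats `p` as long as `b` holds.) -/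
inductive Runs (W : ℕ) : Program → Memory → Memory → ℕ → Prop
  | skip (s : Memory) : Runs W skip s s 1
  | storeNat (s : Memory) (a : ℕ) (i e : NatExpr) (hi : i.eval s ≤ W) (he : e.eval s ≤ W) :
      Runs W (storeNat a i e) s (s.setNat a (i.eval s) (e.eval s)) (i.cost + e.cost + 1)
  | storeReal (s : Memory) (a : ℕ) (i : NatExpr) (e : RealExpr) (hi : i.eval s ≤ W) :
      Runs W (storeReal a i e) s (s.setReal a (i.eval s) (e.eval s)) (i.cost + e.cost + 1)
  | seq {p q : Program} {s s₁ s₂ : Memory} {t₁ t₂ : ℕ} (hp : Runs W p s s₁ t₁)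
      (hq : Runs W q s₁ s₂ t₂) : Runs W (seq p q) s s₂ (t₁ + t₂)
  | branch_true {b : Test} {p q : Program} {s s' : Memory} {t : ℕ} (hb : b.eval s)
      (hp : Runs W p s s' t) : Runs W (branch b p q) s s' (b.cost + t + 1)
  | branch_false {b : Test} {p q : Program} {s s' : Memory} {t : ℕ} (hb : ¬ b.eval s)
      (hq : Runs W q s s' t) : Runs W (branch b p q) s s' (b.cost + t + 1)
  | loop_done {b : Test} {p : Program} {s : Memory} (hb : ¬ b.eval s) :
      Runs W (loop b p) s s (b.cost + 1)
  | loop_step {b : Test} {p : Program} {s s₁ s₂ : Memory} {t₁ t₂ : ℕ} (hb : b.eval s)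
      (hp : Runs W p s s₁ t₁) (hl : Runs W (loop b p) s₁ s₂ t₂) :
      Runs W (loop b p) s s₂ (b.cost + t₁ + t₂ + 1)

/-! ### The input -/

/-- `ends` lists every edge of `G` exactly once, as a pair of end vertices, in any order and with
any orientation. -/
def IsEdgeList {n m : ℕ} (G : SimpleGraph (Fin n)) (ends : Fin m → Fin n × Fin n) : Prop :=
  Function.Injective (fun e => s((ends e).1, (ends e).2)) ∧
    Set.range (fun e => s((ends e).1, (ends e).2)) = G.edgeSet

/-- The natural numbers of the input: `n`, `m` and one further parameter `p` (array 0), and the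
first and second end vertices of the edges (arrays 1 and 2). All other cells hold `0`. -/
def inputNat {n m : ℕ} (ends : Fin m → Fin n × Fin n) (p : ℕ) : ℕ → ℕ → ℕ
  | 0, 0 => n
  | 0, 1 => m
  | 0, 2 => p
  | 1, i => if h : i < m then (ends ⟨i, h⟩).1 else 0
  | 2, i => if h : i < m then (ends ⟨i, h⟩).2 else 0
  | _, _ => 0

/-- The real numbers of the input: `lam` (array 0), the vertex weights (array 1), the edge lengths
(array 2), and the distance matrix, row by row (array 3). All other cells hold `0`. -/
noncomputable def inputReal {n m : ℕ} (N : Network (Fin n)) (ends : Fin m → Fin n × Fin n)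
    (lam : ℝ) : ℕ → ℕ → ℝ
  | 0, 0 => lam
  | 1, i => if h : i < n then N.weight ⟨i, h⟩ else 0
  | 2, i => if h : i < m then N.len (ends ⟨i, h⟩).1 (ends ⟨i, h⟩).2 else 0
  | 3, i =>
      if h : i < n * n then
        graphDist N.graph N.len ⟨i / n, Nat.div_lt_of_lt_mul h⟩
          ⟨i % n, Nat.mod_lt _ (Nat.pos_of_ne_zero (by rintro rfl; simp at h))⟩
      else 0
  | _, _ => 0

noncomputable def inputMemory {n m : ℕ} (N : Network (Fin n)) (ends : Fin m → Fin n × Fin n)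
    (p : ℕ) (lam : ℝ) : Memory where
  nat := inputNat ends p
  real := inputReal N ends lam

theorem IsEdgeList.adj {n m : ℕ} {G : SimpleGraph (Fin n)} {ends : Fin m → Fin n × Fin n}
    (h : IsEdgeList G ends) (e : Fin m) : G.Adj (ends e).1 (ends e).2 := by
  rw [← SimpleGraph.mem_edgeSet, ← h.2]
  exact ⟨e, rfl⟩

/-- The function `t ↦ f(e, x)`, where `x` is the point at distance `t` from the first end vertex of
the edge `e`: the size of a largest self-inclusive subtree of `x` covered by `x` under `lam`. -/
noncomputable def edgeFun {n m : ℕ} (N : Network (Fin n)) (ends : Fin m → Fin n × Fin n)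
    (h : IsEdgeList N.graph ends) (lam : ℝ) (e : Fin m) (t : ℝ) : ℕ :=
  N.largestCovered lam (N.edgePoint (ends e).1 (ends e).2 (h.adj e) t)

/-- The memory `s` holds the piecewise constant function `f` on `[0, L]`: the number of its
breakpoints (array 0 of naturals, cell 0), the breakpoints in increasing order (array 0 of reals),
the values of `f` at the breakpoints (array 1 of naturals), and its values at the points of
`[0, L]` before, between and after the breakpoints (array 2 of naturals). -/
def HoldsFunction (s : Memory) (f : ℝ → ℕ) (L : ℝ) : Prop :=
  (breakpoints f L).Finite ∧
  s.nat 0 0 = (breakpoints f L).ncard ∧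
  StrictMonoOn (s.real 0) (Set.Iio (s.nat 0 0)) ∧
  s.real 0 '' Set.Iio (s.nat 0 0) = breakpoints f L ∧
  (∀ i < s.nat 0 0, s.nat 1 i = f (s.real 0 i)) ∧
  ∀ t ∈ Set.Icc 0 L, t ∉ breakpoints f L →
    f t = s.nat 2 {b | b ∈ breakpoints f L ∧ b < t}.ncard

end KCenter

namespace KCenter
open Set Filter Topology

/-! ### Shortest path distances and shortest path trees of a weighted graph -/

section Walks

variable {X : Type*} {H : SimpleGraph X} {len : X → X → ℝ}

/-! Shortest path trees are replaced by tight arcs. An arc from `a` to `b` is tight if it ends a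
shortest path from the root; since lengths are positive, a shortest path tree is exactly a choice of
one tight predecessor for every vertex other than the root. Hence a set containing the root is a
connected part of some shortest path tree if and only if each of its other vertices has a tight
predecessor in the set (`exists_shortestPathTree_iff`). This property is preserved under unions, so
among the covered sets of this kind there is a greatest one: the vertices reached along tight arcs
through covered vertices only (`Reach`). Therefore f(e,t) is a plain count
(`largestCovered_edgePoint`).

On an edge uv of length L, the distance from the point at t to w is min(t + d(u,w), L - t + d(v,w)).
Let A w be the largest t for which w is reached from u after a detour of length t, let B w be the
same for v, and let τ be the t at which the two ways to w have equal length. Then w is counted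
exactly when t ≤ min(τ, A w) or t ≥ max(τ, L - B w) (`reachCount_eq_tally`). Each vertex is missing
on one open interval only, so f has at most 2n breakpoints, and sorting the ends of these intervals
and sweeping over them tabulates f.

The bounds A come from a bottleneck recursion over tight arcs: the bound of b is the maximum, over
tight predecessors a, of min(A a, lam / w_b - d(u,b)). Relaxing the edges in increasing order of
d(u,a) + d(u,b) evaluates it in one pass (`RelaxInv.step_tight`). Sorting dominates, which gives
O((m+n) log n) per edge, as m ≤ n².

For the decision, a subtree of a shortest path tree need not contain the root, or the dummy vertex.
If it does not, its vertex closest to the root can serve as the centre, and no distance grows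
(`exists_isSelfInclusive_of_subtree`). So λ* ≤ lam holds if and only if some point covers a
self-inclusive set of k vertices (`exists_phi_le_iff`), and it suffices to inspect the tables of all
edges. The intervals on which a vertex is missing are open, so the maximum of f on an edge is
attained at 0 or at a breakpoint. Existence of λ* follows as covering is a closed condition in the
pair (lam, t) and edges are compact (`isLeast_lambdaStar`).

The algorithms are programs of the machine, verified by a weakest precondition calculus that bounds
running times (`Wp`, `wp_loop`); sorting uses a tournament tree. -/

theorem walkLength_nonneg (hp : ∀ a b, H.Adj a b → 0 < len a b) {a b : X} (p : H.Walk a b) :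
    0 ≤ walkLength len p := by
  induction p with
  | nil => exact le_rfl
  | cons h p ih => exact add_nonneg (hp _ _ h).le ih

theorem walkLength_append {a b c : X} (p : H.Walk a b) (q : H.Walk b c) :
    walkLength len (p.append q) = walkLength len p + walkLength len q := by
  induction p with
  | nil => simp [walkLength]
  | cons h p ih => simp [walkLength, ih, add_assoc]

theorem graphDist_le (hp : ∀ a b, H.Adj a b → 0 < len a b) {a b : X} (p : H.Walk a b) :
    graphDist H len a b ≤ walkLength len p :=
  csInf_le ⟨0, by rintro c ⟨p, rfl⟩; exact walkLength_nonneg hp p⟩ ⟨p, rfl⟩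

theorem le_graphDist (hc : H.Connected) {a b : X} {c : ℝ}
    (h : ∀ p : H.Walk a b, c ≤ walkLength len p) : c ≤ graphDist H len a b := by
  obtain ⟨p⟩ := hc.preconnected a b
  exact le_csInf ⟨_, p, rfl⟩ (by rintro _ ⟨p, rfl⟩; exact h p)

/-- The arc from `a` to `b` is tight for the potential `D`. -/
def Tight (H : SimpleGraph X) (len : X → X → ℝ) (D : X → ℝ) (a b : X) : Prop :=
  H.Adj a b ∧ D a + len a b = D b

/-- The characterization of the distances from `r` by local conditions. -/
structure IsDistance (H : SimpleGraph X) (len : X → X → ℝ) (r : X) (D : X → ℝ) : Prop where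
  root : D r = 0
  le : ∀ a b, H.Adj a b → D b ≤ D a + len a b
  tight : ∀ b, b ≠ r → ∃ a, Tight H len D a b

/-- This stands in for induction along shortest paths: tight arcs strictly raise the potential. -/
theorem finite_potential_induction [Finite X] (D : X → ℝ) {P : X → Prop}
    (h : ∀ b, (∀ a, D a < D b → P a) → P b) : ∀ b, P b := by
  have : WellFounded (fun a b => D a < D b) := by
    have : IsTrans X (fun a b => D a < D b) := ⟨fun _ _ _ => lt_trans⟩
    have : Std.Irrefl (fun a b => D a < D b) := ⟨fun _ => lt_irrefl _⟩
    exact Finite.wellFounded_of_trans_of_irrefl _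
  exact fun b => this.induction b h

theorem IsDistance.le_walkLength {r : X} {D : X → ℝ} (hD : IsDistance H len r D) {a b : X}
    (p : H.Walk a b) : D b ≤ D a + walkLength len p := by
  induction p with
  | nil => simp [walkLength]
  | cons h p ih => have := hD.le _ _ h; simp only [walkLength]; linarith

theorem Tight.lt {D : X → ℝ} (hp : ∀ a b, H.Adj a b → 0 < len a b) {a b : X}
    (h : Tight H len D a b) : D a < D b := by
  have := hp _ _ h.1
  linarith [h.2]

theorem IsDistance.exists_walk [Finite X] (hp : ∀ a b, H.Adj a b → 0 < len a b) {r : X}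
    {D : X → ℝ} (hD : IsDistance H len r D) :
    ∀ b, ∃ p : H.Walk r b, walkLength len p ≤ D b := by
  refine finite_potential_induction D fun b ih => ?_
  by_cases hb : b = r
  · subst hb
    exact ⟨.nil, hD.root.ge⟩
  · obtain ⟨a, hab⟩ := hD.tight b hb
    obtain ⟨p, hle⟩ := ih a (hab.lt hp)
    refine ⟨p.append (.cons hab.1 .nil), ?_⟩
    rw [walkLength_append]
    simp only [walkLength]
    linarith [hab.2]

theorem IsDistance.connected [Finite X] (hp : ∀ a b, H.Adj a b → 0 < len a b) {r : X}
    {D : X → ℝ} (hD : IsDistance H len r D) : H.Connected := by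
  have : Nonempty X := ⟨r⟩
  refine SimpleGraph.Connected.mk fun a b => ?_
  obtain ⟨p, -⟩ := hD.exists_walk hp a
  obtain ⟨q, -⟩ := hD.exists_walk hp b
  exact ⟨p.reverse.append q⟩

/-- A potential that grows along each edge by at most its length bounds all walks from below, and
following tight arcs back to the root attains the bound. Distances in subdivisions and in trees are
identified in this way. -/
theorem IsDistance.graphDist_eq [Finite X] (hp : ∀ a b, H.Adj a b → 0 < len a b) {r : X}
    {D : X → ℝ} (hD : IsDistance H len r D) : graphDist H len r = D := by
  funext b
  obtain ⟨p, hle⟩ := hD.exists_walk hp b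
  refine le_antisymm ((graphDist_le hp p).trans hle) (le_graphDist (hD.connected hp) fun p => ?_)
  simpa [hD.root] using hD.le_walkLength p

theorem graphDist_self (hp : ∀ a b, H.Adj a b → 0 < len a b) (hc : H.Connected) (r : X) :
    graphDist H len r r = 0 :=
  le_antisymm (graphDist_le hp .nil) (le_graphDist hc fun p => walkLength_nonneg hp p)

theorem graphDist_nonneg (hp : ∀ a b, H.Adj a b → 0 < len a b) (hc : H.Connected) (r a : X) :
    0 ≤ graphDist H len r a :=
  le_graphDist hc fun p => walkLength_nonneg hp p

theorem graphDist_le_add_len (hp : ∀ a b, H.Adj a b → 0 < len a b) (hc : H.Connected) (r : X)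
    {a b : X} (h : H.Adj a b) : graphDist H len r b ≤ graphDist H len r a + len a b := by
  rw [← sub_le_iff_le_add]
  refine le_graphDist hc fun p => ?_
  have := graphDist_le hp (p.append (.cons h .nil))
  rw [walkLength_append] at this
  simp only [walkLength] at this
  linarith

/-- The walk is cut at its first arrival at `b`; an inequality between the lengths is all that is
needed. -/
theorem exists_last_arc (hp : ∀ a b, H.Adj a b → 0 < len a b) {r b : X} (p : H.Walk r b) :
    b ≠ r → ∃ a, H.Adj a b ∧ ∃ q : H.Walk r a, walkLength len q + len a b ≤ walkLength len p := by
  induction p with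
  | nil => exact fun h => absurd rfl h
  | @cons u v w h p ih =>
    intro _
    by_cases hv : w = v
    · subst hv
      exact ⟨u, h, .nil, by simpa [walkLength] using walkLength_nonneg hp p⟩
    · obtain ⟨a, ha, q, hq⟩ := ih hv
      exact ⟨a, ha, .cons h q, by simp only [walkLength]; linarith⟩

theorem isDistance_graphDist [Finite X] (hp : ∀ a b, H.Adj a b → 0 < len a b)
    (hc : H.Connected) (r : X) : IsDistance H len r (graphDist H len r) where
  root := graphDist_self hp hc r
  le := fun _ _ h => graphDist_le_add_len hp hc r h
  tight := by
    intro b hb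
    obtain ⟨p⟩ := hc.preconnected r b
    obtain ⟨a₀, ha₀, -⟩ := exists_last_arc hp p hb
    -- Every walk to `b` contains an arc into `b`, so a neighbour minimizing the distance plus this
    -- arc is a tight predecessor.
    obtain ⟨a, ha, hmin⟩ := Set.exists_min_image {a | H.Adj a b}
      (fun a => graphDist H len r a + len a b) (Set.toFinite _) ⟨a₀, ha₀⟩
    refine ⟨a, ha, le_antisymm (le_graphDist hc fun p => ?_) (graphDist_le_add_len hp hc r ha)⟩
    obtain ⟨c, hcb, q, hq⟩ := exists_last_arc hp p hb
    have := graphDist_le hp q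
    have := hmin c hcb
    linarith

theorem graphDist_le_add [Finite X] (hp : ∀ a b, H.Adj a b → 0 < len a b)
    (hc : H.Connected) (r a b : X) :
    graphDist H len r b ≤ graphDist H len r a + graphDist H len a b := by
  rw [← sub_le_iff_le_add']
  refine le_graphDist hc fun p => ?_
  linarith [(isDistance_graphDist hp hc r).le_walkLength p]

/-! ### Trees given by parent functions -/

/-- The decreasing potential `μ` leads every vertex to the root, so the graph is connected; each
edge joins a vertex other than the root with its parent, so there are at most |X| - 1 edges. -/
theorem isTree_of_parent [Finite X] (G : SimpleGraph X) (r : X) (q : X → X) (μ : X → ℝ)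
    (hμ : ∀ x, x ≠ r → μ (q x) < μ x)
    (hG : ∀ a b, G.Adj a b ↔ (a ≠ r ∧ b = q a) ∨ (b ≠ r ∧ a = q b)) : G.IsTree := by
  classical
  have hreach : ∀ b, G.Reachable r b := by
    refine finite_potential_induction μ fun b ih => ?_
    by_cases hb : b = r
    · subst hb; exact SimpleGraph.Reachable.refl _
    · exact (ih _ (hμ b hb)).trans ((hG _ _).2 (Or.inr ⟨hb, rfl⟩)).reachable
  have : Nonempty X := ⟨r⟩
  have hconn : G.Connected :=
    SimpleGraph.Connected.mk fun a b => (hreach a).symm.trans (hreach b)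
  refine SimpleGraph.isTree_iff_connected_and_card.2 ⟨hconn,
    le_antisymm ?_ hconn.card_vert_le_card_edgeSet_add_one⟩
  have hsub : G.edgeSet ⊆ (fun x => s(x, q x)) '' {x | x ≠ r} := by
    intro e
    induction e with
    | h a b =>
      intro h
      rcases (hG a b).1 h with ⟨h1, h2⟩ | ⟨h1, h2⟩
      · exact ⟨a, h1, by rw [h2]⟩
      · exact ⟨b, h1, by rw [h2, Sym2.eq_swap]⟩
  have h1 : G.edgeSet.ncard ≤ {x : X | x ≠ r}.ncard :=
    (Set.ncard_le_ncard hsub (Set.toFinite _)).trans (Set.ncard_image_le (Set.toFinite _))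
  have h2 : {x : X | x ≠ r}.ncard + 1 = Nat.card X := by
    rw [← Set.ncard_univ, ← Set.ncard_sdiff_singleton_add_one (Set.mem_univ r)]
    congr 2
    ext; simp
  rw [Nat.card_coe_set_eq, ← h2]
  omega

/-- A shortest path tree is given by a function that maps each vertex to a tight predecessor. -/
theorem IsShortestPathTree.exists_parent [Finite X] (hp : ∀ a b, H.Adj a b → 0 < len a b)
    {r : X} {T : SimpleGraph X} (hT : IsShortestPathTree H len r T) :
    ∃ q : X → X, (∀ x, x ≠ r → Tight H len (graphDist H len r) (q x) x) ∧
      ∀ a b, T.Adj a b ↔ (a ≠ r ∧ b = q a) ∨ (b ≠ r ∧ a = q b) := by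
  classical
  obtain ⟨hle, htree, hdist⟩ := hT
  have hpT : ∀ a b, T.Adj a b → 0 < len a b := fun a b h => hp a b (hle h)
  have hD := isDistance_graphDist hpT htree.connected r
  have heq : graphDist T len r = graphDist H len r := funext hdist
  rw [heq] at hD
  choose! q hq using hD.tight
  have hq' : ∀ x, x ≠ r → Tight H len (graphDist H len r) (q x) x :=
    fun x hx => ⟨hle (hq x hx).1, (hq x hx).2⟩
  refine ⟨q, hq', fun a b => ⟨fun h => ?_, ?_⟩⟩
  -- Parents are strictly closer to the root, so two vertices cannot be parents of each other and
  -- the parent edges are distinct. There are |X| - 1 of them, hence they are all the edges of the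
  -- tree.
  · have hinj : Set.InjOn (fun x => s(x, q x)) {x | x ≠ r} := by
      intro x hx y hy hxy
      rcases Sym2.eq_iff.1 hxy with ⟨h1, -⟩ | ⟨h1, h2⟩
      · exact h1
      · have h3 := (hq' x hx).lt hp
        have h4 := (hq' y hy).lt hp
        rw [h2] at h3
        rw [← h1] at h4
        exact absurd h3 h4.asymm
    have hsub : (fun x => s(x, q x)) '' {x | x ≠ r} ⊆ T.edgeSet := by
      rintro _ ⟨x, hx, rfl⟩
      exact (hq x hx).1.symm
    have h2 : {x : X | x ≠ r}.ncard + 1 = Nat.card X := by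
      rw [← Set.ncard_univ, ← Set.ncard_sdiff_singleton_add_one (Set.mem_univ r)]
      congr 2
      ext; simp
    have h3 := (SimpleGraph.isTree_iff_connected_and_card.1 htree).2
    rw [Nat.card_coe_set_eq] at h3
    have heq := Set.eq_of_subset_of_ncard_le hsub
      (by rw [hinj.ncard_image]; omega) (Set.toFinite _)
    have hab : s(a, b) ∈ T.edgeSet := h
    rw [← heq] at hab
    obtain ⟨x, hx, hxe⟩ := hab
    rcases Sym2.eq_iff.1 hxe with ⟨h1, h2⟩ | ⟨h1, h2⟩
    · left; subst h1; exact ⟨hx, h2.symm⟩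
    · right; subst h1; exact ⟨hx, h2.symm⟩
  · rintro (⟨h1, rfl⟩ | ⟨h1, rfl⟩)
    · exact (hq a h1).1.symm
    · exact (hq b h1).1

/-- The graph whose edges join each vertex other than `r` with its parent. -/
def parentGraph (r : X) (q : X → X) : SimpleGraph X :=
  SimpleGraph.fromRel fun a b => b ≠ r ∧ a = q b

theorem parentGraph_adj {r : X} {q : X → X} (hq : ∀ x, x ≠ r → q x ≠ x) (a b : X) :
    (parentGraph r q).Adj a b ↔ (a ≠ r ∧ b = q a) ∨ (b ≠ r ∧ a = q b) := by
  simp only [parentGraph, SimpleGraph.fromRel_adj]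
  constructor
  · tauto
  · rintro (⟨h, rfl⟩ | ⟨h, rfl⟩)
    · exact ⟨(hq a h).symm, Or.inr ⟨h, rfl⟩⟩
    · exact ⟨hq b h, Or.inl ⟨h, rfl⟩⟩

/-- The distance function of `H` still satisfies the local conditions on the subgraph, because all
parent arcs are tight; hence it is the distance function of the tree. -/
theorem isShortestPathTree_parentGraph [Finite X] (hp : ∀ a b, H.Adj a b → 0 < len a b) (hc : H.Connected)
    {r : X} {q : X → X}
    (hq : ∀ x, x ≠ r → Tight H len (graphDist H len r) (q x) x) :
    IsShortestPathTree H len r (parentGraph r q) := by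
  have hne : ∀ x, x ≠ r → q x ≠ x := fun x hx => (hq x hx).1.ne
  have hadj := parentGraph_adj hne
  have hD := isDistance_graphDist hp hc r
  have hle : parentGraph r q ≤ H := by
    intro a b h
    rcases (hadj a b).1 h with ⟨h1, rfl⟩ | ⟨h1, rfl⟩
    · exact (hq a h1).1.symm
    · exact (hq b h1).1
  refine ⟨hle, isTree_of_parent _ r q (graphDist H len r) (fun x hx => (hq x hx).lt hp) hadj, ?_⟩
  refine congrFun (IsDistance.graphDist_eq (fun a b h => hp a b (hle h)) ⟨hD.root, ?_, ?_⟩)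
  · exact fun a b h => hD.le a b (hle h)
  · exact fun b hb => ⟨q b, (hadj _ _).2 (Or.inr ⟨hb, rfl⟩), (hq b hb).2⟩

/-- Every vertex of `S` other than the root has a tight predecessor in `S`. -/
def TightClosed (H : SimpleGraph X) (len : X → X → ℝ) (r : X) (S : Set X) : Prop :=
  ∀ b ∈ S, b ≠ r → ∃ a ∈ S, Tight H len (graphDist H len r) a b

/-- A nonempty connected part of a shortest path tree contains, with every vertex other than its
top vertex, a tight predecessor. -/
theorem IsShortestPathTree.exists_top [Finite X] (hp : ∀ a b, H.Adj a b → 0 < len a b)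
    {r : X} {T : SimpleGraph X} (hT : IsShortestPathTree H len r T) {W : Set X}
    (hne : W.Nonempty)
    (hW : ∀ Z ⊆ W, Z.Nonempty → (∀ z ∈ Z, ∀ y ∈ W, T.Adj z y → y ∈ Z) → W ⊆ Z) :
    ∃ c ∈ W, (∀ b ∈ W, graphDist H len r c ≤ graphDist H len r b) ∧
      ∀ b ∈ W, b ≠ c → ∃ a ∈ W, Tight H len (graphDist H len r) a b := by
  obtain ⟨q, hq, hadj⟩ := hT.exists_parent hp
  obtain ⟨c, hc, hmin⟩ := Set.exists_min_image W (graphDist H len r) (Set.toFinite _) hne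
  refine ⟨c, hc, hmin, fun b hb hbc => ?_⟩
  by_contra hcon
  push Not at hcon
  let R : X → X → Prop := fun z y => z ≠ r ∧ y = q z
  have hR : ∀ z y, R z y → graphDist H len r y < graphDist H len r z := by
    rintro z _ ⟨hz, rfl⟩
    exact (hq z hz).lt hp
  -- The parent of `b` is outside `W`, so the descendants of `b` in `W` are closed under adjacency
  -- and fill `W`. Then `c` descends from `b`, which contradicts the minimal distance of `c`.
  have hsub := hW {z | z ∈ W ∧ Relation.ReflTransGen R z b} (fun z hz => hz.1)
    ⟨b, hb, .refl⟩ (by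
      rintro z ⟨hz, hzb⟩ y hy hzy
      refine ⟨hy, ?_⟩
      rcases (hadj z y).1 hzy with ⟨h1, rfl⟩ | ⟨h1, rfl⟩
      · rcases Relation.ReflTransGen.cases_head hzb with h | ⟨x, hx, hxb⟩
        · subst h
          exact absurd (hq z h1) (hcon _ hy)
        · rw [hx.2] at hxb
          exact hxb
      · exact .head ⟨h1, rfl⟩ hzb)
  rcases Relation.ReflTransGen.cases_head (hsub hc).2 with h | ⟨x, hx, hxb⟩
  · exact hbc h.symm
  · have h1 := hR _ _ hx
    have h2 : ∀ y, Relation.ReflTransGen R x y → graphDist H len r y ≤ graphDist H len r x := by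
      intro y hy
      induction hy with
      | refl => exact le_rfl
      | tail _ h ih => exact (hR _ _ h).le.trans ih
    replace h2 := h2 b hxb
    exact absurd (hmin b hb) (not_le.2 (h2.trans_lt h1))

theorem closed_of_induce_connected {T : SimpleGraph X} {W : Set X}
    (h : (T.induce W).Connected) :
    ∀ Z ⊆ W, Z.Nonempty → (∀ z ∈ Z, ∀ y ∈ W, T.Adj z y → y ∈ Z) → W ⊆ Z := by
  rintro Z hZ ⟨z, hz⟩ hcl w hw
  obtain ⟨p⟩ := h.preconnected ⟨z, hZ hz⟩ ⟨w, hw⟩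
  have : ∀ {a b : W}, (T.induce W).Walk a b → a.1 ∈ Z → b.1 ∈ Z := by
    intro a b p
    induction p with
    | nil => exact id
    | cons hab _ ih => exact fun ha => ih (hcl _ ha _ (Subtype.prop _) hab)
  exact this p hz

theorem IsShortestPathTree.tightClosed [Finite X] (hp : ∀ a b, H.Adj a b → 0 < len a b)
    (hc : H.Connected) {r : X} {T : SimpleGraph X} (hT : IsShortestPathTree H len r T) {W : Set X}
    (hr : r ∈ W) (hW : (T.induce W).Connected) : TightClosed H len r W := by
  obtain ⟨c, hcW, hmin, htight⟩ := hT.exists_top hp ⟨r, hr⟩ (closed_of_induce_connected hW)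
  have hD := isDistance_graphDist hp hc r
  have : c = r := by
    by_contra hne
    obtain ⟨a, ha⟩ := hD.tight c hne
    have h1 := ha.lt hp
    have h2 := hmin r hr
    rw [hD.root] at h2
    linarith [graphDist_nonneg hp hc r a]
  subst this
  exact htight

theorem TightClosed.exists_parent [Finite X] (hp : ∀ a b, H.Adj a b → 0 < len a b)
    (hc : H.Connected) {r : X} {W : Set X} (hW : TightClosed H len r W) :
    ∃ q : X → X, (∀ x, x ≠ r → Tight H len (graphDist H len r) (q x) x) ∧
      ∀ x ∈ W, x ≠ r → q x ∈ W := by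
  have hD := isDistance_graphDist hp hc r
  have : ∀ x, ∃ y, x ≠ r → (Tight H len (graphDist H len r) y x ∧ (x ∈ W → y ∈ W)) := by
    intro x
    by_cases hx : x = r
    · exact ⟨x, fun h => absurd hx h⟩
    · by_cases hxW : x ∈ W
      · obtain ⟨y, hy, hyx⟩ := hW x hxW hx
        exact ⟨y, fun _ => ⟨hyx, fun _ => hy⟩⟩
      · obtain ⟨y, hyx⟩ := hD.tight x hx
        exact ⟨y, fun _ => ⟨hyx, fun h => absurd h hxW⟩⟩
  choose q hq using this
  exact ⟨q, fun x hx => (hq x hx).1, fun x hxW hx => (hq x hx).2 hxW⟩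

theorem induce_connected_of_parent [Finite X] {T : SimpleGraph X} {r : X} {W : Set X}
    (hr : r ∈ W) (q : X → X) (μ : X → ℝ) (hμ : ∀ x ∈ W, x ≠ r → μ (q x) < μ x)
    (hq : ∀ x ∈ W, x ≠ r → q x ∈ W) (hT : ∀ x ∈ W, x ≠ r → T.Adj (q x) x) :
    (T.induce W).Connected := by
  have hreach : ∀ b, ∀ hb : b ∈ W, (T.induce W).Reachable ⟨r, hr⟩ ⟨b, hb⟩ := by
    refine finite_potential_induction μ fun b ih hb => ?_
    by_cases hbr : b = r
    · subst hbr; exact SimpleGraph.Reachable.refl _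
    · refine (ih _ (hμ b hb hbr) (hq b hb hbr)).trans (SimpleGraph.Adj.reachable ?_)
      exact hT b hb hbr
  have : Nonempty W := ⟨⟨r, hr⟩⟩
  exact SimpleGraph.Connected.mk fun a b => (hreach a a.2).symm.trans (hreach b b.2)

/-- A set containing the root is a connected part of a shortest path tree if and only if it is
closed under some choice of tight predecessors. -/
theorem exists_shortestPathTree_iff [Finite X] (hp : ∀ a b, H.Adj a b → 0 < len a b) (hc : H.Connected)
    {r : X} {W : Set X} (hr : r ∈ W) :
    (∃ T, IsShortestPathTree H len r T ∧ (T.induce W).Connected) ↔ TightClosed H len r W := by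
  constructor
  · rintro ⟨T, hT, hTW⟩
    exact hT.tightClosed hp hc hr hTW
  · intro hW
    obtain ⟨q, hq, hqW⟩ := hW.exists_parent hp hc
    refine ⟨_, isShortestPathTree_parentGraph hp hc hq, induce_connected_of_parent hr q
      (graphDist H len r) (fun x _ hx => (hq x hx).lt hp) hqW fun x _ hx => ?_⟩
    exact (parentGraph_adj (fun x hx => (hq x hx).1.ne) _ _).2 (Or.inr ⟨hx, rfl⟩)

/-- A tight-closed set can be shrunk to any smaller positive size. -/
theorem TightClosed.exists_subset [Finite X] (hp : ∀ a b, H.Adj a b → 0 < len a b)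
    (hc : H.Connected) {r : X} {j : ℕ} (hj : 1 ≤ j) (W : Set X) (hr : r ∈ W)
    (hW : TightClosed H len r W) (hcard : j ≤ W.ncard) :
    ∃ U ⊆ W, r ∈ U ∧ TightClosed H len r U ∧ U.ncard = j := by
  induction hn : W.ncard - j generalizing W with
  | zero => exact ⟨W, Subset.rfl, hr, hW, by omega⟩
  | succ i ih =>
    have hD := isDistance_graphDist hp hc r
    -- A farthest vertex is a tight predecessor of no vertex of `W`, so it may be removed.
    obtain ⟨b, hb, hmax⟩ := Set.exists_max_image W (graphDist H len r) (Set.toFinite _) ⟨r, hr⟩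
    have hbr : b ≠ r := by
      rintro rfl
      have : 1 < W.ncard := by omega
      obtain ⟨x, hx, hxb⟩ := Set.exists_ne_of_one_lt_ncard this b
      obtain ⟨a, ha⟩ := hD.tight x hxb
      have h1 := ha.lt hp
      have h2 := hmax x hx
      rw [hD.root] at h2
      linarith [graphDist_nonneg hp hc b a]
    have hcard' : (W \ {b}).ncard = W.ncard - 1 := Set.ncard_sdiff_singleton_of_mem hb
    obtain ⟨U, hU, h⟩ := ih (W \ {b}) ⟨hr, fun h => hbr h.symm⟩ (by
      rintro x ⟨hx, -⟩ hxr
      obtain ⟨a, ha, hax⟩ := hW x hx hxr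
      refine ⟨a, ⟨ha, ?_⟩, hax⟩
      rintro rfl
      exact absurd (hmax x hx) (not_le.2 (hax.lt hp))) (by omega) (by omega)
    exact ⟨U, hU.trans Set.sdiff_subset, h⟩

end Walks

/-! ### Points of an edge: distances and the greatest covered set -/

namespace Network

variable {V : Type*} [DecidableEq V] [Finite V] (N : Network V)

/-- The distance between two vertices. -/
noncomputable abbrev vdist (u w : V) : ℝ := graphDist N.graph N.len u w

omit [DecidableEq V] in
theorem isDistance_vdist (u : V) : IsDistance N.graph N.len u (N.vdist u) :=
  isDistance_graphDist N.len_pos N.connected u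

/-- The distances from the point of the edge `uv` at distance `t` from `u`. -/
noncomputable def subdivisionDist (u v : V) (t : ℝ) : Option V → ℝ
  | none => 0
  | some w => min (t + N.vdist u w) (N.len u v - t + N.vdist v w)

variable {N}

omit [Finite V] in
theorem subdivisionLen_pos {u v : V} {t : ℝ} (h0 : 0 < t) (h1 : t < N.len u v) :
    ∀ a b, (N.subdivision u v).Adj a b → 0 < N.subdivisionLen u v t a b := by
  rintro (_ | a) (_ | b) h
  · exact h.elim
  · simp only [subdivisionLen]; split_ifs <;> linarith
  · simp only [subdivisionLen]; split_ifs <;> linarith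
  · exact N.len_pos a b h.1

omit [DecidableEq V] in
/-- A tight arc from `u` to `w` on a shortest path from an interior point of the edge `uv` is not
this edge. -/
theorem Tight.ne_edge_left {u v a w : V} {t : ℝ} (h0 : 0 < t)
    (hw : t + N.vdist u w ≤ N.len u v - t + N.vdist v w)
    (ha : Tight N.graph N.len (N.vdist u) a w) : s(a, w) ≠ s(u, v) := by
  intro h
  have hu := (N.isDistance_vdist u).root
  have hv := (N.isDistance_vdist v).root
  have := ha.2
  rcases Sym2.eq_iff.1 h with ⟨rfl, rfl⟩ | ⟨rfl, rfl⟩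
  · linarith
  · have := graphDist_nonneg N.len_pos N.connected w a
    have := N.len_pos _ _ ha.1
    linarith

omit [DecidableEq V] in
theorem Tight.ne_edge_right {u v a w : V} {t : ℝ} (h1 : t < N.len u v)
    (hw : N.len u v - t + N.vdist v w ≤ t + N.vdist u w)
    (ha : Tight N.graph N.len (N.vdist v) a w) : s(a, w) ≠ s(u, v) := by
  rw [Sym2.eq_swap (a := u)]
  refine Tight.ne_edge_left (t := N.len u v - t) (by linarith) ?_ ha
  rw [N.len_symm v u]
  linarith

/-- A shortest path leaves the point towards `u` or towards `v` and then follows tight arcs for that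
end vertex; these never use the subdivided edge, by `Tight.ne_edge_left` and `Tight.ne_edge_right`.
-/
theorem isDistance_subdivisionDist {u v : V} (adj : N.graph.Adj u v) {t : ℝ} (h0 : 0 < t)
    (h1 : t < N.len u v) :
    IsDistance (N.subdivision u v) (N.subdivisionLen u v t) none (N.subdivisionDist u v t) where
  root := rfl
  le := by
    have hu := (N.isDistance_vdist u).root
    have hv := (N.isDistance_vdist v).root
    have hn := graphDist_nonneg N.len_pos N.connected
    rintro (_ | a) (_ | b) h
    · exact h.elim
    · simp only [subdivisionLen, subdivisionDist]
      rcases h with rfl | rfl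
      · simp [hu]
      · rw [if_neg adj.ne']
        simp [hv]
    · simp only [subdivisionLen, subdivisionDist]
      have := hn u a
      have := hn v a
      split_ifs
      · exact add_nonneg (le_min (by linarith) (by linarith)) h0.le
      · exact add_nonneg (le_min (by linarith) (by linarith)) (by linarith)
    · simp only [subdivisionLen, subdivisionDist]
      have h2 := (N.isDistance_vdist u).le a b h.1
      have h3 := (N.isDistance_vdist v).le a b h.1
      rw [← min_add_add_right]
      exact min_le_min (by linarith) (by linarith)
  tight := by
    have hu := (N.isDistance_vdist u).root
    have hv := (N.isDistance_vdist v).root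
    have hn := graphDist_nonneg N.len_pos N.connected
    rintro (_ | w) hw
    · exact absurd rfl hw
    · rcases le_total (t + N.vdist u w) (N.len u v - t + N.vdist v w) with h | h
      · by_cases hwu : w = u
        · subst hwu
          refine ⟨none, Or.inl rfl, ?_⟩
          simp only [subdivisionLen, subdivisionDist]
          rw [min_eq_left h, hu]
          simp
        · obtain ⟨a, ha⟩ := (N.isDistance_vdist u).tight w hwu
          refine ⟨some a, ⟨ha.1, Tight.ne_edge_left h0 h ha⟩, ?_⟩
          have h3 := (N.isDistance_vdist v).le a w ha.1
          have h4 := ha.2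
          simp only [subdivisionLen, subdivisionDist]
          -- The predecessor is also at least as close through `u`: going back along the arc lowers
          -- the distance from `u` by the full length, and the one from `v` by at most that.
          rw [min_eq_left h, min_eq_left (by linarith)]
          linarith
      · by_cases hwv : w = v
        · subst hwv
          refine ⟨none, Or.inr rfl, ?_⟩
          simp only [subdivisionLen, subdivisionDist]
          rw [min_eq_right h, hv, if_neg adj.ne']
          simp
        · obtain ⟨a, ha⟩ := (N.isDistance_vdist v).tight w hwv
          refine ⟨some a, ⟨ha.1, Tight.ne_edge_right h1 h ha⟩, ?_⟩
          have h3 := (N.isDistance_vdist u).le a w ha.1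
          have h4 := ha.2
          simp only [subdivisionLen, subdivisionDist]
          rw [min_eq_right h, min_eq_right (by linarith)]
          linarith

/-- A graph with a distance potential is connected, and the midpoint provides one. -/
theorem subdivision_connected {u v : V} (adj : N.graph.Adj u v) : (N.subdivision u v).Connected :=
  have h : 0 < N.len u v := N.len_pos u v adj
  (isDistance_subdivisionDist adj (half_pos h) (half_lt_self h)).connected
    (subdivisionLen_pos (half_pos h) (half_lt_self h))

theorem graphDist_subdivision {u v : V} (adj : N.graph.Adj u v) {t : ℝ} (h0 : 0 < t)
    (h1 : t < N.len u v) :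
    graphDist (N.subdivision u v) (N.subdivisionLen u v t) none = N.subdivisionDist u v t :=
  (isDistance_subdivisionDist adj h0 h1).graphDist_eq (subdivisionLen_pos h0 h1)

variable (N)

/-- The vertices `w` for which some shortest path from `u` to `w`, preceded by a path of length
`t`, is covered under `lam`. -/
inductive Reach (lam : ℝ) (u : V) (t : ℝ) : V → Prop
  | root (h : N.weight u * t ≤ lam) : Reach lam u t u
  | step {a b : V} (ha : Reach lam u t a) (hab : Tight N.graph N.len (N.vdist u) a b)
      (h : N.weight b * (t + N.vdist u b) ≤ lam) : Reach lam u t b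

/-- The vertices that are connected, by a covered shortest path, with the point of the edge `uv` at
distance `t` from `u`. -/
def reachSet (lam : ℝ) (u v : V) (t : ℝ) : Set V :=
  {w | (t + N.vdist u w ≤ N.len u v - t + N.vdist v w ∧ N.Reach lam u t w) ∨
    (N.len u v - t + N.vdist v w ≤ t + N.vdist u w ∧ N.Reach lam v (N.len u v - t) w)}

variable {N}

omit [DecidableEq V] in
theorem Reach.le {lam : ℝ} {u : V} {t : ℝ} {w : V} (h : N.Reach lam u t w) :
    N.weight w * (t + N.vdist u w) ≤ lam := by
  cases h with
  | root h => rwa [(N.isDistance_vdist u).root, add_zero]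
  | step _ _ h => exact h

omit [DecidableEq V] [Finite V] in
theorem Reach.root' {lam : ℝ} {u : V} {t : ℝ} {w : V} (h : N.Reach lam u t w) :
    N.Reach lam u t u := by
  induction h with
  | root h => exact .root h
  | step _ _ _ ih => exact ih

/-- The supremum is attained by the greatest candidate `R`. If `R` is empty there may be no
candidate at all, and then the supremum of the empty set of naturals is 0, which is again the size
of `R`. -/
theorem largestCovered_eq_ncard {lam : ℝ} {x : N.Point} {R : Set V}
    (hsub : ∀ S, N.IsSelfInclusive x S → (∀ v ∈ S, N.weight v * N.dist x v ≤ lam) → S ⊆ R)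
    (hR : R.Nonempty → N.IsSelfInclusive x R) (hcov : ∀ v ∈ R, N.weight v * N.dist x v ≤ lam) :
    N.largestCovered lam x = R.ncard := by
  have hub : ∀ c ∈ {c | ∃ S : Set V, N.IsSelfInclusive x S ∧
      (∀ v ∈ S, N.weight v * N.dist x v ≤ lam) ∧ c = S.ncard}, c ≤ R.ncard := by
    rintro c ⟨S, h1, h2, rfl⟩
    exact Set.ncard_le_ncard (hsub S h1 h2) (Set.toFinite _)
  rcases R.eq_empty_or_nonempty with rfl | hne
  · rw [Set.ncard_empty] at hub ⊢
    exact Nat.le_zero.1 (csSup_le' hub)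
  · exact le_antisymm (csSup_le' hub) (le_csSup ⟨_, hub⟩ ⟨R, hR hne, hcov, rfl⟩)

theorem isSelfInclusive_vertex {u : V} {S : Set V} :
    N.IsSelfInclusive (.vertex u) S ↔ u ∈ S ∧ TightClosed N.graph N.len u S :=
  and_congr_right fun hu => exists_shortestPathTree_iff N.len_pos N.connected hu

theorem isSelfInclusive_inner {u v : V} (adj : N.graph.Adj u v) {t : ℝ} (h0 : 0 < t)
    (h1 : t < N.len u v) {S : Set V} : N.IsSelfInclusive (.inner u v adj t h0 h1) S ↔
      TightClosed (N.subdivision u v) (N.subdivisionLen u v t) none (insert none (some '' S)) :=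
  exists_shortestPathTree_iff (subdivisionLen_pos h0 h1) (subdivision_connected adj)
    (Set.mem_insert _ _)

/-- A covered self-inclusive set consists of reached vertices, by induction along its tight
predecessors; conversely the reached vertices are closed under the predecessors that reached them.
-/
theorem largestCovered_vertex (lam : ℝ) (u : V) :
    N.largestCovered lam (.vertex u) = {w | N.Reach lam u 0 w}.ncard := by
  have hd := N.isDistance_vdist u
  refine largestCovered_eq_ncard (fun S hS hcov => ?_) ?_ ?_
  · rw [isSelfInclusive_vertex] at hS
    change ∀ v ∈ S, N.weight v * N.vdist u v ≤ lam at hcov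
    refine finite_potential_induction (N.vdist u) fun b ih hb => ?_
    by_cases hbu : b = u
    · subst hbu
      have := hcov b hb
      rw [hd.root] at this
      exact .root this
    · obtain ⟨a, ha, hab⟩ := hS.2 b hb hbu
      have hca : N.Reach lam u 0 a := ih a (hab.lt N.len_pos) ha
      exact hca.step hab (by simpa using hcov b hb)
  · rintro ⟨w, hw⟩
    rw [isSelfInclusive_vertex]
    refine ⟨hw.root', fun b hb hbu => ?_⟩
    cases hb with
    | root => exact absurd rfl hbu
    | step ha hab _ => exact ⟨_, ha, hab⟩
  · intro w hw
    have := hw.le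
    rwa [zero_add] at this

/-- Tight arcs of the subdivision are translated into tight arcs for `u` or for `v`, depending on
the side from which their tail is reached. A vertex at equal distance through both sides may use
either. -/
theorem largestCovered_inner (lam : ℝ) {u v : V} (adj : N.graph.Adj u v) {t : ℝ} (h0 : 0 < t)
    (h1 : t < N.len u v) :
    N.largestCovered lam (.inner u v adj t h0 h1) = (N.reachSet lam u v t).ncard := by
  have hu := (N.isDistance_vdist u).root
  have hv := (N.isDistance_vdist v).root
  have hdist : ∀ w, N.dist (.inner u v adj t h0 h1) w =
      min (t + N.vdist u w) (N.len u v - t + N.vdist v w) :=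
    fun w => congrFun (graphDist_subdivision adj h0 h1) (some w)
  refine largestCovered_eq_ncard (fun S hS hcov => ?_) (fun _ => ?_) ?_
  · rw [isSelfInclusive_inner] at hS
    simp only [hdist] at hcov
    unfold TightClosed at hS
    rw [graphDist_subdivision adj h0 h1] at hS
    refine finite_potential_induction (fun w => N.subdivisionDist u v t (some w))
      fun b ih hb => ?_
    have hcb := hcov b hb
    obtain ⟨_ | a, ha, hab⟩ := hS (some b) (Or.inr ⟨b, hb, rfl⟩) (by simp)
    · have h2 := hab.2
      have hbuv : b = u ∨ b = v := hab.1
      simp only [subdivisionLen, subdivisionDist, zero_add] at h2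
      by_cases hbu : b = u
      · subst hbu
        rw [if_pos rfl] at h2
        have hle : t + N.vdist b b ≤ N.len b v - t + N.vdist v b := by
          rw [hu, add_zero]; exact h2.le.trans (min_le_right _ _)
        refine Or.inl ⟨hle, .root ?_⟩
        rwa [← h2] at hcb
      · obtain rfl := hbuv.resolve_left hbu
        rw [if_neg hbu] at h2
        have hle : N.len u b - t + N.vdist b b ≤ t + N.vdist u b := by
          rw [hv, add_zero]; exact h2.le.trans (min_le_left _ _)
        refine Or.inr ⟨hle, .root ?_⟩
        rwa [← h2] at hcb
    · have haS : a ∈ S := by simpa using ha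
      have h2 := hab.2
      have hadj : N.graph.Adj a b := hab.1.1
      have ihb := ih a (hab.lt (subdivisionLen_pos h0 h1)) haS
      simp only [subdivisionLen, subdivisionDist] at h2
      have h3 := (N.isDistance_vdist u).le a b hadj
      have h4 := (N.isDistance_vdist v).le a b hadj
      have h5 := min_le_left (t + N.vdist u b) (N.len u v - t + N.vdist v b)
      have h6 := min_le_right (t + N.vdist u b) (N.len u v - t + N.vdist v b)
      -- The distance of `b` equals that of `a` plus the arc, which is at least the way to `b` on
      -- the same side, which is at least the distance of `b`. So these are equal and the arc is
      -- tight for that end vertex.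
      rcases ihb with ⟨hle, hr⟩ | ⟨hle, hr⟩
      · rw [min_eq_left hle] at h2
        have h7 : min (t + N.vdist u b) (N.len u v - t + N.vdist v b) = t + N.vdist u b := by
          linarith
        rw [h7] at hcb h2
        exact Or.inl ⟨by linarith, .step hr ⟨hadj, by linarith⟩ hcb⟩
      · rw [min_eq_right hle] at h2
        have h7 : min (t + N.vdist u b) (N.len u v - t + N.vdist v b) =
            N.len u v - t + N.vdist v b := by linarith
        rw [h7] at hcb h2
        exact Or.inr ⟨by linarith, .step hr ⟨hadj, by linarith⟩ hcb⟩
  · rw [isSelfInclusive_inner]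
    unfold TightClosed
    rw [graphDist_subdivision adj h0 h1]
    rintro (_ | b) hb hne
    · exact absurd rfl hne
    · have hbR : b ∈ N.reachSet lam u v t := by simpa using hb
      rcases hbR with ⟨hle, hr⟩ | ⟨hle, hr⟩
      · cases hr with
        | root h =>
          refine ⟨none, Or.inl rfl, Or.inl rfl, ?_⟩
          simp only [subdivisionLen, subdivisionDist]
          rw [min_eq_left hle, hu]
          simp
        | @step a _ ha hab h =>
          have h3 := (N.isDistance_vdist v).le a b hab.1
          have h4 := hab.2
          -- The preference for the side of `u` passes to predecessors, which is why `reachSet`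
          -- requires it of the last vertex only.
          have hle' : t + N.vdist u a ≤ N.len u v - t + N.vdist v a := by linarith
          refine ⟨some a, Or.inr ⟨a, Or.inl ⟨hle', ha⟩, rfl⟩,
            ⟨hab.1, Tight.ne_edge_left h0 hle hab⟩, ?_⟩
          simp only [subdivisionLen, subdivisionDist]
          rw [min_eq_left hle, min_eq_left hle']
          linarith
      · cases hr with
        | root h =>
          refine ⟨none, Or.inl rfl, Or.inr rfl, ?_⟩
          simp only [subdivisionLen, subdivisionDist]
          rw [min_eq_right hle, hv, if_neg adj.ne']
          simp
        | @step a _ ha hab h =>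
          have h3 := (N.isDistance_vdist u).le a b hab.1
          have h4 := hab.2
          have hle' : N.len u v - t + N.vdist v a ≤ t + N.vdist u a := by linarith
          refine ⟨some a, Or.inr ⟨a, Or.inr ⟨hle', ha⟩, rfl⟩,
            ⟨hab.1, Tight.ne_edge_right h1 hle hab⟩, ?_⟩
          simp only [subdivisionLen, subdivisionDist]
          rw [min_eq_right hle, min_eq_right hle']
          linarith
  · intro w hw
    rw [hdist]
    rcases hw with ⟨hle, hr⟩ | ⟨hle, hr⟩
    · rw [min_eq_left hle]; exact hr.le
    · rw [min_eq_right hle]; exact hr.le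

omit [DecidableEq V] in
/-- If a shortest path from `u` to `w` passes through the edge `uv`, it is covered when its part
from `v` on is. -/
theorem Reach.of_across {lam : ℝ} {u v : V} (adj : N.graph.Adj u v) {w : V}
    (h : N.Reach lam v (N.len u v) w) (hw : N.len u v + N.vdist v w ≤ N.vdist u w) :
    N.Reach lam u 0 w := by
  have hd := N.isDistance_vdist u
  have hv := (N.isDistance_vdist v).root
  have hle : ∀ w, N.vdist u w ≤ N.len u v + N.vdist v w := fun w => by
    have h1 := graphDist_le_add N.len_pos N.connected u v w
    have h2 := hd.le u v adj
    rw [hd.root] at h2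
    linarith
  induction h with
  | root h =>
    have h0 : N.vdist u v = N.len u v := by linarith [hle v]
    refine .step (.root ?_) ⟨adj, by rw [hd.root, h0, zero_add]⟩ (by rwa [h0, zero_add])
    -- Covering `v` at a positive distance forces a positive bound, so `u` is covered at distance 0.
    rw [mul_zero]
    exact (mul_pos (N.weight_pos v) (N.len_pos u v adj)).le.trans h
  | @step a b ha hab h ih =>
    have h1 := hd.le a b hab.1
    have h2 := hab.2
    have h3 := hle a
    have h4 := hle b
    have h5 : N.vdist u b = N.len u v + N.vdist v b := by linarith
    exact .step (ih (by linarith)) ⟨hab.1, by linarith⟩ (by rwa [zero_add, h5])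

omit [DecidableEq V] in
-- The count for interior points remains valid at the end vertex: a vertex reached through `v` lies
-- on a shortest path from `u` that starts with the edge.
theorem reachSet_zero (lam : ℝ) {u v : V} (adj : N.graph.Adj u v) :
    N.reachSet lam u v 0 = {w | N.Reach lam u 0 w} := by
  have hd := N.isDistance_vdist u
  ext w
  constructor
  · rintro (⟨-, h⟩ | ⟨hle, h⟩)
    · exact h
    · rw [sub_zero] at h hle
      exact h.of_across adj (by linarith)
  · intro h
    have h1 := graphDist_le_add N.len_pos N.connected u v w
    have h2 := hd.le u v adj
    rw [hd.root] at h2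
    exact Or.inl ⟨by linarith, h⟩

omit [DecidableEq V] [Finite V] in
-- Reversing the edge transfers the case of the first end vertex to the second, and frees the result
-- from the orientation in the edge list.
theorem reachSet_swap (lam : ℝ) (u v : V) (t : ℝ) :
    N.reachSet lam v u (N.len v u - t) = N.reachSet lam u v t := by
  ext w
  simp only [reachSet, Set.mem_ofPred_eq, sub_sub_cancel, N.len_symm v u]
  exact or_comm

theorem largestCovered_edgePoint (lam : ℝ) {u v : V} (adj : N.graph.Adj u v) {t : ℝ}
    (h0 : 0 ≤ t) (h1 : t ≤ N.len u v) :
    N.largestCovered lam (N.edgePoint u v adj t) = (N.reachSet lam u v t).ncard := by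
  unfold edgePoint
  split_ifs with h2 h3
  · exact largestCovered_inner lam adj h2 h3
  · obtain rfl := le_antisymm h1 (not_lt.1 h3)
    rw [largestCovered_vertex, ← reachSet_zero lam adj.symm, ← reachSet_swap, sub_zero]
  · obtain rfl := le_antisymm (not_lt.1 h2) h0
    rw [largestCovered_vertex, reachSet_zero lam adj]

end Network

/-! ### Self-inclusive sets and subtrees of shortest path trees -/

namespace Network

variable {V : Type*} [DecidableEq V] [Finite V] {N : Network V}

omit [DecidableEq V] [Finite V] in
/-- A set closed under a parent function carries a subtree of any graph that contains the edges
between its vertices and their parents. -/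
theorem exists_subtree_of_parent [Finite V] {T : SimpleGraph V} {S : Set V} {c : V} (hc : c ∈ S)
    (q : V → V) (μ : V → ℝ) (hqS : ∀ a ∈ S, a ≠ c → q a ∈ S)
    (hμ : ∀ a ∈ S, a ≠ c → μ (q a) < μ a) (hT : ∀ a ∈ S, a ≠ c → T.Adj a (q a)) :
    ∃ K : T.Subgraph, K.coe.IsTree ∧ K.verts = S := by
  classical
  let K : T.Subgraph :=
    { verts := S
      Adj := fun a b => (a ∈ S ∧ a ≠ c ∧ b = q a) ∨ (b ∈ S ∧ b ≠ c ∧ a = q b)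
      adj_sub := by
        rintro a b (⟨h1, h2, rfl⟩ | ⟨h1, h2, rfl⟩)
        · exact hT a h1 h2
        · exact (hT b h1 h2).symm
      edge_vert := by
        rintro a b (⟨h1, h2, rfl⟩ | ⟨h1, h2, rfl⟩)
        · exact h1
        · exact hqS b h1 h2
      symm := ⟨fun a b h => h.symm⟩ }
  refine ⟨K, ?_, rfl⟩
  let Q : K.verts → K.verts := fun a => if h : a.1 = c then a else ⟨q a, hqS a a.2 h⟩
  have hQ : ∀ x : K.verts, x.1 ≠ c → (Q x).1 = q x := fun x hx => by
    simp only [Q, dif_neg hx]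
  refine isTree_of_parent K.coe ⟨c, hc⟩ Q (fun x => μ x) (fun x hx => ?_) fun a b => ?_
  · have hx' : x.1 ≠ c := fun h => hx (Subtype.ext h)
    rw [hQ x hx']
    exact hμ x x.2 hx'
  · have hne : ∀ x : K.verts, x ≠ ⟨c, hc⟩ ↔ x.1 ≠ c := fun x => not_congr Subtype.ext_iff
    rw [SimpleGraph.Subgraph.coe_adj, hne, hne]
    change ((a.1 ∈ S ∧ a.1 ≠ c ∧ b.1 = q a) ∨ (b.1 ∈ S ∧ b.1 ≠ c ∧ a.1 = q b)) ↔ _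
    refine or_congr ?_ ?_
    · refine ⟨fun ⟨_, h2, h3⟩ => ⟨h2, Subtype.ext (by rw [h3, hQ a h2])⟩,
        fun ⟨h2, h3⟩ => ⟨a.2, h2, by rw [h3, hQ a h2]⟩⟩
    · refine ⟨fun ⟨_, h2, h3⟩ => ⟨h2, Subtype.ext (by rw [h3, hQ b h2])⟩,
        fun ⟨h2, h3⟩ => ⟨b.2, h2, by rw [h3, hQ b h2]⟩⟩

theorem IsSelfInclusive.exists_subset {x : N.Point} {S : Set V} (hS : N.IsSelfInclusive x S)
    {k : ℕ} (hk : 1 ≤ k) (hkS : k ≤ S.ncard) :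
    ∃ U ⊆ S, N.IsSelfInclusive x U ∧ U.ncard = k := by
  cases x with
  | vertex u =>
    rw [isSelfInclusive_vertex] at hS
    obtain ⟨U, hU, h1, h2, h3⟩ :=
      hS.2.exists_subset N.len_pos N.connected hk S hS.1 hkS
    exact ⟨U, hU, isSelfInclusive_vertex.2 ⟨h1, h2⟩, h3⟩
  | inner u v adj t h0 h1 =>
    rw [isSelfInclusive_inner] at hS
    have hcard : ∀ S : Set V, (insert none (some '' S) : Set (Option V)).ncard = S.ncard + 1 := by
      intro S
      rw [Set.ncard_insert_of_notMem (by simp) (Set.toFinite _),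
        Set.ncard_image_of_injective _ (Option.some_injective V)]
    -- The dummy vertex belongs to the set in the subdivision, hence the size `k + 1`.
    obtain ⟨U, hU, h2, h3, h4⟩ := hS.exists_subset (subdivisionLen_pos h0 h1)
      (subdivision_connected adj) (j := k + 1) (by omega) _ (Set.mem_insert _ _)
      (by rw [hcard]; omega)
    have hUe : U = insert none (some '' (some ⁻¹' U)) := by
      ext (_ | a)
      · simp [h2]
      · simp
    refine ⟨some ⁻¹' U, fun a ha => by simpa using hU ha, ?_, ?_⟩
    · rw [isSelfInclusive_inner, ← hUe]
      exact h3
    · have := hcard (some ⁻¹' U)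
      rw [← hUe] at this
      omega

/-- Suppressing the dummy vertex keeps the set connected: the vertex of `S` closest to the point
becomes its root, and another child of the dummy vertex is joined to it by the restored edge. -/
theorem IsSelfInclusive.exists_subtree {x : N.Point} {S : Set V} (hS : N.IsSelfInclusive x S)
    (hne : S.Nonempty) :
    ∃ T ∈ N.shortestPathTrees x, ∃ K : T.Subgraph, K.coe.IsTree ∧ K.verts = S := by
  cases x with
  | vertex u =>
    rw [isSelfInclusive_vertex] at hS
    obtain ⟨q, hq, hqS⟩ := hS.2.exists_parent N.len_pos N.connected
    refine ⟨_, isShortestPathTree_parentGraph N.len_pos N.connected hq, ?_⟩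
    refine exists_subtree_of_parent hS.1 q (N.vdist u) hqS
      (fun a _ ha => (hq a ha).lt N.len_pos) fun a _ ha => ?_
    exact (parentGraph_adj (fun x hx => (hq x hx).1.ne) _ _).2 (Or.inl ⟨ha, rfl⟩)
  | inner u v adj t h0 h1 =>
    rw [isSelfInclusive_inner] at hS
    have hp := subdivisionLen_pos (N := N) h0 h1
    have hc := subdivision_connected (N := N) adj
    obtain ⟨q, hq, hqS⟩ := hS.exists_parent hp hc
    have hadj := parentGraph_adj (r := none) (fun x hx => (hq x hx).1.ne)
    refine ⟨_, ⟨_, isShortestPathTree_parentGraph hp hc hq, rfl⟩, ?_⟩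
    set D := graphDist (N.subdivision u v) (N.subdivisionLen u v t) none with hD
    obtain ⟨c, hcS, hmin⟩ :=
      Set.exists_min_image S (fun a => D (some a)) (Set.toFinite _) hne
    have hqc : q (some c) = none := by
      have h2 := hqS (some c) (Or.inr ⟨c, hcS, rfl⟩) (by simp)
      have h3 := (hq (some c) (by simp)).lt hp
      rcases hqe : q (some c) with _ | a
      · rfl
      · rw [hqe] at h2 h3
        exact absurd (hmin a (by simpa using h2)) (not_le.2 h3)
    have hpos : ∀ a : V, 0 < D (some a) := by
      intro a
      have h2 := (hq (some a) (by simp)).lt hp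
      exact (graphDist_nonneg hp hc _ _).trans_lt h2
    -- The default `c` is the new parent of a vertex whose parent was the dummy. The potential is
    -- reset to 0 at `c`, because the two ends of the edge may be equally far from the point.
    refine exists_subtree_of_parent hcS (fun a => (q (some a)).getD c)
      (fun a => if a = c then 0 else D (some a)) (fun a ha hac => ?_) (fun a ha hac => ?_)
      (fun a ha hac => ?_)
    · have h2 := hqS (some a) (Or.inr ⟨a, ha, rfl⟩) (by simp)
      rcases hqe : q (some a) with _ | b
      · simpa using hcS
      · rw [hqe] at h2
        simpa using h2
    · rw [if_neg hac]
      have h3 := (hq (some a) (by simp)).lt hp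
      rcases hqe : q (some a) with _ | b
      · simpa using hpos a
      · rw [hqe] at h3
        simp only [Option.getD_some]
        split_ifs
        · exact hpos a
        · exact h3
    · have h3 := (hq (some a) (by simp)).1.ne
      rcases hqe : q (some a) with _ | b
      · refine ⟨hac, Or.inr ⟨(hadj _ _).2 (Or.inr ⟨by simp, hqe.symm⟩),
          (hadj _ _).2 (Or.inr ⟨by simp, by simpa using hqc.symm⟩)⟩⟩
      · rw [hqe] at h3
        exact ⟨fun h => h3 (by simp [h]),
          Or.inl ((hadj _ _).2 (Or.inl ⟨by simp, by simp [hqe]⟩))⟩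

theorem isSelfInclusive_univ (x : N.Point) : N.IsSelfInclusive x Set.univ := by
  cases x with
  | vertex u =>
    refine isSelfInclusive_vertex.2 ⟨trivial, fun b _ hb => ?_⟩
    obtain ⟨a, ha⟩ := (N.isDistance_vdist u).tight b hb
    exact ⟨a, trivial, ha⟩
  | inner u v adj t h0 h1 =>
    refine (isSelfInclusive_inner adj h0 h1).2 fun b _ hb => ?_
    obtain ⟨a, ha⟩ := (isDistance_graphDist (subdivisionLen_pos h0 h1)
      (subdivision_connected adj) none).tight b hb
    exact ⟨a, by cases a <;> simp, ha⟩

/-- If in a set `S` every vertex other than `c` has a predecessor that is tight for some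
1-Lipschitz potential, then `S` is self-inclusive at `c`, and its distances from `c` are at most
the increments of the potential. -/
theorem isSelfInclusive_vertex_of_tight {S : Set V} {c : V} (hc : c ∈ S) {D : V → ℝ}
    (hD : ∀ a b, D b ≤ D a + N.vdist a b) (hcD : 0 ≤ D c)
    (hS : ∀ b ∈ S, b ≠ c → ∃ a ∈ S, Tight N.graph N.len D a b) :
    N.IsSelfInclusive (.vertex c) S ∧ ∀ v ∈ S, N.dist (.vertex c) v ≤ D v := by
  have hd := N.isDistance_vdist c
  -- Along tight arcs from `c` the potential grows by full edge lengths, and it cannot grow by more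
  -- than the distance from `c`; so these arcs form shortest paths from `c`.
  have key : ∀ b, b ∈ S → D b = D c + N.vdist c b := by
    refine finite_potential_induction D fun b ih hb => ?_
    by_cases hbc : b = c
    · subst hbc
      rw [hd.root, add_zero]
    · obtain ⟨a, ha, hab⟩ := hS b hb hbc
      have h1 := ih a (hab.lt N.len_pos) ha
      have h2 := hd.le a b hab.1
      have h3 := hab.2
      have h4 := hD c b
      linarith
  refine ⟨isSelfInclusive_vertex.2 ⟨hc, fun b hb hbc => ?_⟩, fun v hv => ?_⟩
  · obtain ⟨a, ha, hab⟩ := hS b hb hbc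
    have h1 := key a ha
    have h2 := key b hb
    have h3 := hab.2
    exact ⟨a, ha, hab.1, by change N.vdist c a + _ = N.vdist c b; linarith⟩
  · change N.vdist c v ≤ D v
    rw [key v hv]
    linarith

/-- Every subtree of a shortest path tree of a point is self-inclusive at some point that is at
least as close to all its vertices. -/
theorem exists_isSelfInclusive_of_subtree {x : N.Point} {T : SimpleGraph V}
    (hT : T ∈ N.shortestPathTrees x) (K : T.Subgraph) (hK : K.coe.Connected) :
    ∃ y, N.IsSelfInclusive y K.verts ∧ ∀ v ∈ K.verts, N.dist y v ≤ N.dist x v := by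
  have hclosed : ∀ Z ⊆ K.verts, Z.Nonempty → (∀ z ∈ Z, ∀ y, K.Adj z y → y ∈ Z) →
      K.verts ⊆ Z := by
    rintro Z hZ ⟨z, hz⟩ hcl w hw
    obtain ⟨p⟩ := hK.preconnected ⟨z, hZ hz⟩ ⟨w, hw⟩
    have : ∀ {a b : K.verts}, K.coe.Walk a b → a.1 ∈ Z → b.1 ∈ Z := by
      intro a b p
      induction p with
      | nil => exact id
      | cons hab _ ih => exact fun ha => ih (hcl _ ha _ hab)
    exact this p hz
  have hne : K.verts.Nonempty := by
    obtain ⟨a⟩ := hK.nonempty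
    exact ⟨a, a.2⟩
  cases x with
  | vertex u =>
    obtain ⟨c, hc, hmin, htight⟩ := IsShortestPathTree.exists_top N.len_pos hT hne
      (fun Z hZ hZne hcl => hclosed Z hZ hZne fun z hz y hzy =>
        hcl z hz y (K.edge_vert hzy.symm) hzy.adj_sub)
    exact ⟨.vertex c, isSelfInclusive_vertex_of_tight hc
      (fun a b => graphDist_le_add N.len_pos N.connected u a b)
      (graphDist_nonneg N.len_pos N.connected u c) htight⟩
  | inner u v adj t h0 h1 =>
    obtain ⟨T', hT', rfl⟩ := hT
    have hp := subdivisionLen_pos (N := N) h0 h1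
    have hc := subdivision_connected (N := N) adj
    -- If `K` has an edge between two neighbours of the dummy vertex, then `K` together with the
    -- point is connected in `T'` and the point itself works. Otherwise every edge of `K` is an edge
    -- of `T'`, and the vertex of `K` closest to the point takes its place.
    by_cases hex : ∃ a b, K.Adj a b ∧ T'.Adj none (some a) ∧ T'.Adj none (some b)
    · obtain ⟨a₀, b₀, hab₀, ha₀, -⟩ := hex
      refine ⟨.inner u v adj t h0 h1, ?_, fun _ _ => le_rfl⟩
      rw [isSelfInclusive_inner]
      obtain ⟨c, hcW, hmin, htight⟩ := hT'.exists_top hp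
        (W := insert none (some '' K.verts)) ⟨none, Set.mem_insert _ _⟩ (by
        rintro Z hZ ⟨z, hz⟩ hcl
        have hVZ : (∃ a ∈ K.verts, some a ∈ Z) → K.verts ⊆ some ⁻¹' Z := by
          rintro ⟨a, haK, ha⟩
          refine (hclosed (some ⁻¹' Z ∩ K.verts) Set.inter_subset_right ⟨a, ha, haK⟩ ?_).trans
            Set.inter_subset_left
          rintro b ⟨hb, hbK⟩ y hby
          have hyK := K.edge_vert hby.symm
          have hyW : some y ∈ insert none (some '' K.verts) := Or.inr ⟨y, hyK, rfl⟩
          refine ⟨?_, hyK⟩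
          rcases hby.adj_sub.2 with h | ⟨h2, h3⟩
          · exact hcl _ hb _ hyW h
          · exact hcl _ (hcl _ hb none (Or.inl rfl) h2.symm) _ hyW h3
        have hK0 := K.edge_vert hab₀
        have hVZ' : K.verts ⊆ some ⁻¹' Z := by
          apply hVZ
          rcases hZ hz with rfl | ⟨a, ha, rfl⟩
          · exact ⟨a₀, hK0, hcl _ hz _ (Or.inr ⟨a₀, hK0, rfl⟩) ha₀⟩
          · exact ⟨a, ha, hz⟩
        rintro _ (rfl | ⟨a, ha, rfl⟩)
        · exact hcl _ (hVZ' hK0) _ (Or.inl rfl) ha₀.symm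
        · exact hVZ' ha)
      have hD := isDistance_graphDist hp hc none
      have hcr : c = none := by
        by_contra hne
        obtain ⟨a, ha⟩ := hD.tight c hne
        have h1 := ha.lt hp
        have h2 := hmin none (Set.mem_insert _ _)
        rw [hD.root] at h2
        linarith [graphDist_nonneg hp hc none a]
      subst hcr
      exact htight
    · push Not at hex
      obtain ⟨c, hcW, hmin, htight⟩ := hT'.exists_top hp
        (W := some '' K.verts) (hne.image _) (by
        rintro Z hZ ⟨z, hz⟩ hcl
        obtain ⟨a, haK, rfl⟩ := hZ hz
        refine Set.image_subset_iff.2 ((hclosed (some ⁻¹' Z ∩ K.verts) Set.inter_subset_right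
          ⟨a, hz, haK⟩ ?_).trans Set.inter_subset_left)
        rintro b ⟨hb, hbK⟩ y hby
        have hyK := K.edge_vert hby.symm
        refine ⟨?_, hyK⟩
        rcases hby.adj_sub.2 with h | ⟨h2, h3⟩
        · exact hcl _ hb _ ⟨y, hyK, rfl⟩ h
        · exact absurd h3 (hex b y hby h2))
      obtain ⟨c, hcK, rfl⟩ := hcW
      rw [graphDist_subdivision adj h0 h1] at htight
      have hdist : ∀ w, N.dist (.inner u v adj t h0 h1) w = N.subdivisionDist u v t (some w) :=
        fun w => congrFun (graphDist_subdivision adj h0 h1) (some w)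
      simp only [hdist]
      have hn := graphDist_nonneg N.len_pos N.connected
      refine ⟨.vertex c, isSelfInclusive_vertex_of_tight hcK (fun a b => ?_) ?_ fun b hb hbc => ?_⟩
      · have h3 := graphDist_le_add N.len_pos N.connected u a b
        have h4 := graphDist_le_add N.len_pos N.connected v a b
        simp only [subdivisionDist]
        rw [← min_add_add_right]
        exact min_le_min (by linarith) (by linarith)
      · have h3 := hn u c
        have h4 := hn v c
        exact le_min (by linarith) (by linarith)
      · obtain ⟨_, ⟨a, ha, rfl⟩, hab⟩ := htight (some b) ⟨b, hb, rfl⟩ (by simpa using hbc)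
        exact ⟨a, ha, hab.1.1, hab.2⟩

theorem exists_le_largestCovered {lam : ℝ} {x : N.Point} {k : ℕ} (hk : 1 ≤ k)
    (h : k ≤ N.largestCovered lam x) : ∃ S, N.IsSelfInclusive x S ∧
      (∀ v ∈ S, N.weight v * N.dist x v ≤ lam) ∧ S.ncard = k := by
  have hmem : N.largestCovered lam x ∈ {c | ∃ S : Set V, N.IsSelfInclusive x S ∧
      (∀ v ∈ S, N.weight v * N.dist x v ≤ lam) ∧ c = S.ncard} := by
    refine Nat.sSup_mem ?_ ⟨Nat.card V, ?_⟩
    -- Without candidates the supremum would be 0, less than `k`.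
    · by_contra hne
      rw [Set.not_nonempty_iff_eq_empty] at hne
      unfold largestCovered at h
      rw [hne] at h
      simp at h
      omega
    · rintro c ⟨S, -, -, rfl⟩
      rw [← Set.ncard_univ]
      exact Set.ncard_le_ncard (Set.subset_univ _) (Set.toFinite _)
  obtain ⟨S, h1, h2, h3⟩ := hmem
  obtain ⟨U, hU, h4, h5⟩ := h1.exists_subset hk (h3 ▸ h)
  exact ⟨U, h4, fun v hv => h2 v (hU hv), h5⟩

theorem ncard_le_largestCovered {lam : ℝ} {x : N.Point} {S : Set V}
    (h1 : N.IsSelfInclusive x S) (h2 : ∀ v ∈ S, N.weight v * N.dist x v ≤ lam) :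
    S.ncard ≤ N.largestCovered lam x := by
  refine le_csSup ⟨Nat.card V, ?_⟩ ⟨S, h1, h2, rfl⟩
  rintro c ⟨S, -, -, rfl⟩
  rw [← Set.ncard_univ]
  exact Set.ncard_le_ncard (Set.subset_univ _) (Set.toFinite _)

/-- The infimum defining `phi` is a minimum, since only finitely many vertex sets occur. An optimal
subtree is self-inclusive at a point no farther from its vertices, possibly a different one;
conversely a covered self-inclusive set is shrunk to exactly `k` vertices and carries a subtree. -/
theorem exists_phi_le_iff {k : ℕ} (hk : 1 ≤ k) (hkV : k ≤ Nat.card V) (lam : ℝ) :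
    (∃ x, N.phi k x ≤ lam) ↔ ∃ x, k ≤ N.largestCovered lam x := by
  have hfin : ∀ x : N.Point, {c | ∃ T ∈ N.shortestPathTrees x, ∃ K : T.Subgraph, K.coe.IsTree ∧
      K.verts.ncard = k ∧ c = sSup ((fun v => N.weight v * N.dist x v) '' K.verts)}.Finite := by
    intro x
    refine (Set.finite_range fun S : Set V =>
      sSup ((fun v => N.weight v * N.dist x v) '' S)).subset ?_
    rintro c ⟨T, -, K, -, -, rfl⟩
    exact ⟨K.verts, rfl⟩
  constructor
  · rintro ⟨x, hx⟩
    have hne : {c | ∃ T ∈ N.shortestPathTrees x, ∃ K : T.Subgraph, K.coe.IsTree ∧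
        K.verts.ncard = k ∧
        c = sSup ((fun v => N.weight v * N.dist x v) '' K.verts)}.Nonempty := by
      obtain ⟨U, -, hU, hUk⟩ := (isSelfInclusive_univ x).exists_subset hk
        (by rwa [Set.ncard_univ])
      obtain ⟨T, hT, K, hK, rfl⟩ := hU.exists_subtree
        (Set.nonempty_of_ncard_ne_zero (by omega))
      exact ⟨_, T, hT, K, hK, hUk, rfl⟩
    obtain ⟨T, hT, K, hK, hKk, hc⟩ := hne.csInf_mem (hfin x)
    obtain ⟨y, hy, hle⟩ := exists_isSelfInclusive_of_subtree hT K hK.connected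
    refine ⟨y, hKk ▸ ncard_le_largestCovered hy fun v hv => ?_⟩
    refine le_trans ?_ hx
    change _ ≤ sInf _
    rw [hc]
    refine (mul_le_mul_of_nonneg_left (hle v hv) (N.weight_pos v).le).trans ?_
    exact le_csSup (Set.toFinite _).bddAbove ⟨v, hv, rfl⟩
  · rintro ⟨x, hx⟩
    obtain ⟨S, h1, h2, h3⟩ := exists_le_largestCovered hk hx
    have hS : S.Nonempty := Set.nonempty_of_ncard_ne_zero (by omega)
    obtain ⟨T, hT, K, hK, rfl⟩ := h1.exists_subtree hS
    refine ⟨x, (csInf_le (hfin x).bddBelow ⟨T, hT, K, hK, h3, rfl⟩).trans ?_⟩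
    refine csSup_le (hS.image _) ?_
    rintro _ ⟨v, hv, rfl⟩
    exact h2 v hv

end Network

/-! ### Closedness of covering and existence of the minimum -/

namespace Network

variable {V : Type*} [DecidableEq V] [Finite V] {N : Network V}

omit [DecidableEq V] in
-- By induction on the distance, reaching `w` is a finite combination, by unions and intersections,
-- of weak linear inequalities in the bound and the position.
theorem isClosed_reach (u : V) :
    ∀ w, IsClosed {p : ℝ × ℝ | N.Reach p.1 u p.2 w} := by
  refine finite_potential_induction (N.vdist u) fun w ih => ?_
  have hroot := (N.isDistance_vdist u).root
  have heq : {p : ℝ × ℝ | N.Reach p.1 u p.2 w} =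
      {p : ℝ × ℝ | N.weight w * (p.2 + N.vdist u w) ≤ p.1} ∩ ({_p | w = u} ∪
        ⋃ a : {a // Tight N.graph N.len (N.vdist u) a w}, {p | N.Reach p.1 u p.2 a}) := by
    ext p
    simp only [Set.mem_ofPred_eq, Set.mem_inter_iff, Set.mem_union, Set.mem_iUnion]
    constructor
    · intro h
      refine ⟨h.le, ?_⟩
      cases h with
      | root h => exact Or.inl rfl
      | step ha hab h => exact Or.inr ⟨⟨_, hab⟩, ha⟩
    · rintro ⟨h, rfl | ⟨a, ha⟩⟩
      · rw [hroot, add_zero] at h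
        exact .root h
      · exact ha.step a.2 h
  rw [heq]
  refine (isClosed_le (by fun_prop) (by fun_prop)).inter ((isClosed_const).union
    (isClosed_iUnion_of_finite fun a => ih a (a.2.lt N.len_pos)))

omit [DecidableEq V] in
-- The superlevel set is the finite union, over vertex sets of size at least `k`, of the closed sets
-- on which all their members belong to `R`.
theorem isClosed_le_ncard {Y : Type*} [TopologicalSpace Y] {R : Y → Set V}
    (hR : ∀ w, IsClosed {y | w ∈ R y}) (k : ℕ) : IsClosed {y | k ≤ (R y).ncard} := by
  have : {y | k ≤ (R y).ncard} =
      ⋃ S : {S : Set V // k ≤ S.ncard}, ⋂ w : S.1, {y | w.1 ∈ R y} := by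
    ext y
    simp only [Set.mem_ofPred_eq, Set.mem_iUnion, Set.mem_iInter]
    constructor
    · exact fun h => ⟨⟨R y, h⟩, fun w => w.2⟩
    · rintro ⟨⟨S, hS⟩, h⟩
      exact hS.trans (Set.ncard_le_ncard (fun w hw => h ⟨w, hw⟩) (Set.toFinite _))
  rw [this]
  exact isClosed_iUnion_of_finite fun S => isClosed_iInter fun w => hR w

omit [DecidableEq V] in
theorem isClosed_mem_reachSet (u v w : V) :
    IsClosed {p : ℝ × ℝ | w ∈ N.reachSet p.1 u v p.2} := by
  have h2 : IsClosed {p : ℝ × ℝ | N.Reach p.1 v (N.len u v - p.2) w} :=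
    (isClosed_reach v w).preimage (f := fun p : ℝ × ℝ => (p.1, N.len u v - p.2)) (by fun_prop)
  have h3 : IsClosed {p : ℝ × ℝ | p.2 + N.vdist u w ≤ N.len u v - p.2 + N.vdist v w} :=
    isClosed_le (by fun_prop) (by fun_prop)
  have h4 : IsClosed {p : ℝ × ℝ | N.len u v - p.2 + N.vdist v w ≤ p.2 + N.vdist u w} :=
    isClosed_le (by fun_prop) (by fun_prop)
  exact (h3.inter (isClosed_reach u w)).union (h4.inter h2)

theorem exists_phi_le_iff_reach {k : ℕ} (hk : 1 ≤ k) (hkV : k ≤ Nat.card V) (lam : ℝ) :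
    (∃ x, N.phi k x ≤ lam) ↔ (∃ u, k ≤ {w | N.Reach lam u 0 w}.ncard) ∨
      ∃ u v, N.graph.Adj u v ∧ ∃ t ∈ Icc 0 (N.len u v), k ≤ (N.reachSet lam u v t).ncard := by
  rw [exists_phi_le_iff hk hkV]
  constructor
  · rintro ⟨u | ⟨u, v, adj, t, h0, h1⟩, hx⟩
    · rw [largestCovered_vertex] at hx
      exact Or.inl ⟨u, hx⟩
    · rw [largestCovered_inner] at hx
      exact Or.inr ⟨u, v, adj, t, ⟨h0.le, h1.le⟩, hx⟩
  · rintro (⟨u, hu⟩ | ⟨u, v, adj, t, ht, hu⟩)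
    · exact ⟨.vertex u, by rwa [largestCovered_vertex]⟩
    · exact ⟨N.edgePoint u v adj t, by rwa [largestCovered_edgePoint lam adj ht.1 ht.2]⟩

theorem nonneg_of_le_largestCovered {k : ℕ} (hk : 1 ≤ k) {lam : ℝ} {x : N.Point}
    (h : k ≤ N.largestCovered lam x) : 0 ≤ lam := by
  obtain ⟨S, -, h2, h3⟩ := exists_le_largestCovered hk h
  obtain ⟨v, hv⟩ : S.Nonempty := Set.nonempty_of_ncard_ne_zero (by omega)
  refine le_trans (mul_nonneg (N.weight_pos v).le ?_) (h2 v hv)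
  cases x with
  | vertex u => exact graphDist_nonneg N.len_pos N.connected u v
  | inner a b adj t h0 h1 =>
    exact graphDist_nonneg (subdivisionLen_pos h0 h1) (subdivision_connected adj) _ _

theorem isLeast_lambdaStar {k : ℕ} (hk : 1 ≤ k) (hkV : k ≤ Nat.card V) :
    IsLeast (Set.range (N.phi k)) (N.lambdaStar k) := by
  obtain ⟨v₀⟩ := N.connected.nonempty
  have hnonneg : ∀ lam, (∃ x, N.phi k x ≤ lam) → 0 ≤ lam := by
    intro lam h
    obtain ⟨x, hx⟩ := (exists_phi_le_iff hk hkV lam).1 h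
    exact nonneg_of_le_largestCovered hk hx
  set M := N.phi k (.vertex v₀) with hM
  -- The feasible bounds up to the value at one vertex, written as a finite union of compact sets:
  -- closed sets of bounds for the vertices, and projections of compact sets of pairs (bound,
  -- position) for the edges.
  let A : Set ℝ := (⋃ u, {lam | k ≤ {w | N.Reach lam u 0 w}.ncard} ∩ Icc 0 M) ∪
    ⋃ e : {e : V × V // N.graph.Adj e.1 e.2}, Prod.fst ''
      ((Icc 0 M ×ˢ Icc 0 (N.len e.1.1 e.1.2)) ∩
        {p : ℝ × ℝ | k ≤ (N.reachSet p.1 e.1.1 e.1.2 p.2).ncard})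
  have hA : A = {lam | (∃ x, N.phi k x ≤ lam) ∧ lam ≤ M} := by
    ext lam
    simp only [Set.mem_ofPred_eq]
    constructor
    · rintro (h | h)
      · obtain ⟨u, hu, hl⟩ := Set.mem_iUnion.1 h
        exact ⟨(exists_phi_le_iff_reach hk hkV lam).2 (Or.inl ⟨u, hu⟩), hl.2⟩
      · obtain ⟨⟨⟨u, v⟩, adj⟩, ⟨l, t⟩, ⟨⟨hl, ht⟩, hc⟩, rfl⟩ := Set.mem_iUnion.1 h
        exact ⟨(exists_phi_le_iff_reach hk hkV l).2 (Or.inr ⟨u, v, adj, t, ht, hc⟩), hl.2⟩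
    · rintro ⟨h, hl⟩
      have h0 := hnonneg lam h
      rcases (exists_phi_le_iff_reach hk hkV lam).1 h with ⟨u, hu⟩ | ⟨u, v, adj, t, ht, hc⟩
      · exact Or.inl (Set.mem_iUnion.2 ⟨u, hu, h0, hl⟩)
      · exact Or.inr (Set.mem_iUnion.2 ⟨⟨(u, v), adj⟩, (lam, t), ⟨⟨⟨h0, hl⟩, ht⟩, hc⟩, rfl⟩)
  have hcompact : IsCompact A := by
    refine IsCompact.union (isCompact_iUnion fun u => ?_) (isCompact_iUnion fun e => ?_)
    · refine isCompact_Icc.inter_left (isClosed_le_ncard (fun w => ?_) k)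
      exact (isClosed_reach u w).preimage (f := fun l : ℝ => (l, (0 : ℝ))) (by fun_prop)
    · refine IsCompact.image ((isCompact_Icc.prod isCompact_Icc).inter_right ?_) continuous_fst
      exact isClosed_le_ncard (fun w => isClosed_mem_reachSet e.1.1 e.1.2 w) k
  have hne : A.Nonempty := ⟨M, by rw [hA]; exact ⟨⟨_, le_rfl⟩, le_rfl⟩⟩
  obtain ⟨l₀, hl₀, hmin⟩ := hcompact.exists_isLeast hne
  rw [hA] at hl₀ hmin
  obtain ⟨⟨x, hx⟩, hlM⟩ := hl₀
  have hle : ∀ y, l₀ ≤ N.phi k y := by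
    intro y
    rcases le_total (N.phi k y) M with h | h
    · exact hmin ⟨⟨y, le_rfl⟩, h⟩
    · exact hlM.trans h
  have hleast : IsLeast (Set.range (N.phi k)) l₀ :=
    ⟨⟨x, le_antisymm hx (hle x)⟩, by rintro _ ⟨y, rfl⟩; exact hle y⟩
  have : N.lambdaStar k = l₀ := hleast.csInf_eq
  rwa [this]

theorem lambdaStar_le_iff {k : ℕ} (hk : 1 ≤ k) (hkV : k ≤ Nat.card V) (lam : ℝ) :
    N.lambdaStar k ≤ lam ↔ (∃ u, k ≤ {w | N.Reach lam u 0 w}.ncard) ∨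
      ∃ u v, N.graph.Adj u v ∧ ∃ t ∈ Icc 0 (N.len u v), k ≤ (N.reachSet lam u v t).ncard := by
  rw [← exists_phi_le_iff_reach hk hkV]
  obtain ⟨⟨x, hx⟩, hmin⟩ := isLeast_lambdaStar (N := N) hk hkV
  constructor
  · exact fun h => ⟨x, hx.trans_le h⟩
  · rintro ⟨y, hy⟩
    exact (hmin ⟨y, rfl⟩).trans hy

end Network

/-! ### Verification of programs -/

namespace Program

/-- The program contains a store to the array `b` of natural numbers. -/
def WritesNat : Program → ℕ → Prop
  | skip, _ => False
  | storeNat a _ _, b => b = a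
  | storeReal _ _ _, _ => False
  | seq p q, b => p.WritesNat b ∨ q.WritesNat b
  | branch _ p q, b => p.WritesNat b ∨ q.WritesNat b
  | loop _ p, b => p.WritesNat b

/-- The program contains a store to the array `b` of real numbers. -/
def WritesReal : Program → ℕ → Prop
  | skip, _ => False
  | storeNat _ _ _, _ => False
  | storeReal a _ _, b => b = a
  | seq p q, b => p.WritesReal b ∨ q.WritesReal b
  | branch _ p q, b => p.WritesReal b ∨ q.WritesReal b
  | loop _ p, b => p.WritesReal b

end Program

/-- `s'` differs from `s` only in arrays that `p` writes. -/
structure Frame (p : Program) (s s' : Memory) : Prop where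
  nat : ∀ a, ¬ p.WritesNat a → s'.nat a = s.nat a
  real : ∀ a, ¬ p.WritesReal a → s'.real a = s.real a

theorem Frame.refl (p : Program) (s : Memory) : Frame p s s := ⟨fun _ _ => rfl, fun _ _ => rfl⟩

theorem Frame.trans {p : Program} {s₁ s₂ s₃ : Memory} (h : Frame p s₁ s₂) (h' : Frame p s₂ s₃) :
    Frame p s₁ s₃ :=
  ⟨fun a ha => (h'.nat a ha).trans (h.nat a ha), fun a ha => (h'.real a ha).trans (h.real a ha)⟩

/-- The arrays that a program can change are read off its text, so facts about all other arrays
survive without being part of loop invariants. -/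
theorem Runs.frame {W : ℕ} {p : Program} {s s' : Memory} {t : ℕ} (h : Runs W p s s' t) :
    Frame p s s' := by
  induction h with
  | skip s => exact Frame.refl _ _
  | storeNat s a i e hi he =>
    refine ⟨fun b hb => ?_, fun _ _ => rfl⟩
    exact Function.update_of_ne hb _ _
  | storeReal s a i e hi =>
    refine ⟨fun _ _ => rfl, fun b hb => ?_⟩
    exact Function.update_of_ne hb _ _
  | seq _ _ ih₁ ih₂ =>
    exact ⟨fun a ha => (ih₂.nat a fun h => ha (Or.inr h)).trans (ih₁.nat a fun h => ha (Or.inl h)),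
      fun a ha => (ih₂.real a fun h => ha (Or.inr h)).trans (ih₁.real a fun h => ha (Or.inl h))⟩
  | branch_true _ _ ih => exact ⟨fun a ha => ih.nat a fun h => ha (Or.inl h),
      fun a ha => ih.real a fun h => ha (Or.inl h)⟩
  | branch_false _ _ ih => exact ⟨fun a ha => ih.nat a fun h => ha (Or.inr h),
      fun a ha => ih.real a fun h => ha (Or.inr h)⟩
  | loop_done _ => exact Frame.refl _ _
  | loop_step _ _ _ ih₁ ih₂ => exact Frame.trans ⟨ih₁.nat, ih₁.real⟩ ih₂

/-- The program halts, and its final memory and running time satisfy `Q`. -/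
def Wp (W : ℕ) (p : Program) (s : Memory) (Q : Memory → ℕ → Prop) : Prop :=
  ∃ s' t, Runs W p s s' t ∧ Q s' t

section Wp

variable {W : ℕ} {s : Memory} {Q : Memory → ℕ → Prop}

theorem Wp.mono {p : Program} {Q' : Memory → ℕ → Prop} (h : Wp W p s Q)
    (hQ : ∀ s' t, Frame p s s' → Q s' t → Q' s' t) : Wp W p s Q' := by
  obtain ⟨s', t, hr, hq⟩ := h
  exact ⟨s', t, hr, hQ s' t hr.frame hq⟩

theorem wp_skip (h : Q s 1) : Wp W .skip s Q := ⟨_, _, .skip s, h⟩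

theorem wp_storeNat {a : ℕ} {i e : NatExpr} (hi : i.eval s ≤ W) (he : e.eval s ≤ W)
    (h : Q (s.setNat a (i.eval s) (e.eval s)) (i.cost + e.cost + 1)) :
    Wp W (.storeNat a i e) s Q :=
  ⟨_, _, .storeNat s a i e hi he, h⟩

theorem wp_storeReal {a : ℕ} {i : NatExpr} {e : RealExpr} (hi : i.eval s ≤ W)
    (h : Q (s.setReal a (i.eval s) (e.eval s)) (i.cost + e.cost + 1)) :
    Wp W (.storeReal a i e) s Q :=
  ⟨_, _, .storeReal s a i e hi, h⟩

theorem wp_seq {p q : Program} (h : Wp W p s fun s₁ t₁ => Wp W q s₁ fun s₂ t₂ => Q s₂ (t₁ + t₂)) :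
    Wp W (.seq p q) s Q := by
  obtain ⟨s₁, t₁, h₁, s₂, t₂, h₂, hQ⟩ := h
  exact ⟨_, _, .seq h₁ h₂, hQ⟩

theorem wp_branch {b : Test} {p q : Program}
    (h₁ : b.eval s → Wp W p s fun s' t => Q s' (b.cost + t + 1))
    (h₂ : ¬ b.eval s → Wp W q s fun s' t => Q s' (b.cost + t + 1)) :
    Wp W (.branch b p q) s Q := by
  by_cases hb : b.eval s
  · obtain ⟨s', t, h, hQ⟩ := h₁ hb
    exact ⟨_, _, .branch_true hb h, hQ⟩
  · obtain ⟨s', t, h, hQ⟩ := h₂ hb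
    exact ⟨_, _, .branch_false hb h, hQ⟩

/-- The rule for loops, with an invariant `I`, a variant `μ` and a bound `c` for the time of the
body. -/
theorem wp_loop {b : Test} {p : Program} (I : Memory → Prop) (μ : Memory → ℕ) (c : ℕ)
    (h0 : I s)
    (hstep : ∀ s₁, Frame p s s₁ → I s₁ → b.eval s₁ →
      Wp W p s₁ fun s₂ t => I s₂ ∧ μ s₂ < μ s₁ ∧ t ≤ c)
    (hQ : ∀ s₁ t, Frame p s s₁ → I s₁ → ¬ b.eval s₁ →
      t ≤ μ s * (c + b.cost + 1) + b.cost + 1 → Q s₁ t) :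
    Wp W (.loop b p) s Q := by
  have key : ∀ k s₁, μ s₁ = k → Frame p s s₁ → I s₁ →
      Wp W (.loop b p) s₁ fun s₂ t => Frame p s s₂ ∧ I s₂ ∧ ¬ b.eval s₂ ∧
        t ≤ μ s₁ * (c + b.cost + 1) + b.cost + 1 := by
    intro k
    induction k using Nat.strong_induction_on with
    | _ k ih =>
      intro s₁ hk hf hI
      by_cases hb : b.eval s₁
      · obtain ⟨s₂, t₁, hr, hI₂, hμ, ht⟩ := hstep s₁ hf hI hb
        have hf₂ : Frame p s s₂ := hf.trans hr.frame
        obtain ⟨s₃, t₂, hr₂, h1, h2, h3, h4⟩ := ih (μ s₂) (hk ▸ hμ) s₂ rfl hf₂ hI₂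
        refine ⟨s₃, _, .loop_step hb hr hr₂, h1, h2, h3, ?_⟩
        have h5 : (μ s₂ + 1) * (c + b.cost + 1) ≤ μ s₁ * (c + b.cost + 1) :=
          Nat.mul_le_mul_right _ hμ
        rw [add_mul, one_mul] at h5
        omega
      · exact ⟨s₁, _, .loop_done hb, hf, hI, hb, by omega⟩
  obtain ⟨s', t, hr, h1, h2, h3, h4⟩ := key _ s rfl (Frame.refl _ _) h0
  exact ⟨s', t, hr, hQ s' t h1 h2 h3 h4⟩

end Wp

namespace Memory

@[simp] theorem setNat_nat (s : Memory) (a i x b j : ℕ) :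
    (s.setNat a i x).nat b j = if b = a ∧ j = i then x else s.nat b j := by
  by_cases h : b = a
  · subst h
    by_cases h' : j = i
    · subst h'; simp [setNat]
    · simp [setNat, h']
  · simp [setNat, h]

@[simp] theorem setNat_real (s : Memory) (a i x : ℕ) : (s.setNat a i x).real = s.real := rfl

@[simp] theorem setReal_real (s : Memory) (a i : ℕ) (x : ℝ) (b j : ℕ) :
    (s.setReal a i x).real b j = if b = a ∧ j = i then x else s.real b j := by
  by_cases h : b = a
  · subst h
    by_cases h' : j = i
    · subst h'; simp [setReal]
    · simp [setReal, h']
  · simp [setReal, h]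

@[simp] theorem setReal_nat (s : Memory) (a i : ℕ) (x : ℝ) : (s.setReal a i x).nat = s.nat := rfl

end Memory

/-- A variable: the first cell of an array. -/
def NatExpr.var (a : ℕ) : NatExpr := .load a (.lit 0)

/-- A variable: the first cell of an array. -/
def RealExpr.var (a : ℕ) : RealExpr := .load a (.lit 0)

@[simp] theorem NatExpr.eval_var (s : Memory) (a : ℕ) : (NatExpr.var a).eval s = s.nat a 0 := rfl
@[simp] theorem NatExpr.cost_var (a : ℕ) : (NatExpr.var a).cost = 2 := rfl
@[simp] theorem RealExpr.eval_var (s : Memory) (a : ℕ) :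
    (RealExpr.var a).eval s = s.real a 0 := rfl
@[simp] theorem RealExpr.cost_var (a : ℕ) : (RealExpr.var a).cost = 2 := rfl

attribute [simp] NatExpr.eval NatExpr.cost RealExpr.eval RealExpr.cost Test.eval Test.cost
  Program.WritesNat Program.WritesReal

/-- Assignment to a variable. -/
def Program.setVar (a : ℕ) (e : NatExpr) : Program := .storeNat a (.lit 0) e

/-- Increment of a variable. -/
def Program.incr (a : ℕ) : Program := .setVar a (.add (.var a) (.lit 1))

@[simp] theorem Program.writesNat_setVar (a : ℕ) (e : NatExpr) (b : ℕ) :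
    (Program.setVar a e).WritesNat b ↔ b = a := Iff.rfl
@[simp] theorem Program.writesReal_setVar (a : ℕ) (e : NatExpr) (b : ℕ) :
    (Program.setVar a e).WritesReal b ↔ False := Iff.rfl
@[simp] theorem Program.writesNat_incr (a b : ℕ) :
    (Program.incr a).WritesNat b ↔ b = a := Iff.rfl
@[simp] theorem Program.writesReal_incr (a b : ℕ) :
    (Program.incr a).WritesReal b ↔ False := Iff.rfl

theorem wp_setVar {W : ℕ} {s : Memory} {Q : Memory → ℕ → Prop} {a : ℕ} {e : NatExpr}
    (he : e.eval s ≤ W) (h : Q (s.setNat a 0 (e.eval s)) (e.cost + 2)) :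
    Wp W (.setVar a e) s Q :=
  wp_storeNat (Nat.zero_le _) he (by
    rw [show (NatExpr.lit 0).cost + e.cost + 1 = e.cost + 2 by simp; omega]
    exact h)

theorem wp_incr {W : ℕ} {s : Memory} {Q : Memory → ℕ → Prop} {a : ℕ}
    (he : s.nat a 0 + 1 ≤ W) (h : Q (s.setNat a 0 (s.nat a 0 + 1)) 6) :
    Wp W (.incr a) s Q :=
  wp_setVar (by simpa using he) (by simpa using h)

/-! ### Sorting with a tournament tree -/

section Tournament

open Classical in
/-- The winner of two entries of a tournament; the entry `c + 1` stands for the item `c`, and `0`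
for no item. -/
noncomputable def winner (key : ℕ → ℝ) (a b : ℕ) : ℕ :=
  if 1 ≤ a ∧ ¬ (1 ≤ b ∧ ¬ key (a - 1) ≤ key (b - 1)) then a else b

theorem winner_eq_or (key : ℕ → ℝ) (a b : ℕ) : winner key a b = a ∨ winner key a b = b := by
  unfold winner; split_ifs <;> simp

theorem winner_left {key : ℕ → ℝ} {a b : ℕ} (ha : a ≠ 0) :
    winner key a b ≠ 0 ∧ key (winner key a b - 1) ≤ key (a - 1) := by
  unfold winner
  split_ifs with h
  · exact ⟨ha, le_rfl⟩
  · have h' : 1 ≤ b ∧ ¬ key (a - 1) ≤ key (b - 1) := by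
      by_contra hc
      exact h ⟨by omega, hc⟩
    exact ⟨by omega, (not_le.1 h'.2).le⟩

theorem winner_right {key : ℕ → ℝ} {a b : ℕ} (hb : b ≠ 0) :
    winner key a b ≠ 0 ∧ key (winner key a b - 1) ≤ key (b - 1) := by
  unfold winner
  split_ifs with h
  · refine ⟨by omega, ?_⟩
    by_contra hc
    exact h.2 ⟨by omega, hc⟩
  · exact ⟨hb, le_rfl⟩

/-- The node `x` of the tournament tree `T` holds the winner of its children. -/
def IsNode (key : ℕ → ℝ) (T : ℕ → ℕ) (x : ℕ) : Prop := T x = winner key (T (2 * x)) (T (2 * x + 1))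

/-- The leaves are the nodes from `N` to `2 * N - 1`; `N` need not be a power of two. Each entry
comes from a child with a larger index, ultimately from a leaf. The parameter `k` allows for a tree
built only from node `k` on. -/
theorem tournament_valid {key : ℕ → ℝ} {T : ℕ → ℕ} {N : ℕ}
    (hleaf : ∀ c < N, T (N + c) = 0 ∨ T (N + c) = c + 1) (k : ℕ)
    (hnode : ∀ x, k ≤ x → x < N → IsNode key T x) (hk : 1 ≤ k) :
    ∀ y, k ≤ y → y < 2 * N → T y = 0 ∨ ∃ c < N, T y = c + 1 ∧ T (N + c) = c + 1 := by
  intro y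
  induction hn : 2 * N - y using Nat.strong_induction_on generalizing y with
  | _ n ih =>
    intro hy hy2
    by_cases hyN : y < N
    · rw [hnode y hy hyN]
      rcases winner_eq_or key (T (2 * y)) (T (2 * y + 1)) with h | h
      · rw [h]; exact ih _ (by omega) (2 * y) rfl (by omega) (by omega)
      · rw [h]; exact ih _ (by omega) (2 * y + 1) rfl (by omega) (by omega)
    · obtain ⟨c, rfl⟩ := Nat.exists_eq_add_of_le (not_lt.1 hyN)
      exact (hleaf c (by omega)).imp_right fun h => ⟨c, by omega, h, h⟩

/-- The least key propagates upwards, since the parent of `y` is `y / 2` and a winner beats both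
children. -/
theorem tournament_root {key : ℕ → ℝ} {T : ℕ → ℕ} {N : ℕ}
    (hnode : ∀ x, 1 ≤ x → x < N → IsNode key T x) :
    ∀ y, 1 ≤ y → y < 2 * N → T y ≠ 0 → T 1 ≠ 0 ∧ key (T 1 - 1) ≤ key (T y - 1) := by
  intro y
  induction y using Nat.strong_induction_on with
  | _ y ih =>
    intro h1 h2 hy
    by_cases hy1 : y = 1
    · subst hy1; exact ⟨hy, le_rfl⟩
    · have hn := hnode (y / 2) (by omega) (by omega)
      have hle : T (y / 2) ≠ 0 ∧ key (T (y / 2) - 1) ≤ key (T y - 1) := by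
        rw [hn]
        rcases Nat.even_or_odd' y with ⟨z, rfl | rfl⟩
        · rw [show 2 * z / 2 = z by omega]
          exact winner_left hy
        · rw [show (2 * z + 1) / 2 = z by omega]
          exact winner_right hy
      obtain ⟨h3, h4⟩ := ih (y / 2) (by omega) (by omega) (by omega) hle.1
      exact ⟨h3, h4.trans hle.2⟩

/-- Recompute the node `q` (variable 8) of the tournament tree (array 6). -/
def playNode : Program :=
  .branch
    (.and (.natLe (.lit 1) (.load 6 (.mul (.lit 2) (.var 8))))
      (.not (.and (.natLe (.lit 1) (.load 6 (.add (.mul (.lit 2) (.var 8)) (.lit 1))))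
        (.not (.realLe (.load 4 (.sub (.load 6 (.mul (.lit 2) (.var 8))) (.lit 1)))
          (.load 4 (.sub (.load 6 (.add (.mul (.lit 2) (.var 8)) (.lit 1))) (.lit 1))))))))
    (.storeNat 6 (.var 8) (.load 6 (.mul (.lit 2) (.var 8))))
    (.storeNat 6 (.var 8) (.load 6 (.add (.mul (.lit 2) (.var 8)) (.lit 1))))

/-- The test of the program unfolds to the condition in `winner`. -/
theorem wp_playNode {W : ℕ} {s : Memory} {Q : Memory → ℕ → Prop} {q : ℕ} (hq : s.nat 8 0 = q)
    (hqW : q ≤ W) (h1 : s.nat 6 (2 * q) ≤ W) (h2 : s.nat 6 (2 * q + 1) ≤ W)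
    (h : ∀ t ≤ 60, Q (s.setNat 6 q (winner (s.real 4) (s.nat 6 (2 * q)) (s.nat 6 (2 * q + 1)))) t) :
    Wp W playNode s Q := by
  subst hq
  refine wp_branch (fun hb => wp_storeNat hqW h1 ?_) (fun hb => wp_storeNat hqW h2 ?_)
  · have hw : winner (s.real 4) (s.nat 6 (2 * s.nat 8 0)) (s.nat 6 (2 * s.nat 8 0 + 1)) =
        s.nat 6 (2 * s.nat 8 0) := if_pos hb
    change Q (s.setNat 6 (s.nat 8 0) (s.nat 6 (2 * s.nat 8 0))) _
    rw [← hw]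
    exact h _ (by simp)
  · have hw : winner (s.real 4) (s.nat 6 (2 * s.nat 8 0)) (s.nat 6 (2 * s.nat 8 0 + 1)) =
        s.nat 6 (2 * s.nat 8 0 + 1) := if_neg hb
    change Q (s.setNat 6 (s.nat 8 0) (s.nat 6 (2 * s.nat 8 0 + 1))) _
    rw [← hw]
    exact h _ (by simp)

end Tournament

section Tournament

/-- Fill the leaves of the tournament tree: the leaf `N + c` gets the entry `c + 1`. -/
def initLeaves : Program :=
  .seq (.setVar 4 (.lit 0)) (.loop (.not (.natLe (.var 5) (.var 4)))
    (.seq (.storeNat 6 (.add (.var 5) (.var 4)) (.add (.var 4) (.lit 1))) (.incr 4)))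

/-- Compute the inner nodes of the tournament tree, from the bottom to the top. -/
def buildTree : Program :=
  .seq (.setVar 4 (.var 5)) (.loop (.not (.natLe (.var 4) (.lit 1)))
    (.seq (.setVar 4 (.sub (.var 4) (.lit 1))) (.seq (.setVar 8 (.var 4)) playNode)))

/-- Recompute the proper ancestors of the node `q` (variable 8). -/
def climb : Program :=
  .loop (.not (.natLe (.var 8) (.lit 1))) (.seq (.setVar 8 (.div (.var 8) (.lit 2))) playNode)

/-- Remove the winners one after the other, and list them in the array 7. -/
def extractAll : Program :=
  .seq (.setVar 4 (.lit 0)) (.loop (.not (.natLe (.var 5) (.var 4)))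
    (.seq (.storeNat 7 (.var 4) (.sub (.load 6 (.lit 1)) (.lit 1)))
    (.seq (.setVar 8 (.add (.var 5) (.load 7 (.var 4))))
    (.seq (.storeNat 6 (.var 8) (.lit 0)) (.seq climb (.incr 4))))))

/-- Sort the items `0, …, N - 1` (`N` is the variable 5) by their keys in the real array 4; the
sorted list of items is written to the array 7. -/
def sortProgram : Program := .seq initLeaves (.seq buildTree extractAll)

variable {W : ℕ} {s : Memory} {N : ℕ}

theorem wp_initLeaves (hN : s.nat 5 0 = N) (hW : 2 * N + 2 ≤ W) :
    Wp W initLeaves s fun s' t => (∀ c < N, s'.nat 6 (N + c) = c + 1) ∧ t ≤ 40 * (N + 1) := by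
  refine wp_seq (wp_setVar (by simp) ?_)
  refine wp_loop (fun s => s.nat 4 0 ≤ N ∧ ∀ c < s.nat 4 0, s.nat 6 (N + c) = c + 1)
    (fun s => N - s.nat 4 0) 20 (by simp) ?_ ?_
  · rintro s₁ hf ⟨h1, h2⟩ hb
    have h5 : s₁.nat 5 0 = N := by rw [hf.nat 5 (by simp)]; simpa
    simp only [Test.eval, NatExpr.eval_var, h5, not_le] at hb
    refine wp_seq (wp_storeNat (by simp [h5]; omega) (by simp; omega) (wp_incr ?_ ?_))
    · simp; omega
    · simp only [Memory.setNat_nat, NatExpr.eval, NatExpr.eval_var, h5]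
      refine ⟨⟨by simp; omega, fun c hc => ?_⟩, by simp; omega, by simp⟩
      simp at hc ⊢
      split_ifs with hce
      · omega
      · exact h2 c (by omega)
  · rintro s₁ t hf ⟨h1, h2⟩ hb ht
    have h5 : s₁.nat 5 0 = N := by rw [hf.nat 5 (by simp)]; simpa
    simp only [Test.eval, NatExpr.eval_var, h5, not_le, not_lt] at hb
    refine ⟨fun c hc => h2 c (by omega), ?_⟩
    simp at ht ⊢
    omega

theorem wp_buildTree (hN : s.nat 5 0 = N) (hW : 2 * N + 2 ≤ W)
    (hleaf : ∀ c < N, s.nat 6 (N + c) = c + 1) :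
    Wp W buildTree s fun s' t => (∀ c < N, s'.nat 6 (N + c) = c + 1) ∧
      (∀ x, 1 ≤ x → x < N → IsNode (s.real 4) (s'.nat 6) x) ∧ t ≤ 100 * (N + 1) := by
  refine wp_seq (wp_setVar (by simp; omega) ?_)
  refine wp_loop (fun s' => s'.nat 4 0 ≤ N ∧ (1 ≤ N → 1 ≤ s'.nat 4 0) ∧
    (∀ c < N, s'.nat 6 (N + c) = c + 1) ∧
    (∀ x, s'.nat 4 0 ≤ x → x < N → IsNode (s.real 4) (s'.nat 6) x))
    (fun s => s.nat 4 0) 80 ?_ ?_ ?_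
  · simp [hN]
    exact ⟨hleaf, fun x h1 h2 => absurd h1 (by omega)⟩
  · rintro s₁ hf ⟨h1, h2, h3, h4⟩ hb
    have hkey : s₁.real 4 = s.real 4 := by rw [hf.real 4 (by simp [playNode])]; simp
    simp only [Test.eval, NatExpr.eval_var, NatExpr.eval, not_le] at hb
    set i := s₁.nat 4 0 with hi
    -- The children of node `i - 1` have indices at least `i`, because `i ≥ 2`; so their entries are
    -- already valid and fit into a word.
    have hval := tournament_valid (fun c hc => Or.inr (h3 c hc)) i h4 (by omega)
    have hb1 : ∀ y, i ≤ y → y < 2 * N → s₁.nat 6 y ≤ W := by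
      intro y h5 h6
      rcases hval y h5 h6 with h | ⟨c, hc, h, -⟩ <;> omega
    refine wp_seq (wp_setVar (by simp; omega) (wp_seq (wp_setVar (by simp; omega)
      (wp_playNode (q := i - 1) (by simp [hi]) (by omega) ?_ ?_ ?_))))
    · simpa using hb1 _ (by omega) (by omega)
    · simpa using hb1 _ (by omega) (by omega)
    · intro t ht
      refine ⟨⟨?_, ?_, ?_, ?_⟩, ?_, ?_⟩
      · simp; omega
      · simp; omega
      · intro c hc
        simp only [Memory.setNat_nat]
        simp [show N + c ≠ i - 1 by omega, h3 c hc]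
      · intro x hx hxN
        unfold IsNode
        simp [← hi] at hx ⊢
        rw [hkey]
        rw [if_neg (show ¬ 2 * x = i - 1 by omega), if_neg (show ¬ 2 * x + 1 = i - 1 by omega)]
        by_cases hxi : x = i - 1
        · rw [if_pos hxi, hxi]
        · rw [if_neg hxi]
          exact h4 x (by omega) hxN
      · simp; omega
      · simp; omega
  · rintro s₁ t hf ⟨h1, h2, h3, h4⟩ hb ht
    simp only [Test.eval, NatExpr.eval_var, NatExpr.eval, not_le, not_lt] at hb
    refine ⟨h3, fun x hx hxN => h4 x (by omega) hxN, ?_⟩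
    simp [hN] at ht ⊢
    omega

/-- After a change at node q only its parent may hold a wrong winner. Recomputing the parent moves
this defect one level up, and it vanishes above the root, after log q rounds. -/
theorem wp_climb (hW : 2 * N + 2 ≤ W) (hq : 1 ≤ s.nat 8 0) (hqN : s.nat 8 0 < 2 * N)
    (hb : ∀ y, 1 ≤ y → y < 2 * N → s.nat 6 y ≤ N)
    (hnode : ∀ x, 1 ≤ x → x < N → x ≠ s.nat 8 0 / 2 → IsNode (s.real 4) (s.nat 6) x) :
    Wp W climb s fun s' t => (∀ c < N, s'.nat 6 (N + c) = s.nat 6 (N + c)) ∧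
      (∀ x, 1 ≤ x → x < N → IsNode (s.real 4) (s'.nat 6) x) ∧
      t ≤ 100 * (Nat.log 2 (s.nat 8 0) + 1) := by
  refine wp_loop (fun s' => (1 ≤ s'.nat 8 0 ∧ s'.nat 8 0 < 2 * N) ∧
    (∀ y, 1 ≤ y → y < 2 * N → s'.nat 6 y ≤ N) ∧
    (∀ c < N, s'.nat 6 (N + c) = s.nat 6 (N + c)) ∧
    (∀ x, 1 ≤ x → x < N → x ≠ s'.nat 8 0 / 2 → IsNode (s.real 4) (s'.nat 6) x))
    (fun s' => Nat.log 2 (s'.nat 8 0)) 80 ⟨⟨hq, hqN⟩, hb, fun _ _ => rfl, hnode⟩ ?_ ?_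
  · rintro s₁ hf ⟨⟨h1, h2⟩, h3, h4, h5⟩ hb
    have hkey : s₁.real 4 = s.real 4 := hf.real 4 (by simp [playNode])
    simp only [Test.eval, NatExpr.eval_var, NatExpr.eval, not_le] at hb
    set q := s₁.nat 8 0 with hq'
    refine wp_seq (wp_setVar (by simp; omega)
      (wp_playNode (q := q / 2) (by simp [hq']) (by omega) ?_ ?_ ?_))
    · have := h3 (2 * (q / 2)) (by omega) (by omega)
      simp; omega
    · have := h3 (2 * (q / 2) + 1) (by omega) (by omega)
      simp; omega
    · intro t ht
      simp only [Memory.setNat_nat, Memory.setNat_real, hkey]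
      refine ⟨⟨?_, ?_, ?_, ?_⟩, ?_, ?_⟩
      · simp [← hq']; omega
      · intro y hy1 hy2
        simp
        split_ifs
        · rcases winner_eq_or (s.real 4) (s₁.nat 6 (2 * (q / 2))) (s₁.nat 6 (2 * (q / 2) + 1))
            with h | h
          · rw [h]; exact h3 _ (by omega) (by omega)
          · rw [h]; exact h3 _ (by omega) (by omega)
        · exact h3 y hy1 hy2
      · intro c hc
        simp [show N + c ≠ q / 2 by omega, h4 c hc]
      · intro x hx1 hxN hxq
        unfold IsNode
        simp [← hq'] at hxq ⊢
        rw [if_neg (show ¬ 2 * x = q / 2 by omega), if_neg (show ¬ 2 * x + 1 = q / 2 by omega)]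
        by_cases hxi : x = q / 2
        · rw [if_pos hxi, hxi]
        · rw [if_neg hxi]
          exact h5 x hx1 hxN hxi
      · simp [← hq']
        exact (show 2 ≤ q from hb)
      · simp; omega
  · rintro s₁ t hf ⟨⟨h1, h2⟩, h3, h4, h5⟩ hb ht
    simp only [Test.eval, NatExpr.eval_var, NatExpr.eval, not_le, not_lt] at hb
    refine ⟨h4, fun x hx hxN => h5 x hx hxN (by omega), ?_⟩
    simp at ht ⊢
    omega

/-- `π` lists the items `0, …, N - 1` by increasing keys. -/
structure IsSorting (N : ℕ) (key : ℕ → ℝ) (π : ℕ → ℕ) : Prop where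
  lt : ∀ i < N, π i < N
  inj : ∀ i < N, ∀ j < N, π i = π j → i = j
  mono : ∀ i j, i ≤ j → j < N → key (π i) ≤ key (π j)

/-- `π` lists `i` items in the order of their keys, with no smaller ones left, and the leaves of
the tournament tree `T` are the remaining items. -/
structure PartialSorting (N : ℕ) (key : ℕ → ℝ) (T : ℕ → ℕ) (i : ℕ) (π : ℕ → ℕ) : Prop where
  le : i ≤ N
  lt : ∀ j < i, π j < N
  inj : ∀ j < i, ∀ j' < i, π j = π j' → j = j'
  mono : ∀ j j', j ≤ j' → j' < i → key (π j) ≤ key (π j')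
  removed : ∀ j < i, T (N + π j) = 0
  remaining : ∀ c < N, (∀ j < i, π j ≠ c) →
    T (N + c) = c + 1 ∧ ∀ j < i, key (π j) ≤ key c

/-- Fewer than `N` items have been listed, so by counting one is left; its leaf makes the root
nonempty, and the root then shows a remaining item of least key. -/
theorem PartialSorting.exists_min {key : ℕ → ℝ} {T : ℕ → ℕ} {i : ℕ} {π : ℕ → ℕ}
    (h : PartialSorting N key T i π) (hi : i < N)
    (hnode : ∀ x, 1 ≤ x → x < N → IsNode key T x) :
    (∀ y, 1 ≤ y → y < 2 * N → T y ≤ N) ∧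
    ∃ c < N, T 1 = c + 1 ∧ (∀ j < i, π j ≠ c) ∧
      ∀ c' < N, (∀ j < i, π j ≠ c') → key c ≤ key c' := by
  have hleaf : ∀ c < N, T (N + c) = 0 ∨ T (N + c) = c + 1 := by
    intro c hc
    by_cases hr : ∃ j < i, π j = c
    · obtain ⟨j, hj, rfl⟩ := hr
      exact Or.inl (h.removed j hj)
    · push Not at hr
      exact Or.inr (h.remaining c hc hr).1
  have hval := tournament_valid hleaf 1 hnode le_rfl
  refine ⟨fun y h1 h2 => by rcases hval y h1 h2 with h | ⟨c, hc, h, -⟩ <;> omega, ?_⟩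
  have hroot := tournament_root hnode
  have hrem : ∀ c < N, (∀ j < i, π j ≠ c) → T 1 ≠ 0 ∧ key (T 1 - 1) ≤ key c := by
    intro c hc hr
    have h1 := (h.remaining c hc hr).1
    have h2 := hroot (N + c) (by omega) (by omega) (by omega)
    rwa [h1, Nat.add_sub_cancel] at h2
  obtain ⟨c₀, hc₀, hr₀⟩ : ∃ c < N, ∀ j < i, π j ≠ c := by
    by_contra hcon
    push Not at hcon
    have hsub : Finset.range N ⊆ (Finset.range i).image π := by
      intro c hc
      obtain ⟨j, hj, hjc⟩ := hcon c (Finset.mem_range.1 hc)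
      exact Finset.mem_image.2 ⟨j, Finset.mem_range.2 hj, hjc⟩
    have h1 := (Finset.card_le_card hsub).trans Finset.card_image_le
    simp at h1
    omega
  rcases hval 1 le_rfl (by omega) with h1 | ⟨c, hc, h1, h2⟩
  · exact absurd h1 (hrem c₀ hc₀ hr₀).1
  · refine ⟨c, hc, h1, ?_, fun c' hc' hr => ?_⟩
    · rintro j hj rfl
      have := h.removed j hj
      omega
    · have := (hrem c' hc' hr).2
      rwa [h1, Nat.add_sub_cancel] at this

theorem PartialSorting.succ {key : ℕ → ℝ} {T T' : ℕ → ℕ} {i : ℕ} {π π' : ℕ → ℕ} {c : ℕ}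
    (h : PartialSorting N key T i π) (hi : i < N) (hc : c < N) (hr : ∀ j < i, π j ≠ c)
    (hmin : ∀ c' < N, (∀ j < i, π j ≠ c') → key c ≤ key c')
    (hπ : ∀ j < i, π' j = π j) (hπi : π' i = c)
    (hT : ∀ c' < N, T' (N + c') = if c' = c then 0 else T (N + c')) :
    PartialSorting N key T' (i + 1) π' where
  le := hi
  lt := by
    intro j hj
    rcases Nat.lt_succ_iff_lt_or_eq.1 hj with hj | rfl
    · rw [hπ j hj]; exact h.lt j hj
    · rwa [hπi]
  inj := by
    intro j hj j' hj' he
    rcases Nat.lt_succ_iff_lt_or_eq.1 hj with hj | rfl <;>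
    rcases Nat.lt_succ_iff_lt_or_eq.1 hj' with hj' | rfl
    · rw [hπ j hj, hπ j' hj'] at he
      exact h.inj j hj j' hj' he
    · rw [hπ j hj, hπi] at he
      exact absurd he (hr j hj)
    · rw [hπ j' hj', hπi] at he
      exact absurd he.symm (hr j' hj')
    · rfl
  mono := by
    intro j j' hjj hj'
    rcases Nat.lt_succ_iff_lt_or_eq.1 hj' with hj' | rfl
    · rw [hπ j (by omega), hπ j' hj']
      exact h.mono j j' hjj hj'
    · rcases hjj.eq_or_lt with rfl | hjj
      · exact le_rfl
      · rw [hπ j hjj, hπi]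
        exact (h.remaining c hc hr).2 j hjj
  removed := by
    intro j hj
    rcases Nat.lt_succ_iff_lt_or_eq.1 hj with hj | rfl
    · rw [hπ j hj, hT _ (h.lt j hj), if_neg (hr j hj)]
      exact h.removed j hj
    · rw [hπi, hT c hc, if_pos rfl]
  remaining := by
    intro c' hc' hr'
    have hr'' : ∀ j < i, π j ≠ c' := fun j hj => by
      rw [← hπ j hj]; exact hr' j (by omega)
    have hne : c' ≠ c := fun he => hr' i (by omega) (by rw [hπi, he])
    obtain ⟨h1, h2⟩ := h.remaining c' hc' hr''
    refine ⟨by rw [hT c' hc', if_neg hne, h1], fun j hj => ?_⟩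
    rcases Nat.lt_succ_iff_lt_or_eq.1 hj with hj | rfl
    · rw [hπ j hj]; exact h2 j hj
    · rw [hπi]; exact hmin c' hc' hr''

theorem wp_extractAll (hN : s.nat 5 0 = N) (hW : 2 * N + 2 ≤ W)
    (hleaf : ∀ c < N, s.nat 6 (N + c) = c + 1)
    (hnode : ∀ x, 1 ≤ x → x < N → IsNode (s.real 4) (s.nat 6) x) :
    Wp W extractAll s fun s' t => IsSorting N (s.real 4) (s'.nat 7) ∧
      t ≤ 200 * (N + 1) * (Nat.log 2 (2 * N) + 1) := by
  have hlogmono : ∀ q < 2 * N, Nat.log 2 q ≤ Nat.log 2 (2 * N) :=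
    fun q hq => Nat.log_mono_right hq.le
  set ℓ := Nat.log 2 (2 * N) with hℓ
  refine wp_seq (wp_setVar (by simp) ?_)
  refine wp_loop (fun s' =>
      PartialSorting N (s.real 4) (s'.nat 6) (s'.nat 4 0) (s'.nat 7) ∧
      ∀ x, 1 ≤ x → x < N → IsNode (s.real 4) (s'.nat 6) x)
    (fun s => N - s.nat 4 0) (100 * (ℓ + 1) + 50) ?_ ?_ ?_
  · refine ⟨⟨by simp, ?_, ?_, ?_, ?_, ?_⟩, ?_⟩
    · simp
    · simp
    · simp
    · simp
    · intro c hc _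
      simpa using hleaf c hc
    · intro x hx hxN
      simpa [IsNode] using hnode x hx hxN
  · rintro s₁ hf ⟨h1, h2⟩ hb
    have h5 : s₁.nat 5 0 = N := by
      rw [hf.nat 5 (by simp [climb, playNode])]; simpa
    have hkey : s₁.real 4 = s.real 4 := hf.real 4 (by simp [climb, playNode])
    simp only [Test.eval, NatExpr.eval_var, h5, not_le] at hb
    obtain ⟨hbd, c, hc, hc1, hr, hmin⟩ := h1.exists_min hb h2
    set i := s₁.nat 4 0 with hi
    refine wp_seq (wp_storeNat (by simp; omega) (by simp; omega) (wp_seq (wp_setVar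
      (by simp [h5, hc1]; omega) (wp_seq (wp_storeNat (by simp [h5, hc1]; omega) (by simp) ?_)))))
    simp only [NatExpr.eval, NatExpr.eval_var, ← hi, hc1, Nat.add_sub_cancel]
    simp only [Memory.setNat_nat, h5, ← hi]
    simp
    refine wp_seq ((wp_climb hW (by simp; omega) (by simp; omega) ?_ ?_).mono ?_)
    · intro y hy1 hy2
      simp
      split_ifs
      exacts [Nat.zero_le _, hbd y hy1 hy2]
    · intro x hx hxN hxq
      simp at hxq
      have := h2 x hx hxN
      unfold IsNode at this ⊢
      simp [hkey]
      rwa [if_neg (by omega), if_neg (by omega), if_neg (by omega)]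
    · rintro s₂ t hf₂ ⟨h6, h7, h8⟩
      have h4' : s₂.nat 4 0 = i := by
        rw [hf₂.nat 4 (by simp [climb, playNode])]; simp [hi]
      have h7' : ∀ j, s₂.nat 7 j = if j = i then c else s₁.nat 7 j := by
        intro j
        rw [hf₂.nat 7 (by simp [climb, playNode])]; simp
      refine wp_incr (by rw [h4']; omega) ?_
      simp only [Memory.setNat_nat, h4']
      simp at h6 h7 h8 ⊢
      simp only [hkey] at h7
      have h9 := hlogmono (N + c) (by omega)
      refine ⟨⟨h1.succ hb hc hr hmin (fun j hj => by simp [h7', hj.ne])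
        (by simp [h7']) h6, h7⟩, by omega, by omega⟩
  · rintro s₁ t hf ⟨h1, h2⟩ hb ht
    have h5 : s₁.nat 5 0 = N := by
      rw [hf.nat 5 (by simp [climb, playNode])]; simpa
    simp only [Test.eval, NatExpr.eval_var, h5, not_le, not_lt] at hb
    have h6 : s₁.nat 4 0 = N := le_antisymm h1.le hb
    rw [h6] at h1
    refine ⟨⟨h1.lt, h1.inj, h1.mono⟩, ?_⟩
    simp at ht ⊢
    nlinarith

theorem wp_sortProgram (hN : s.nat 5 0 = N) (hW : 2 * N + 2 ≤ W) :
    Wp W sortProgram s fun s' t => IsSorting N (s.real 4) (s'.nat 7) ∧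
      t ≤ 400 * (N + 1) * (Nat.log 2 (2 * N) + 1) := by
  refine wp_seq ((wp_initLeaves hN hW).mono ?_)
  rintro s₁ t₁ hf₁ ⟨h1, ht₁⟩
  have hN₁ : s₁.nat 5 0 = N := by rw [hf₁.nat 5 (by simp [initLeaves])]; exact hN
  have hk₁ : s₁.real 4 = s.real 4 := hf₁.real 4 (by simp [initLeaves])
  refine wp_seq ((wp_buildTree hN₁ hW h1).mono ?_)
  rintro s₂ t₂ hf₂ ⟨h2, h3, ht₂⟩
  have hN₂ : s₂.nat 5 0 = N := by rw [hf₂.nat 5 (by simp [buildTree, playNode])]; exact hN₁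
  have hk₂ : s₂.real 4 = s₁.real 4 := hf₂.real 4 (by simp [buildTree, playNode])
  refine (wp_extractAll hN₂ hW h2 (by rwa [hk₂])).mono ?_
  rintro s₃ t₃ hf₃ ⟨h4, ht₃⟩
  rw [hk₂, hk₁] at h4
  refine ⟨h4, ?_⟩
  nlinarith

@[simp] theorem writesNat_sortProgram (a : ℕ) :
    sortProgram.WritesNat a ↔ a = 4 ∨ a = 6 ∨ a = 7 ∨ a = 8 := by
  simp [sortProgram, initLeaves, buildTree, extractAll, climb, playNode]
  tauto

@[simp] theorem writesReal_sortProgram (a : ℕ) : sortProgram.WritesReal a ↔ False := by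
  simp [sortProgram, initLeaves, buildTree, extractAll, climb, playNode]

end Tournament

/-! ### Covered shortest paths from a vertex -/

section Relax

variable {V : Type*} [DecidableEq V] [Finite V] {N : Network V}

/-- After relaxing the edges `0, …, i - 1`, where `Arc j a b` says that the edge `j` joins `a` and
`b`: the largest `t` for which a vertex is reached over these edges is given by `x`. -/
structure RelaxInv (N : Network V) (lam : ℝ) (u : V) (Arc : ℕ → V → V → Prop) (i : ℕ)
    (x : V → ℝ) : Prop where
  root : x u = lam / N.weight u
  iff : ∀ b, b ≠ u → ∀ t, 0 ≤ t → (t ≤ x b ↔ ∃ j < i, ∃ a, Arc j a b ∧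
    Tight N.graph N.len (N.vdist u) a b ∧ t ≤ x a ∧ t ≤ lam / N.weight b - N.vdist u b)

omit [DecidableEq V] in
theorem Tight.ne_root {u a b : V} (h : Tight N.graph N.len (N.vdist u) a b) : b ≠ u := by
  rintro rfl
  have h1 := h.lt N.len_pos
  rw [(N.isDistance_vdist b).root] at h1
  linarith [graphDist_nonneg N.len_pos N.connected b a]

/-- If (a, p) and (p, q) are tight, then d(a) < d(p) < d(q), so the edge ap has a smaller sum of end
distances than pq. Hence the bound of a vertex is final before it is used as a tail. -/
theorem RelaxInv.step_tight {lam : ℝ} {u : V} {Arc : ℕ → V → V → Prop} {i : ℕ} {x : V → ℝ}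
    (h : RelaxInv N lam u Arc i x) {p q : V} (hArc : ∀ a b, Arc i a b ↔ s(p, q) = s(a, b))
    (ht : Tight N.graph N.len (N.vdist u) p q)
    (hs : ∀ j < i, ∀ a b, Arc j a b → N.vdist u a + N.vdist u b ≤ N.vdist u p + N.vdist u q) :
    RelaxInv N lam u Arc (i + 1) (Function.update x q
      (max (x q) (min (x p) (lam / N.weight q - N.vdist u q)))) where
  root := by rw [Function.update_of_ne ht.ne_root.symm]; exact h.root
  iff := by
    intro b hb t h0
    have hpq := ht.lt N.len_pos
    have hpne : p ≠ q := ht.1.ne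
    -- No earlier tight arc starts at `q`: its sum of end distances would be larger than that of the
    -- current edge. So updating `q` does not disturb the invariant for earlier arcs.
    have hold : ∀ j < i, ∀ a b, Arc j a b → Tight N.graph N.len (N.vdist u) a b → a ≠ q := by
      rintro j hj a b harc hab rfl
      have h1 := hs j hj a b harc
      have h2 := hab.lt N.len_pos
      linarith
    have hlast : ∀ a, Arc i a b → Tight N.graph N.len (N.vdist u) a b → a = p ∧ b = q := by
      intro a harc hab
      rcases Sym2.eq_iff.1 ((hArc a b).1 harc) with ⟨h1, h2⟩ | ⟨h1, h2⟩
      · exact ⟨h1.symm, h2.symm⟩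
      · subst h1 h2
        exact absurd (hab.lt N.len_pos) hpq.asymm
    by_cases hbq : b = q
    · subst hbq
      rw [Function.update_self, le_max_iff, le_min_iff, h.iff b hb t h0]
      constructor
      · rintro (⟨j, hj, a, h1, h2, h3, h4⟩ | ⟨h3, h4⟩)
        · refine ⟨j, by omega, a, h1, h2, ?_, h4⟩
          rwa [Function.update_of_ne (hold j hj a b h1 h2)]
        · refine ⟨i, by omega, p, (hArc _ _).2 rfl, ht, ?_, h4⟩
          rwa [Function.update_of_ne hpne]
      · rintro ⟨j, hj, a, h1, h2, h3, h4⟩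
        rcases Nat.lt_succ_iff_lt_or_eq.1 hj with hj | rfl
        · rw [Function.update_of_ne (hold j hj a b h1 h2)] at h3
          exact Or.inl ⟨j, hj, a, h1, h2, h3, h4⟩
        · obtain ⟨rfl, -⟩ := hlast a h1 h2
          rw [Function.update_of_ne hpne] at h3
          exact Or.inr ⟨h3, h4⟩
    · rw [Function.update_of_ne hbq, h.iff b hb t h0]
      constructor
      · rintro ⟨j, hj, a, h1, h2, h3, h4⟩
        refine ⟨j, by omega, a, h1, h2, ?_, h4⟩
        rwa [Function.update_of_ne (hold j hj a b h1 h2)]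
      · rintro ⟨j, hj, a, h1, h2, h3, h4⟩
        rcases Nat.lt_succ_iff_lt_or_eq.1 hj with hj | rfl
        · rw [Function.update_of_ne (hold j hj a b h1 h2)] at h3
          exact ⟨j, hj, a, h1, h2, h3, h4⟩
        · exact absurd (hlast a h1 h2).2 hbq

omit [DecidableEq V] [Finite V] in
theorem RelaxInv.step_of_not_tight {lam : ℝ} {u : V} {Arc : ℕ → V → V → Prop} {i : ℕ} {x : V → ℝ}
    (h : RelaxInv N lam u Arc i x)
    (ht : ∀ a b, Arc i a b → ¬ Tight N.graph N.len (N.vdist u) a b) :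
    RelaxInv N lam u Arc (i + 1) x where
  root := h.root
  iff := by
    intro b hb t h0
    rw [h.iff b hb t h0]
    constructor
    · rintro ⟨j, hj, h⟩
      exact ⟨j, by omega, h⟩
    · rintro ⟨j, hj, a, h1, h2, h3⟩
      rcases Nat.lt_succ_iff_lt_or_eq.1 hj with hj | rfl
      · exact ⟨j, hj, a, h1, h2, h3⟩
      · exact absurd h2 (ht a b h1)

omit [DecidableEq V] in
-- Once all edges are relaxed, the recursion of the bounds is the recursion that defines `Reach`,
-- solved for `t`.
theorem RelaxInv.le_iff_reach {lam : ℝ} {u : V} {Arc : ℕ → V → V → Prop} {i : ℕ} {x : V → ℝ}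
    (h : RelaxInv N lam u Arc i x) (hArc : ∀ a b, N.graph.Adj a b → ∃ j < i, Arc j a b)
    {t : ℝ} (h0 : 0 ≤ t) : ∀ w, t ≤ x w ↔ N.Reach lam u t w := by
  refine finite_potential_induction (N.vdist u) fun w ih => ?_
  have hcov : ∀ b, t ≤ lam / N.weight b - N.vdist u b ↔
      N.weight b * (t + N.vdist u b) ≤ lam := fun b => by
    rw [le_sub_iff_add_le, le_div_iff₀' (N.weight_pos b)]
  have hroot := (N.isDistance_vdist u).root
  by_cases hw : w = u
  · subst hw
    have := hcov w
    rw [hroot, sub_zero, add_zero, ← h.root] at this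
    rw [this]
    refine ⟨.root, fun hr => ?_⟩
    have := hr.le
    rwa [hroot, add_zero] at this
  · rw [h.iff w hw t h0]
    constructor
    · rintro ⟨j, hj, a, h1, h2, h3, h4⟩
      exact ((ih a (h2.lt N.len_pos)).1 h3).step h2 ((hcov w).1 h4)
    · intro hr
      cases hr with
      | root => exact absurd rfl hw
      | @step a _ ha hab hc =>
        obtain ⟨j, hj, harc⟩ := hArc a w hab.1
        exact ⟨j, hj, a, harc, hab, (ih a (hab.lt N.len_pos)).2 ha, (hcov w).2 hc⟩

end Relax

/-! ### The program computing the bounds for one source vertex -/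

section ArmsProgram

variable {n m : ℕ}

/-- The memory holds the network in the input format. -/
structure HasInput (N : Network (Fin n)) (ends : Fin m → Fin n × Fin n) (lam : ℝ) (s : Memory) :
    Prop where
  card : s.nat 0 0 = n
  edges : s.nat 0 1 = m
  fst : ∀ e : Fin m, s.nat 1 e = (ends e).1
  snd : ∀ e : Fin m, s.nat 2 e = (ends e).2
  lam : s.real 0 0 = lam
  weight : ∀ v : Fin n, s.real 1 v = N.weight v
  len : ∀ e : Fin m, s.real 2 e = N.len (ends e).1 (ends e).2
  dist : ∀ u v : Fin n, s.real 3 (u * n + v) = N.vdist u v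

/-- The input occupies the natural arrays 0 to 2 and the real arrays 0 to 3; working storage lies
above them. -/
theorem HasInput.congr {N : Network (Fin n)} {ends : Fin m → Fin n × Fin n} {lam : ℝ}
    {s s' : Memory} (h : HasInput N ends lam s) (hn : ∀ a < 3, s'.nat a = s.nat a)
    (hr : ∀ a < 4, s'.real a = s.real a) : HasInput N ends lam s' where
  card := by rw [hn 0 (by norm_num)]; exact h.card
  edges := by rw [hn 0 (by norm_num)]; exact h.edges
  fst := by rw [hn 1 (by norm_num)]; exact h.fst
  snd := by rw [hn 2 (by norm_num)]; exact h.snd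
  lam := by rw [hr 0 (by norm_num)]; exact h.lam
  weight := by rw [hr 1 (by norm_num)]; exact h.weight
  len := by rw [hr 2 (by norm_num)]; exact h.len
  dist := by rw [hr 3 (by norm_num)]; exact h.dist

/-- The distance of the source (variable 9) and the vertex `x`. -/
def sourceDist (x : NatExpr) : RealExpr := .load 3 (.add (.mul (.var 9) (.var 0)) x)

@[simp] theorem cost_sourceDist (x : NatExpr) : (sourceDist x).cost = x.cost + 7 := by
  simp [sourceDist]; omega

theorem HasInput.eval_sourceDist {N : Network (Fin n)} {ends : Fin m → Fin n × Fin n} {lam : ℝ}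
    {s : Memory} (h : HasInput N ends lam s) {u v : Fin n} (hu : s.nat 9 0 = u) {x : NatExpr}
    (hx : x.eval s = v) : (sourceDist x).eval s = N.vdist u v := by
  simp only [sourceDist, RealExpr.eval, NatExpr.eval, NatExpr.eval_var, hu, h.card, hx]
  exact h.dist u v

/-- The sum of the distances of the end vertices of each edge, as its key. -/
def edgeKeys : Program :=
  .seq (.setVar 4 (.lit 0)) (.loop (.not (.natLe (.load 0 (.lit 1)) (.var 4)))
    (.seq (.storeReal 4 (.var 4)
      (.add (sourceDist (.load 1 (.var 4))) (sourceDist (.load 2 (.var 4))))) (.incr 4)))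

/-- Initialize the bounds of the vertices. -/
def initBounds : Program :=
  .seq (.setVar 4 (.lit 0)) (.seq (.loop (.not (.natLe (.var 0) (.var 4)))
    (.seq (.storeReal 5 (.var 4) (.lit (-1))) (.incr 4)))
    (.storeReal 5 (.var 9) (.div (.var 0) (.load 1 (.var 9)))))

/-- Relax the arc from `A[j]` to `B[j]`, where `j` is the variable 17. -/
def relaxArc (A B : ℕ) : Program :=
  .branch (.realLe (.add (sourceDist (.load A (.var 17))) (.load 2 (.var 17)))
      (sourceDist (.load B (.var 17))))
    (.seq (.storeReal 8 (.lit 0)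
      (.sub (.div (.var 0) (.load 1 (.load B (.var 17)))) (sourceDist (.load B (.var 17)))))
    (.seq (.branch (.realLe (.load 5 (.load A (.var 17))) (.var 8))
        (.storeReal 8 (.lit 0) (.load 5 (.load A (.var 17)))) .skip)
      (.branch (.realLe (.load 5 (.load B (.var 17))) (.var 8))
        (.storeReal 5 (.load B (.var 17)) (.var 8)) .skip)))
    .skip

/-- Relax all edges in the order given by the array 7. -/
def relaxAll : Program :=
  .seq (.setVar 4 (.lit 0)) (.loop (.not (.natLe (.load 0 (.lit 1)) (.var 4)))
    (.seq (.setVar 17 (.load 7 (.var 4)))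
      (.seq (relaxArc 1 2) (.seq (relaxArc 2 1) (.incr 4)))))

/-- For each vertex `w`, compute the largest `t` such that `w` is reached from the source by a
covered shortest path that is preceded by a path of length `t`. -/
def boundsProgram : Program :=
  .seq edgeKeys (.seq (.setVar 5 (.load 0 (.lit 1))) (.seq sortProgram (.seq initBounds relaxAll)))

variable {N : Network (Fin n)} {ends : Fin m → Fin n × Fin n} {lam : ℝ} {s : Memory} {W : ℕ}
  {u : Fin n}

theorem wp_edgeKeys (hin : HasInput N ends lam s) (hu : s.nat 9 0 = u) (hW : m ≤ W) :
    Wp W edgeKeys s fun s' t => (∀ e : Fin m, s'.real 4 e =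
      N.vdist u (ends e).1 + N.vdist u (ends e).2) ∧ t ≤ 60 * (m + 1) := by
  refine wp_seq (wp_setVar (by simp) ?_)
  refine wp_loop (fun s' => s'.nat 4 0 ≤ m ∧ ∀ e : Fin m, (e : ℕ) < s'.nat 4 0 → s'.real 4 e =
      N.vdist u (ends e).1 + N.vdist u (ends e).2) (fun s => m - s.nat 4 0) 40 (by simp) ?_ ?_
  · rintro s₁ hf ⟨h1, h2⟩ hb
    have hin₁ : HasInput N ends lam s₁ := hin.congr
      (fun a ha => by rw [hf.nat a (by simp; omega)]; ext; simp; omega)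
      (fun a ha => by rw [hf.real a (by simp; omega)]; rfl)
    have hu₁ : s₁.nat 9 0 = u := by rw [hf.nat 9 (by simp)]; simpa
    simp only [Test.eval, NatExpr.eval_var, NatExpr.eval, hin₁.edges, not_le] at hb
    set i := s₁.nat 4 0 with hi
    have hfst : (NatExpr.load 1 (.var 4)).eval s₁ = (ends ⟨i, hb⟩).1 := hin₁.fst ⟨i, hb⟩
    have hsnd : (NatExpr.load 2 (.var 4)).eval s₁ = (ends ⟨i, hb⟩).2 := hin₁.snd ⟨i, hb⟩
    refine wp_seq (wp_storeReal (by simp; omega) (wp_incr (by simp; omega) ?_))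
    simp only [RealExpr.eval, hin₁.eval_sourceDist hu₁ hfst, hin₁.eval_sourceDist hu₁ hsnd]
    simp [← hi]
    refine ⟨⟨by omega, fun e he => ?_⟩, by omega⟩
    split_ifs with hei
    · rw [show e = ⟨i, hb⟩ from Fin.ext hei]
    · exact h2 e (by omega)
  · rintro s₁ t hf ⟨h1, h2⟩ hb ht
    have h01 : s₁.nat 0 1 = m := by rw [hf.nat 0 (by simp)]; simpa using hin.edges
    simp only [Test.eval, NatExpr.eval_var, NatExpr.eval, h01, not_le, not_lt] at hb
    refine ⟨fun e => h2 e (by omega), ?_⟩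
    simp at ht ⊢
    omega

theorem wp_initBounds (hin : HasInput N ends lam s) (hu : s.nat 9 0 = u) (hW : n ≤ W) :
    Wp W initBounds s fun s' t => (∀ v : Fin n, s'.real 5 v =
      if v = u then lam / N.weight u else -1) ∧ t ≤ 40 * (n + 1) := by
  refine wp_seq (wp_setVar (by simp) (wp_seq ?_))
  refine wp_loop (fun s' => s'.nat 4 0 ≤ n ∧ ∀ v : Fin n, (v : ℕ) < s'.nat 4 0 → s'.real 5 v = -1)
      (fun s => n - s.nat 4 0) 20 (by simp) ?_ ?_
  · rintro s₁ hf ⟨h1, h2⟩ hb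
    have h0 : s₁.nat 0 0 = n := by rw [hf.nat 0 (by simp)]; simpa using hin.card
    simp only [Test.eval, NatExpr.eval_var, h0, not_le] at hb
    refine wp_seq (wp_storeReal (by simp; omega) (wp_incr (by simp; omega) ?_))
    simp
    refine ⟨⟨by omega, fun e he => ?_⟩, by omega⟩
    exact fun hei => h2 e (by omega)
  · rintro s₁ t hf ⟨h1, h2⟩ hb ht
    have h0 : s₁.nat 0 0 = n := by rw [hf.nat 0 (by simp)]; simpa using hin.card
    have hu₁ : s₁.nat 9 0 = u := by rw [hf.nat 9 (by simp)]; simpa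
    have hlam : s₁.real 0 0 = lam := by rw [hf.real 0 (by simp)]; simpa using hin.lam
    have hwt : s₁.real 1 u = N.weight u := by
      rw [hf.real 1 (by simp)]; simpa using hin.weight u
    simp only [Test.eval, NatExpr.eval_var, h0, not_le, not_lt] at hb
    have := u.2
    refine wp_storeReal (by simp; omega) ⟨fun v => ?_, ?_⟩
    · simp [hu₁, hlam, hwt, Fin.val_inj]
      split_ifs
      · rfl
      · exact h2 v (by omega)
    · simp at ht ⊢
      omega

/-- The inequality in the test detects tightness, since distances give the reverse inequality along
every edge. -/
theorem wp_relaxArc {Q : Memory → ℕ → Prop} (hin : HasInput N ends lam s) (hu : s.nat 9 0 = u)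
    (hW : n ≤ W) {A B : ℕ} {a b : Fin n} {e : Fin m} (he : s.nat 17 0 = e)
    (ha : s.nat A e = a) (hb : s.nat B e = b)
    (h : ∀ s' t, s'.nat = s.nat → (∀ r, r ≠ 5 → r ≠ 8 → s'.real r = s.real r) →
      (∀ v : Fin n, s'.real 5 v =
        if N.vdist u a + N.len (ends e).1 (ends e).2 ≤ N.vdist u b then
          Function.update (fun v : Fin n => s.real 5 v) b (max (s.real 5 b)
            (min (s.real 5 a) (lam / N.weight b - N.vdist u b))) v
        else s.real 5 v) → t ≤ 100 → Q s' t) : Wp W (relaxArc A B) s Q := by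
  have hA : (NatExpr.load A (.var 17)).eval s = a := by simp [he, ha]
  have hB : (NatExpr.load B (.var 17)).eval s = b := by simp [he, hb]
  have hlen := hin.len e
  refine wp_branch (fun hc => ?_) (fun hc => wp_skip (h _ _ rfl (fun _ _ _ => rfl) ?_ (by simp)))
  · simp only [Test.eval, RealExpr.eval, hin.eval_sourceDist hu hA, hin.eval_sourceDist hu hB,
      NatExpr.eval_var, he, hlen] at hc
    have hbW : (b : ℕ) ≤ W := by have := b.2; omega
    refine wp_seq (wp_storeReal (by simp) (wp_seq ?_))
    set c := lam / N.weight b - N.vdist u b with hcdef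
    have hcap : RealExpr.eval s (.sub (.div (.var 0) (.load 1 (.load B (.var 17))))
        (sourceDist (.load B (.var 17)))) = c := by
      simp only [RealExpr.eval, hin.eval_sourceDist hu hB, RealExpr.eval_var, hin.lam, hB,
        hin.weight, hcdef]
    rw [hcap]
    -- The last branch, which takes the maximum, is treated once for both outcomes of the preceding
    -- minimum.
    have key : ∀ s₁ : Memory, s₁.nat = s.nat →
        (∀ r, r ≠ 8 → s₁.real r = s.real r) → s₁.real 8 0 = min (s.real 5 a) c →
        Wp W (.branch (.realLe (.load 5 (.load B (.var 17))) (.var 8))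
          (.storeReal 5 (.load B (.var 17)) (.var 8)) .skip) s₁
          fun s' t => t ≤ 20 ∧ ∀ T ≤ 100, Q s' T := by
      intro s₁ h1 h2 h3
      have hB₁ : (NatExpr.load B (.var 17)).eval s₁ = b := by simp [h1, he, hb]
      have h5 := h2 5 (by norm_num)
      refine wp_branch (fun hd => wp_storeReal (hB₁.trans_le hbW)
        ⟨by simp, fun T hT => h _ _ h1 ?_ ?_ hT⟩)
        (fun hd => wp_skip ⟨by simp, fun T hT => h _ _ h1 ?_ ?_ hT⟩)
      · intro r hr hr'
        ext j
        simp [hr, h2 r hr']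
      · intro v
        simp only [Test.eval, RealExpr.eval, RealExpr.eval_var, hB₁, h3, h5] at hd
        simp only [hB₁, Memory.setReal_real, RealExpr.eval_var, h3, h5, if_pos hc, true_and]
        by_cases hv : v = b
        · subst hv; simp [max_eq_right hd]
        · simp [hv, Fin.val_inj]
      · exact fun r _ hr' => h2 r hr'
      · intro v
        simp only [Test.eval, RealExpr.eval, RealExpr.eval_var, hB₁, h3, h5, not_le] at hd
        simp only [h5, if_pos hc]
        by_cases hv : v = b
        · subst hv; simp [max_eq_left hd.le]
        · simp [hv]
    refine wp_branch (fun hd => ?_) (fun hd => ?_)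
    · refine wp_storeReal (by simp) ((key _ ?_ ?_ ?_).mono ?_)
      · rfl
      · intro r hr
        ext j
        simp [hr]
      · simp [he, ha] at hd ⊢
        exact hd
      · rintro s' t - ⟨ht, hQ⟩
        exact hQ _ (by simp; omega)
    · refine wp_skip ((key _ ?_ ?_ ?_).mono ?_)
      · rfl
      · intro r hr
        ext j
        simp [hr]
      · simp [he, ha] at hd ⊢
        exact hd.le
      · rintro s' t - ⟨ht, hQ⟩
        exact hQ _ (by simp; omega)
  · intro v
    simp only [Test.eval, RealExpr.eval, hin.eval_sourceDist hu hA, hin.eval_sourceDist hu hB,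
      NatExpr.eval_var, he, hlen] at hc
    rw [if_neg hc]

/-- The edges in the order of the list `π`. -/
def listedArc (ends : Fin m → Fin n × Fin n) (π : ℕ → ℕ) (j : ℕ) (a b : Fin n) : Prop :=
  ∃ e : Fin m, (e : ℕ) = π j ∧ s((ends e).1, (ends e).2) = s(a, b)

theorem wp_relaxAll (hin : HasInput N ends lam s) (hends : IsEdgeList N.graph ends)
    (hu : s.nat 9 0 = u) (hW : n + m ≤ W)
    (hsort : IsSorting m (s.real 4) (s.nat 7))
    (hkey : ∀ e : Fin m, s.real 4 e = N.vdist u (ends e).1 + N.vdist u (ends e).2)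
    (hinit : ∀ v : Fin n, s.real 5 v = if v = u then lam / N.weight u else -1) :
    Wp W relaxAll s fun s' t => (∀ t : ℝ, 0 ≤ t → ∀ w : Fin n,
      (t ≤ s'.real 5 w ↔ N.Reach lam u t w)) ∧ t ≤ 300 * (m + 1) := by
  refine wp_seq (wp_setVar (by simp) ?_)
  refine wp_loop (fun s' => s'.nat 4 0 ≤ m ∧ RelaxInv N lam u (listedArc ends (s.nat 7))
    (s'.nat 4 0) (fun v => s'.real 5 v)) (fun s => m - s.nat 4 0) 250 ?_ ?_ ?_
  -- The initial value -1 admits no `t ≥ 0`, as it should before any arc has been relaxed.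
  · refine ⟨by simp, by simp [hinit], fun b hb t h0 => ?_⟩
    simp [hinit, hb]
    linarith
  · rintro s₁ hf ⟨h1, h2⟩ hb
    have hin₁ : HasInput N ends lam s₁ := hin.congr
      (fun a ha => by rw [hf.nat a (by simp [relaxArc]; omega)]; ext; simp; omega)
      (fun a ha => by rw [hf.real a (by simp [relaxArc]; omega)]; rfl)
    have hu₁ : s₁.nat 9 0 = u := by rw [hf.nat 9 (by simp [relaxArc])]; simpa
    have hπ : s₁.nat 7 = s.nat 7 := by
      rw [hf.nat 7 (by simp [relaxArc])]; ext; simp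
    simp only [Test.eval, NatExpr.eval_var, NatExpr.eval, hin₁.edges, not_le] at hb
    set i := s₁.nat 4 0 with hi
    have hπi := hsort.lt i hb
    obtain ⟨e, he⟩ : ∃ e : Fin m, (e : ℕ) = s.nat 7 i := ⟨⟨_, hπi⟩, rfl⟩
    have hadj := hends.adj e
    have hlem := (N.isDistance_vdist u).le
    have hArc : ∀ a b, listedArc ends (s.nat 7) i a b ↔ s((ends e).1, (ends e).2) = s(a, b) := by
      intro a b
      constructor
      · rintro ⟨e', he', h⟩
        rwa [show e' = e from Fin.ext (he'.trans he.symm)] at h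
      · exact fun h => ⟨e, he, h⟩
    have hs : ∀ j < i, ∀ a b, listedArc ends (s.nat 7) j a b → N.vdist u a + N.vdist u b ≤
        N.vdist u (ends e).1 + N.vdist u (ends e).2 := by
      rintro j hj a b ⟨e', he', h⟩
      have h3 := hsort.mono j i hj.le hb
      rw [← he, ← he', hkey, hkey] at h3
      rcases Sym2.eq_iff.1 h with ⟨h4, h5⟩ | ⟨h4, h5⟩ <;> rw [h4, h5] at h3 <;> linarith
    refine wp_seq (wp_setVar (by simp [hπ, ← hi]; omega) (wp_seq ?_))
    simp only [NatExpr.eval, NatExpr.eval_var, ← hi, hπ, ← he]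
    set s₂ := s₁.setNat 17 0 e with hs₂
    have hin₂ : HasInput N ends lam s₂ := hin₁.congr
      (fun a ha => by ext; simp [hs₂]; omega) (fun a ha => rfl)
    refine wp_relaxArc (a := (ends e).1) (b := (ends e).2) (e := e) hin₂ (by simpa [hs₂] using hu₁)
      (by omega) (by simp [hs₂]) (hin₂.fst e) (hin₂.snd e) ?_
    intro s₃ t₃ hn₃ hr₃ hx₃ ht₃
    have hin₃ : HasInput N ends lam s₃ := hin₂.congr (fun a _ => by rw [hn₃])
      (fun a ha => hr₃ a (by omega) (by omega))
    refine wp_seq ?_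
    refine wp_relaxArc (a := (ends e).2) (b := (ends e).1) (e := e) hin₃
      (by simpa [hs₂, hn₃] using hu₁)
      (by omega) (by simp [hs₂, hn₃]) (hin₃.snd e) (hin₃.fst e) ?_
    intro s₄ t₄ hn₄ hr₄ hx₄ ht₄
    have h4 : s₄.nat 4 0 = i := by rw [hn₄, hn₃]; simp [hs₂, hi]
    refine wp_incr (by omega) ⟨⟨by simp [h4]; omega, ?_⟩, by simp [h4]; omega, by simp; omega⟩
    simp only [h4, Memory.setNat_nat, Memory.setNat_real, and_self, if_true]
    have hx2 : (fun v : Fin n => s₂.real 5 v) = fun v : Fin n => s₁.real 5 v := rfl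
    have hval : ∀ v : Fin n, s₂.real 5 v = s₁.real 5 v := fun v => rfl
    rw [hx2] at hx₃
    simp only [hval] at hx₃
    have e1 := hlem _ _ hadj
    have e2 := hlem _ _ hadj.symm
    rw [N.len_symm] at e2
    have hpos := N.len_pos _ _ hadj
    -- At most one of the two directions is tight, because the edge has positive length; the other
    -- relaxation changes nothing.
    by_cases hc1 : N.vdist u (ends e).1 + N.len (ends e).1 (ends e).2 ≤ N.vdist u (ends e).2
    · have hc2 : ¬ N.vdist u (ends e).2 + N.len (ends e).1 (ends e).2 ≤ N.vdist u (ends e).1 := by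
        intro h; linarith
      have := h2.step_tight hArc ⟨hadj, le_antisymm hc1 e1⟩ hs
      convert this using 1
      ext v
      rw [hx₄, if_neg hc2, hx₃, if_pos hc1]
    · by_cases hc2 : N.vdist u (ends e).2 + N.len (ends e).1 (ends e).2 ≤ N.vdist u (ends e).1
      · have := h2.step_tight (p := (ends e).2) (q := (ends e).1)
          (fun a b => by rw [hArc, Sym2.eq_swap (a := (ends e).1)])
          ⟨hadj.symm, by rw [N.len_symm]; exact le_antisymm hc2 e2⟩
          (fun j hj a b h => (hs j hj a b h).trans_eq (add_comm _ _))
        convert this using 1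
        ext v
        simp only [hx₄, if_pos hc2, hx₃, if_neg hc1]
      · have := h2.step_of_not_tight (by
          intro a b hab ht
          rcases Sym2.eq_iff.1 ((hArc a b).1 hab) with ⟨h4, h5⟩ | ⟨h4, h5⟩
          · rw [← h4, ← h5] at ht
            exact hc1 ht.2.le
          · rw [← h4, ← h5] at ht
            have := ht.2
            rw [N.len_symm] at this
            exact hc2 this.le)
        convert this using 1
        ext v
        rw [hx₄, if_neg hc2, hx₃, if_neg hc1]
  · rintro s₁ t hf ⟨h1, h2⟩ hb ht
    have h01 : s₁.nat 0 1 = m := by rw [hf.nat 0 (by simp [relaxArc])]; simpa using hin.edges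
    simp only [Test.eval, NatExpr.eval_var, NatExpr.eval, h01, not_le, not_lt] at hb
    have h3 : s₁.nat 4 0 = m := le_antisymm h1 hb
    rw [h3] at h2
    refine ⟨fun t h0 w => h2.le_iff_reach (fun a b hab => ?_) h0 w, ?_⟩
    · rw [← SimpleGraph.mem_edgeSet, ← hends.2] at hab
      obtain ⟨e, he⟩ := hab
      -- The sorted list is injective on a finite set, hence a permutation, so no edge is missed.
      have hsurj : Set.SurjOn (s.nat 7) (Finset.range m) (Finset.range m) := by
        refine Finset.surjOn_of_injOn_of_card_le _ (fun j hj => ?_) (fun j hj j' hj' h => ?_) le_rfl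
        · simpa using hsort.lt j (by simpa using hj)
        · exact hsort.inj j (by simpa using hj) j' (by simpa using hj') h
      obtain ⟨j, hj, hje⟩ := hsurj (show (e : ℕ) ∈ _ by simp)
      exact ⟨j, by simpa using hj, e, hje.symm, he⟩
    · simp at ht ⊢
      omega

theorem wp_boundsProgram (hin : HasInput N ends lam s) (hends : IsEdgeList N.graph ends)
    (hu : s.nat 9 0 = u) (hW : 2 * (n + m) + 2 ≤ W) :
    Wp W boundsProgram s fun s' t => (∀ t : ℝ, 0 ≤ t → ∀ w : Fin n,
      (t ≤ s'.real 5 w ↔ N.Reach lam u t w)) ∧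
      t ≤ 1000 * (m + n + 1) * (Nat.log 2 (2 * m) + 1) := by
  refine wp_seq ((wp_edgeKeys hin hu (by omega)).mono ?_)
  rintro s₁ t₁ hf₁ ⟨h1, ht₁⟩
  have hin₁ : HasInput N ends lam s₁ := hin.congr
    (fun a ha => hf₁.nat a (by simp [edgeKeys]; omega))
    (fun a ha => hf₁.real a (by simp [edgeKeys]; omega))
  have hu₁ : s₁.nat 9 0 = u := by rw [hf₁.nat 9 (by simp [edgeKeys])]; exact hu
  refine wp_seq (wp_setVar (by simp [hin₁.edges]; omega) (wp_seq ?_))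
  refine (wp_sortProgram (N := m) (by simp [hin₁.edges]) (by omega)).mono ?_
  rintro s₂ t₂ hf₂ ⟨h2, ht₂⟩
  have hin₂ : HasInput N ends lam s₂ := hin₁.congr
    (fun a ha => by rw [hf₂.nat a (by simp; omega)]; ext; simp; omega)
    (fun a ha => hf₂.real a (by simp))
  have hu₂ : s₂.nat 9 0 = u := by rw [hf₂.nat 9 (by simp)]; simpa using hu₁
  have hk₂ : s₂.real 4 = s₁.real 4 := hf₂.real 4 (by simp)
  refine wp_seq ((wp_initBounds hin₂ hu₂ (by omega)).mono ?_)
  rintro s₃ t₃ hf₃ ⟨h3, ht₃⟩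
  have hin₃ : HasInput N ends lam s₃ := hin₂.congr
    (fun a ha => hf₃.nat a (by simp [initBounds]; omega))
    (fun a ha => hf₃.real a (by simp [initBounds]; omega))
  have hu₃ : s₃.nat 9 0 = u := by rw [hf₃.nat 9 (by simp [initBounds])]; exact hu₂
  have hk₃ : s₃.real 4 = s₁.real 4 := by rw [hf₃.real 4 (by simp [initBounds]), hk₂]
  have hπ₃ : s₃.nat 7 = s₂.nat 7 := hf₃.nat 7 (by simp [initBounds])
  refine (wp_relaxAll hin₃ hends hu₃ (by omega) ?_ ?_ h3).mono ?_
  · rw [hk₃, hπ₃]; exact h2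
  · rw [hk₃]; exact h1
  · rintro s₄ t₄ hf₄ ⟨h4, ht₄⟩
    refine ⟨h4, ?_⟩
    simp only [NatExpr.cost]
    nlinarith

@[simp] theorem writesNat_boundsProgram (a : ℕ) :
    boundsProgram.WritesNat a ↔ a = 4 ∨ a = 5 ∨ a = 6 ∨ a = 7 ∨ a = 8 ∨ a = 17 := by
  simp [boundsProgram, edgeKeys, initBounds, relaxAll, relaxArc]
  tauto

@[simp] theorem writesReal_boundsProgram (a : ℕ) :
    boundsProgram.WritesReal a ↔ a = 4 ∨ a = 5 ∨ a = 8 := by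
  simp [boundsProgram, edgeKeys, initBounds, relaxAll, relaxArc]
  tauto

end ArmsProgram

/-! ### Functions given by sorted events -/

section Tally

open Classical in
/-- The number of `j < N` with `p j`. -/
noncomputable def tally (p : ℕ → Prop) (N : ℕ) : ℕ := Nat.count p N

@[simp] theorem tally_zero (p : ℕ → Prop) : tally p 0 = 0 := by
  classical exact Nat.count_zero p

open Classical in
theorem tally_succ (p : ℕ → Prop) (N : ℕ) : tally p (N + 1) = tally p N + if p N then 1 else 0 :=
  Nat.count_succ _ _

theorem tally_succ_of {p : ℕ → Prop} {N : ℕ} (h : p N) : tally p (N + 1) = tally p N + 1 := by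
  rw [tally_succ, if_pos h]

theorem tally_succ_of_not {p : ℕ → Prop} {N : ℕ} (h : ¬ p N) : tally p (N + 1) = tally p N := by
  rw [tally_succ, if_neg h, add_zero]

open Classical in
theorem tally_eq_card (p : ℕ → Prop) (N : ℕ) : tally p N = ((Finset.range N).filter p).card :=
  Nat.count_eq_card_filter_range _ _

theorem tally_mono {p q : ℕ → Prop} {N : ℕ} (h : ∀ j < N, p j → q j) : tally p N ≤ tally q N := by
  classical
  rw [tally_eq_card, tally_eq_card]
  refine Finset.card_le_card fun j hj => ?_
  rw [Finset.mem_filter, Finset.mem_range] at hj ⊢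
  exact ⟨hj.1, h j hj.1 hj.2⟩

theorem tally_congr {p q : ℕ → Prop} {N : ℕ} (h : ∀ j < N, (p j ↔ q j)) : tally p N = tally q N :=
  le_antisymm (tally_mono fun j hj => (h j hj).1) (tally_mono fun j hj => (h j hj).2)

theorem tally_lt {p q : ℕ → Prop} {N : ℕ} (h : ∀ j < N, p j → q j) {i : ℕ} (hi : i < N)
    (hq : q i) (hp : ¬ p i) : tally p N < tally q N := by
  classical
  rw [tally_eq_card, tally_eq_card]
  refine Finset.card_lt_card ((Finset.ssubset_iff_of_subset fun j hj => ?_).2 ⟨i, ?_, ?_⟩)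
  · rw [Finset.mem_filter, Finset.mem_range] at hj ⊢
    exact ⟨hj.1, h j hj.1 hj.2⟩
  · simp [hi, hq]
  · simp [hp]

theorem tally_eq_zero {p : ℕ → Prop} {N : ℕ} (h : ∀ j < N, ¬ p j) : tally p N = 0 := by
  rw [tally_congr (q := fun _ => False) fun j hj => iff_false_intro (h j hj), tally_eq_card]
  simp

theorem tally_le (p : ℕ → Prop) (N : ℕ) : tally p N ≤ N := by
  classical
  rw [tally_eq_card]
  simpa using Finset.card_filter_le (Finset.range N) p

theorem tally_le_tally (p : ℕ → Prop) {M N : ℕ} (h : M ≤ N) : tally p M ≤ tally p N := by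
  classical exact Nat.count_monotone p h

/-- A sorting is a permutation of the items, so it preserves counts. -/
theorem tally_comp_sorting {N : ℕ} {key : ℕ → ℝ} {π : ℕ → ℕ} (h : IsSorting N key π)
    (p : ℕ → Prop) : tally (fun j => p (π j)) N = tally p N := by
  classical
  have hsurj : Set.SurjOn π (Finset.range N) (Finset.range N) := by
    refine Finset.surjOn_of_injOn_of_card_le _ (fun j hj => ?_) (fun j hj j' hj' hh => ?_) le_rfl
    · simpa using h.lt j (by simpa using hj)
    · exact h.inj j (by simpa using hj) j' (by simpa using hj') hh
  rw [tally_eq_card, tally_eq_card]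
  refine Finset.card_nbij π (fun j hj => ?_) (fun j hj j' hj' hh => ?_) (fun c hc => ?_)
  · simp at hj ⊢
    exact ⟨h.lt j hj.1, hj.2⟩
  · simp at hj hj'
    exact h.inj j hj.1 j' hj'.1 hh
  · simp at hc
    obtain ⟨j, hj, rfl⟩ := hsurj (show c ∈ _ by simpa using hc.1)
    exact ⟨j, by simpa using ⟨by simpa using hj, hc.2⟩, rfl⟩

theorem tally_eq_ncard (p : ℕ → Prop) (n : ℕ) : tally p n = {w : Fin n | p w}.ncard := by
  classical
  rw [tally_eq_card, ← Set.ncard_coe_finset, ← Set.ncard_image_of_injective _ Fin.val_injective]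
  congr 1
  ext j
  simp only [Finset.coe_filter, Finset.mem_range, Set.mem_ofPred_eq, Set.mem_image]
  constructor
  · rintro ⟨h1, h2⟩
    exact ⟨⟨j, h1⟩, h2, rfl⟩
  · rintro ⟨w, h, rfl⟩
    exact ⟨w.2, h⟩

end Tally

/-- The function `f` on `[0, L]` is `base` minus the number of events of type `0` before the
argument plus the number of events of type `1` before or at the argument. -/
structure IsEvents (f : ℝ → ℕ) (L : ℝ) (N base : ℕ) (κ : ℕ → ℝ) (τ : ℕ → ℕ) : Prop where
  type : ∀ j < N, (τ j = 0 ∧ 0 ≤ κ j ∧ κ j < L) ∨ (τ j = 1 ∧ 0 < κ j ∧ κ j ≤ L)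
  count : ∀ t ∈ Icc 0 L, f t + tally (fun j => τ j = 0 ∧ κ j < t) N =
    base + tally (fun j => τ j = 1 ∧ κ j ≤ t) N
  le_base : tally (fun j => τ j = 0) N ≤ base

namespace IsEvents

variable {f : ℝ → ℕ} {L : ℝ} {N base : ℕ} {κ : ℕ → ℝ} {τ : ℕ → ℕ}

theorem comp_sorting (h : IsEvents f L N base κ τ) {key : ℕ → ℝ} {π : ℕ → ℕ}
    (hπ : IsSorting N key π) :
    IsEvents f L N base (fun j => κ (π j)) (fun j => τ (π j)) where
  type := fun j hj => h.type _ (hπ.lt j hj)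
  count := by
    intro t ht
    rw [tally_comp_sorting hπ (fun j => τ j = 0 ∧ κ j < t),
      tally_comp_sorting hπ (fun j => τ j = 1 ∧ κ j ≤ t)]
    exact h.count t ht
  le_base := by
    rw [tally_comp_sorting hπ (fun j => τ j = 0)]
    exact h.le_base

theorem mem_Icc (h : IsEvents f L N base κ τ) {j : ℕ} (hj : j < N) : κ j ∈ Icc 0 L := by
  rcases h.type j hj with h | h
  · exact ⟨h.2.1, h.2.2.le⟩
  · exact ⟨h.2.1.le, h.2.2⟩

theorem exists_gap (κ : ℕ → ℝ) (N : ℕ) (t : ℝ) : ∃ ε > 0, ∀ j < N, κ j ≠ t → ε ≤ |κ j - t| := by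
  induction N with
  | zero => exact ⟨1, one_pos, by simp⟩
  | succ N ih =>
    obtain ⟨ε, hε, h⟩ := ih
    by_cases hN : κ N = t
    · refine ⟨ε, hε, fun j hj hne => ?_⟩
      rcases Nat.lt_succ_iff_lt_or_eq.1 hj with hj | rfl
      · exact h j hj hne
      · exact absurd hN hne
    · refine ⟨min ε |κ N - t|, lt_min hε (abs_pos.2 (sub_ne_zero.2 hN)), fun j hj hne => ?_⟩
      rcases Nat.lt_succ_iff_lt_or_eq.1 hj with hj | rfl
      · exact (min_le_left _ _).trans (h j hj hne)
      · exact min_le_right _ _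

/-- Events never cancel, even at the same point: those of type `0` make the values just to the right
smaller, and those of type `1` make the values just to the left smaller, than the value at the
point. The bounds in `IsEvents.type` ensure that the side in question lies in the interval. -/
theorem breakpoints_eq (h : IsEvents f L N base κ τ) :
    breakpoints f L = {t | ∃ j < N, κ j = t} := by
  ext t
  obtain ⟨ε, hε, hgap⟩ := exists_gap κ N t
  constructor
  · rintro ⟨ht, hnot⟩
    by_contra hcon
    have hne : ∀ j < N, κ j ≠ t := fun j hj he => hcon ⟨j, hj, he⟩
    refine hnot ?_
    have hball : Metric.ball t ε ∩ Icc 0 L ∈ 𝓝[Icc 0 L] t :=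
      Filter.inter_mem (mem_nhdsWithin_of_mem_nhds (Metric.ball_mem_nhds t hε))
        self_mem_nhdsWithin
    filter_upwards [hball] with t' ht'
    have h1 := h.count t ht
    have h2 := h.count t' ht'.2
    have hd : |t' - t| < ε := by simpa [Real.dist_eq] using ht'.1
    have hiff : ∀ j < N, (κ j < t ↔ κ j < t') ∧ (κ j ≤ t ↔ κ j ≤ t') := by
      intro j hj
      have h3 := hgap j hj (hne j hj)
      rw [abs_lt] at hd
      rcases le_abs.1 h3 with h4 | h4
      · exact ⟨⟨fun _ => by linarith, fun _ => by linarith⟩,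
          ⟨fun _ => by linarith, fun _ => by linarith⟩⟩
      · exact ⟨⟨fun _ => by linarith, fun _ => by linarith⟩,
          ⟨fun _ => by linarith, fun _ => by linarith⟩⟩
    rw [tally_congr fun j hj => and_congr_right fun _ => (hiff j hj).1,
      tally_congr (p := fun j => τ j = 1 ∧ κ j ≤ t)
        fun j hj => and_congr_right fun _ => (hiff j hj).2] at h1
    omega
  · rintro ⟨i, hi, rfl⟩
    refine ⟨h.mem_Icc hi, fun hev => ?_⟩
    obtain ⟨δ, hδ, hev⟩ := Metric.mem_nhdsWithin_iff.1 hev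
    have hc := h.count _ (h.mem_Icc hi)
    rcases h.type i hi with ⟨hτ, h0, hL⟩ | ⟨hτ, h0, hL⟩
    -- A point just to the right of a drop, within the neighbourhood and before any further event.
    · obtain ⟨t, ht1, ht2⟩ := exists_between
        (lt_min (lt_min (lt_add_of_pos_right (κ i) hε) (lt_add_of_pos_right (κ i) hδ)) hL)
      rw [lt_min_iff, lt_min_iff] at ht2
      have htI : t ∈ Icc 0 L := ⟨by linarith, by linarith⟩
      have hft : f t = f (κ i) := hev ⟨by
        rw [Metric.mem_ball, Real.dist_eq, abs_of_pos (by linarith)]; linarith, htI⟩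
      have h2 := h.count t htI
      have h3 : tally (fun j => τ j = 0 ∧ κ j < κ i) N < tally (fun j => τ j = 0 ∧ κ j < t) N :=
        tally_lt (fun j _ hj => ⟨hj.1, hj.2.trans ht1⟩) hi ⟨hτ, ht1⟩ fun hc => lt_irrefl _ hc.2
      have h4 : tally (fun j => τ j = 1 ∧ κ j ≤ t) N =
          tally (fun j => τ j = 1 ∧ κ j ≤ κ i) N := by
        refine tally_congr fun j hj => and_congr_right fun _ => ⟨fun hle => ?_, fun hle => by linarith⟩
        by_contra hlt
        have := hgap j hj (fun he => hlt he.le)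
        rw [abs_of_pos (by linarith)] at this
        linarith
      omega
    -- A point just to the left of a rise, within the neighbourhood and after all earlier events.
    · obtain ⟨t, ht1, ht2⟩ := exists_between
        (max_lt (max_lt (sub_lt_self (κ i) hε) (sub_lt_self (κ i) hδ)) h0)
      rw [max_lt_iff, max_lt_iff] at ht1
      have htI : t ∈ Icc 0 L := ⟨by linarith, by linarith⟩
      have hft : f t = f (κ i) := hev ⟨by
        rw [Metric.mem_ball, Real.dist_eq, abs_of_neg (by linarith)]; linarith, htI⟩
      have h2 := h.count t htI
      have h3 : tally (fun j => τ j = 1 ∧ κ j ≤ t) N < tally (fun j => τ j = 1 ∧ κ j ≤ κ i) N :=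
        tally_lt (fun j _ hj => ⟨hj.1, hj.2.trans ht2.le⟩) hi ⟨hτ, le_rfl⟩
          fun hc => absurd hc.2 (not_le.2 ht2)
      have h4 : tally (fun j => τ j = 0 ∧ κ j < t) N =
          tally (fun j => τ j = 0 ∧ κ j < κ i) N := by
        refine tally_congr fun j hj => and_congr_right fun _ => ⟨fun hle => by linarith, fun hlt => ?_⟩
        by_contra hle
        have := hgap j hj hlt.ne
        rw [abs_of_neg (by linarith)] at this
        linarith
      omega

theorem map_zero (h : IsEvents f L N base κ τ) (hL : 0 ≤ L) : f 0 = base := by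
  have h1 := h.count 0 ⟨le_rfl, hL⟩
  rw [tally_eq_zero, tally_eq_zero] at h1
  · exact h1
  · rintro j hj ⟨h2, h3⟩
    rcases h.type j hj with h | h
    · omega
    · linarith [h.2.1]
  · rintro j hj ⟨h2, h3⟩
    linarith [(h.mem_Icc hj).1]

/-- The maximum of `f` is attained at `0` or at an event. -/
theorem le_base_or_le (h : IsEvents f L N base κ τ) {t : ℝ} (ht : t ∈ Icc 0 L) :
    f t ≤ base ∨ ∃ j < N, f t ≤ f (κ j) := by
  by_cases hex : ∃ j, j < N ∧ κ j ≤ t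
  -- Moving back to the last event up to `t` loses no rise, and it can only undo drops.
  · obtain ⟨i, ⟨hi, hit⟩, hmax⟩ := Set.exists_max_image {j | j < N ∧ κ j ≤ t} κ
      ((Set.finite_lt_nat N).subset fun j hj => hj.1) hex
    right
    refine ⟨i, hi, ?_⟩
    have h1 := h.count t ht
    have h2 := h.count _ (h.mem_Icc hi)
    have h3 : tally (fun j => τ j = 1 ∧ κ j ≤ t) N = tally (fun j => τ j = 1 ∧ κ j ≤ κ i) N :=
      tally_congr fun j hj => and_congr_right fun _ =>
        ⟨fun hle => hmax j ⟨hj, hle⟩, fun hle => hle.trans hit⟩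
    have h4 : tally (fun j => τ j = 0 ∧ κ j < κ i) N ≤ tally (fun j => τ j = 0 ∧ κ j < t) N :=
      tally_mono fun j _ hj => ⟨hj.1, hj.2.trans_le hit⟩
    omega
  · left
    have h1 := h.count t ht
    rw [tally_eq_zero (p := fun j => τ j = 1 ∧ κ j ≤ t) fun j hj hc => hex ⟨j, hj, hc.2⟩] at h1
    omega

end IsEvents

/-! ### The events of a family of intervals -/

/-- The state of the collection of events: the left ends `α` of the first `a` intervals and the
right ends `β` of the first `b` intervals have been processed. -/
structure CollectInv (α β : ℕ → ℝ) (L : ℝ) (n a b N base : ℕ) (κ : ℕ → ℝ) (τ : ℕ → ℕ) : Prop where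
  type : ∀ j < N, (τ j = 0 ∧ 0 ≤ κ j ∧ κ j < L) ∨ (τ j = 1 ∧ 0 < κ j ∧ κ j ≤ L)
  left : ∀ t ∈ Icc 0 L, base + tally (fun w => (α w < β w ∧ 0 < β w ∧ α w < L) ∧ α w < t) a =
    n + tally (fun j => τ j = 0 ∧ κ j < t) N
  right : ∀ t ∈ Icc 0 L, tally (fun w => (α w < β w ∧ 0 < β w ∧ α w < L) ∧ β w ≤ t) b =
    tally (fun j => τ j = 1 ∧ κ j ≤ t) N
  le_base : tally (fun j => τ j = 0) N + (n - a) ≤ base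
  base_le : base ≤ n
  card_le : N ≤ a + b

namespace CollectInv

variable {α β : ℕ → ℝ} {L : ℝ} {n a b N base : ℕ} {κ κ' : ℕ → ℝ} {τ τ' : ℕ → ℕ}

theorem init (α β : ℕ → ℝ) (L : ℝ) (n : ℕ) (κ : ℕ → ℝ) (τ : ℕ → ℕ) :
    CollectInv α β L n 0 0 0 n κ τ :=
  ⟨by simp, by simp, by simp, by simp, le_rfl, by simp⟩

theorem skip_left (h : CollectInv α β L n a b N base κ τ)
    (hw : ¬ (α a < β a ∧ 0 < β a ∧ α a < L)) : CollectInv α β L n (a + 1) b N base κ τ where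
  type := h.type
  left := fun t ht => by rw [tally_succ_of_not fun hc => hw hc.1]; exact h.left t ht
  right := h.right
  le_base := by have := h.le_base; omega
  base_le := h.base_le
  card_le := by have := h.card_le; omega

theorem skip_right (h : CollectInv α β L n a b N base κ τ)
    (hw : ¬ ((α b < β b ∧ 0 < β b ∧ α b < L) ∧ β b ≤ L)) :
    CollectInv α β L n a (b + 1) N base κ τ where
  type := h.type
  left := h.left
  right := fun t ht => by
    rw [tally_succ_of_not fun hc => hw ⟨hc.1, hc.2.trans ht.2⟩]; exact h.right t ht
  le_base := h.le_base
  base_le := h.base_le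
  card_le := by have := h.card_le; omega

/-- Each unprocessed left end keeps one unit of `base` in reserve, so the truncated subtraction in
`decr_left` is exact. -/
theorem base_pos (h : CollectInv α β L n a b N base κ τ) (ha : a < n) : 1 ≤ base := by
  have := h.le_base; omega

/-- A gap that begins before 0 and ends after it already excludes its vertex at 0; it lowers the
starting value instead of creating an event. -/
theorem decr_left (h : CollectInv α β L n a b N base κ τ) (ha : a < n)
    (hw : α a < β a ∧ 0 < β a ∧ α a < L) (h0 : α a < 0) :
    CollectInv α β L n (a + 1) b N (base - 1) κ τ where
  type := h.type
  left := fun t ht => by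
    rw [tally_succ_of ⟨hw, h0.trans_le ht.1⟩]
    have := h.left t ht
    have := h.base_pos ha
    omega
  right := h.right
  le_base := by have := h.le_base; omega
  base_le := by have := h.base_le; omega
  card_le := by have := h.card_le; omega

theorem push_left (h : CollectInv α β L n a b N base κ τ) (ha : a < n)
    (hw : α a < β a ∧ 0 < β a ∧ α a < L) (h0 : 0 ≤ α a)
    (hκ : ∀ j < N, κ' j = κ j) (hτ : ∀ j < N, τ' j = τ j) (hκN : κ' N = α a) (hτN : τ' N = 0) :
    CollectInv α β L n (a + 1) b (N + 1) base κ' τ' where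
  type := by
    intro j hj
    rcases Nat.lt_succ_iff_lt_or_eq.1 hj with hj | rfl
    · rw [hκ j hj, hτ j hj]; exact h.type j hj
    · left; rw [hκN]; exact ⟨hτN, h0, hw.2.2⟩
  left := fun t ht => by
    classical
    rw [tally_succ, tally_succ, tally_congr (p := fun j => τ' j = 0 ∧ κ' j < t)
      fun j hj => by rw [hκ j hj, hτ j hj], hκN, hτN]
    have := h.left t ht
    simp only [hw, true_and, and_self]
    omega
  right := fun t ht => by
    rw [tally_succ_of_not (N := N) (by rw [hτN]; simp), h.right t ht]
    exact tally_congr fun j hj => by rw [hκ j hj, hτ j hj]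
  le_base := by
    rw [tally_succ_of (p := fun j => τ' j = 0) hτN, tally_congr fun j hj => by rw [hτ j hj]]
    have := h.le_base
    omega
  base_le := h.base_le
  card_le := by have := h.card_le; omega

theorem push_right (h : CollectInv α β L n a b N base κ τ)
    (hw : α b < β b ∧ 0 < β b ∧ α b < L) (hL : β b ≤ L)
    (hκ : ∀ j < N, κ' j = κ j) (hτ : ∀ j < N, τ' j = τ j) (hκN : κ' N = β b) (hτN : τ' N = 1) :
    CollectInv α β L n a (b + 1) (N + 1) base κ' τ' where
  type := by
    intro j hj
    rcases Nat.lt_succ_iff_lt_or_eq.1 hj with hj | rfl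
    · rw [hκ j hj, hτ j hj]; exact h.type j hj
    · right; rw [hκN]; exact ⟨hτN, hw.2.1, hL⟩
  left := fun t ht => by
    rw [tally_succ_of_not (N := N) (by rw [hτN]; simp), h.left t ht]
    congr 1
    exact tally_congr fun j hj => by rw [hκ j hj, hτ j hj]
  right := fun t ht => by
    classical
    rw [tally_succ, tally_succ, tally_congr (p := fun j => τ' j = 1 ∧ κ' j ≤ t)
      fun j hj => by rw [hκ j hj, hτ j hj], hκN, hτN, h.right t ht]
    simp only [hw, true_and, and_self]
  le_base := by
    rw [tally_succ_of_not (p := fun j => τ' j = 0) (by rw [hτN]; simp),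
      tally_congr fun j hj => by rw [hτ j hj]]
    exact h.le_base
  base_le := h.base_le
  card_le := by have := h.card_le; omega

/-- Vertex `w` is missing exactly on the open interval from `α w` to `β w`. Only intervals that meet
the edge matter; each causes a drop after its left end and a rise at its right end, as far as these
lie on the edge. -/
theorem isEvents (h : CollectInv α β L n n n N base κ τ) {f : ℝ → ℕ}
    (hf : ∀ t ∈ Icc 0 L, f t = tally (fun w => t ≤ α w ∨ β w ≤ t) n) :
    IsEvents f L N base κ τ where
  type := h.type
  count := by
    intro t ht
    have h1 := h.left t ht
    have h2 := h.right t ht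
    -- The identity holds for each vertex separately: presence plus a past drop equals one plus a
    -- past rise. An interval that misses the edge leaves its vertex present throughout.
    have h3 : ∀ i, tally (fun w => t ≤ α w ∨ β w ≤ t) i +
        tally (fun w => (α w < β w ∧ 0 < β w ∧ α w < L) ∧ α w < t) i =
        i + tally (fun w => (α w < β w ∧ 0 < β w ∧ α w < L) ∧ β w ≤ t) i := by
      intro i
      induction i with
      | zero => simp
      | succ i ih =>
        by_cases hact : α i < β i ∧ 0 < β i ∧ α i < L
        · by_cases hα : α i < t
          · rw [tally_succ_of (p := fun w => (α w < β w ∧ 0 < β w ∧ α w < L) ∧ α w < t)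
              ⟨hact, hα⟩]
            by_cases hβ : β i ≤ t
            · rw [tally_succ_of (p := fun w => t ≤ α w ∨ β w ≤ t) (Or.inr hβ), tally_succ_of
                (p := fun w => (α w < β w ∧ 0 < β w ∧ α w < L) ∧ β w ≤ t) ⟨hact, hβ⟩]
              omega
            · rw [tally_succ_of_not (p := fun w => t ≤ α w ∨ β w ≤ t)
                (by rintro (h | h) <;> linarith), tally_succ_of_not
                (p := fun w => (α w < β w ∧ 0 < β w ∧ α w < L) ∧ β w ≤ t) fun h => hβ h.2]
              omega
          · rw [tally_succ_of_not (p := fun w => (α w < β w ∧ 0 < β w ∧ α w < L) ∧ α w < t)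
              fun h => hα h.2, tally_succ_of (p := fun w => t ≤ α w ∨ β w ≤ t)
              (Or.inl (not_lt.1 hα)), tally_succ_of_not
              (p := fun w => (α w < β w ∧ 0 < β w ∧ α w < L) ∧ β w ≤ t)
              fun h => by linarith [h.2, h.1.1]]
            omega
        · rw [tally_succ_of_not (p := fun w => (α w < β w ∧ 0 < β w ∧ α w < L) ∧ α w < t)
            fun h => hact h.1, tally_succ_of_not
            (p := fun w => (α w < β w ∧ 0 < β w ∧ α w < L) ∧ β w ≤ t) fun h => hact h.1,
            tally_succ_of (p := fun w => t ≤ α w ∨ β w ≤ t)]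
          · omega
          · by_contra hc
            push Not at hc
            exact hact ⟨by linarith, by linarith [ht.1], by linarith [ht.2]⟩
    have h4 := h3 n
    rw [hf t ht]
    omega
  le_base := by have := h.le_base; omega

end CollectInv

/-! ### The sweep over the sorted events -/

/-- The state of the sweep over events sorted by `κ`: the points `bp 0 < … < bp (c - 1)` are those
of the first `k` events, and `val` and `aft` are the values at and after these points of the
function given by the first `i` events; `aft 0` is its value before these points. -/
structure SweepInv (κ : ℕ → ℝ) (τ : ℕ → ℕ) (base i k c : ℕ) (bp : ℕ → ℝ) (val aft : ℕ → ℕ) :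
    Prop where
  le : c ≤ k
  mono : ∀ q q', q < q' → q' < c → bp q < bp q'
  listed : ∀ q < c, ∃ j < k, bp q = κ j
  covers : ∀ j < k, ∃ q < c, κ j = bp q
  val : ∀ q < c, val q + tally (fun j => τ j = 0 ∧ κ j < bp q) i =
    base + tally (fun j => τ j = 1 ∧ κ j ≤ bp q) i
  first : aft 0 = base
  after : ∀ q < c, aft (q + 1) + tally (fun j => τ j = 0 ∧ κ j ≤ bp q) i =
    base + tally (fun j => τ j = 1 ∧ κ j ≤ bp q) i

namespace SweepInv

variable {κ : ℕ → ℝ} {τ : ℕ → ℕ} {base i k c N : ℕ} {bp bp' : ℕ → ℝ} {val val' aft aft' : ℕ → ℕ}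

theorem init (κ : ℕ → ℝ) (τ : ℕ → ℕ) (bp : ℕ → ℝ) (val : ℕ → ℕ) (h : aft 0 = base) :
    SweepInv κ τ base 0 0 0 bp val aft :=
  ⟨le_rfl, by simp, by simp, by simp, by simp, h, by simp⟩

theorem mono_le (h : SweepInv κ τ base i k c bp val aft) {q q' : ℕ} (hq : q ≤ q') (hc : q' < c) :
    bp q ≤ bp q' := by
  rcases hq.eq_or_lt with rfl | hq
  · exact le_rfl
  · exact (h.mono q q' hq hc).le

theorem last_eq (h : SweepInv κ τ base i (k + 1) c bp val aft)
    (hs : ∀ j j', j ≤ j' → j' < N → κ j ≤ κ j') (hk : k < N) : 1 ≤ c ∧ bp (c - 1) = κ k := by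
  obtain ⟨q, hq, hkq⟩ := h.covers k (by omega)
  refine ⟨by omega, le_antisymm ?_ ?_⟩
  · obtain ⟨j, hj, hjc⟩ := h.listed (c - 1) (by omega)
    rw [hjc]
    exact hs j k (by omega) hk
  · rw [hkq]
    exact h.mono_le (by omega) (by omega)

/-- By sortedness the key is at least the last point, so the test with `≤` detects equality. -/
theorem old_point (h : SweepInv κ τ base i i c bp val aft)
    (hs : ∀ j j', j ≤ j' → j' < N → κ j ≤ κ j') (hi : i < N) (hc : 1 ≤ c)
    (hle : κ i ≤ bp (c - 1)) : SweepInv κ τ base i (i + 1) c bp val aft where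
  le := by have := h.le; omega
  mono := h.mono
  listed := fun q hq => by
    obtain ⟨j, hj, he⟩ := h.listed q hq
    exact ⟨j, by omega, he⟩
  covers := by
    intro j hj
    rcases Nat.lt_succ_iff_lt_or_eq.1 hj with hj | rfl
    · exact h.covers j hj
    · refine ⟨c - 1, by omega, le_antisymm hle ?_⟩
      obtain ⟨j', hj', he⟩ := h.listed (c - 1) (by omega)
      rw [he]
      exact hs j' j hj'.le hi
  val := h.val
  first := h.first
  after := h.after

/-- All earlier events lie strictly before the new point, so the value after the previous point is a
correct provisional value both at and after the new one. -/
theorem new_point (h : SweepInv κ τ base i i c bp val aft)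
    (hlt : ¬ (1 ≤ c ∧ κ i ≤ bp (c - 1)))
    (hbp : ∀ q < c, bp' q = bp q) (hbpc : bp' c = κ i)
    (hval : ∀ q < c, val' q = val q) (hvalc : val' c = aft c)
    (haft : ∀ q ≤ c, aft' q = aft q) (haftc : aft' (c + 1) = aft c) :
    SweepInv κ τ base i (i + 1) (c + 1) bp' val' aft' := by
  have hlast : ∀ q < c, bp q < κ i := by
    intro q hq
    have h1 := h.mono_le (q := q) (q' := c - 1) (by omega) (by omega)
    by_contra hcon
    exact hlt ⟨by omega, (not_lt.1 hcon).trans h1⟩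
  have hlt' : ∀ j < i, κ j < κ i := by
    intro j hj
    obtain ⟨q, hq, he⟩ := h.covers j hj
    rw [he]
    exact hlast q hq
  -- Every event counted so far lies at or before the last point, so the conditions on the keys are
  -- void. Without points there are no events yet.
  have hnew : aft c + tally (fun j => τ j = 0) i = base + tally (fun j => τ j = 1) i := by
    by_cases hc : c = 0
    · subst hc
      have hi0 : i = 0 := by
        by_contra hne
        obtain ⟨q, hq, -⟩ := h.covers 0 (by omega)
        omega
      subst hi0
      simp [h.first]
    · have h1 := h.after (c - 1) (by omega)
      rw [show c - 1 + 1 = c by omega] at h1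
      have hall : ∀ j < i, κ j ≤ bp (c - 1) := by
        intro j hj
        obtain ⟨q, hq, he⟩ := h.covers j hj
        rw [he]
        exact h.mono_le (by omega) (by omega)
      rwa [tally_congr (p := fun j => τ j = 0 ∧ κ j ≤ bp (c - 1)) (q := fun j => τ j = 0)
          fun j hj => and_iff_left (hall j hj),
        tally_congr (p := fun j => τ j = 1 ∧ κ j ≤ bp (c - 1)) (q := fun j => τ j = 1)
          fun j hj => and_iff_left (hall j hj)] at h1
  refine ⟨by have := h.le; omega, ?_, ?_, ?_, ?_, ?_, ?_⟩
  · intro q q' hqq hq'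
    rcases Nat.lt_succ_iff_lt_or_eq.1 hq' with hq' | rfl
    · rw [hbp q (by omega), hbp q' hq']
      exact h.mono q q' hqq hq'
    · rw [hbp q hqq, hbpc]
      exact hlast q hqq
  · intro q hq
    rcases Nat.lt_succ_iff_lt_or_eq.1 hq with hq | rfl
    · obtain ⟨j, hj, he⟩ := h.listed q hq
      exact ⟨j, by omega, by rw [hbp q hq, he]⟩
    · exact ⟨i, by omega, hbpc⟩
  · intro j hj
    rcases Nat.lt_succ_iff_lt_or_eq.1 hj with hj | rfl
    · obtain ⟨q, hq, he⟩ := h.covers j hj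
      exact ⟨q, by omega, by rw [hbp q hq, he]⟩
    · exact ⟨c, by omega, hbpc.symm⟩
  · intro q hq
    rcases Nat.lt_succ_iff_lt_or_eq.1 hq with hq | rfl
    · rw [hbp q hq, hval q hq]
      exact h.val q hq
    · rw [hbpc, hvalc, tally_congr (p := fun j => τ j = 0 ∧ κ j < κ i) (q := fun j => τ j = 0)
          fun j hj => and_iff_left (hlt' j hj),
        tally_congr (p := fun j => τ j = 1 ∧ κ j ≤ κ i) (q := fun j => τ j = 1)
          fun j hj => and_iff_left (hlt' j hj).le]
      exact hnew
  · rw [haft 0 (Nat.zero_le _)]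
    exact h.first
  · intro q hq
    rcases Nat.lt_succ_iff_lt_or_eq.1 hq with hq | rfl
    · rw [hbp q hq, haft (q + 1) hq]
      exact h.after q hq
    · rw [hbpc, haftc, tally_congr (p := fun j => τ j = 0 ∧ κ j ≤ κ i) (q := fun j => τ j = 0)
          fun j hj => and_iff_left (hlt' j hj).le,
        tally_congr (p := fun j => τ j = 1 ∧ κ j ≤ κ i) (q := fun j => τ j = 1)
          fun j hj => and_iff_left (hlt' j hj).le]
      exact hnew

/-- A drop affects only the piece after the last point. The total number of drops is at most `base`,
so the truncated subtraction is exact. -/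
theorem count_zero (h : SweepInv κ τ base i (i + 1) c bp val aft)
    (hs : ∀ j j', j ≤ j' → j' < N → κ j ≤ κ j') (hi : i < N) (hτ : τ i = 0)
    (hbase : tally (fun j => τ j = 0) N ≤ base)
    (haft : ∀ q < c, aft' q = aft q) (haftc : aft' c = aft c - 1) :
    SweepInv κ τ base (i + 1) (i + 1) c bp val aft' := by
  obtain ⟨hc, hlast⟩ := h.last_eq hs hi
  have hle : ∀ q < c, bp q ≤ κ i := fun q hq => by
    rw [← hlast]; exact h.mono_le (by omega) (by omega)
  have hlt : ∀ q, q + 1 < c → bp q < κ i := fun q hq => by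
    rw [← hlast]; exact h.mono _ _ (by omega) (by omega)
  refine ⟨h.le, h.mono, h.listed, h.covers, ?_, ?_, ?_⟩
  · intro q hq
    rw [tally_succ_of_not (p := fun j => τ j = 0 ∧ κ j < bp q)
        fun hh => absurd hh.2 (not_lt.2 (hle q hq)),
      tally_succ_of_not (p := fun j => τ j = 1 ∧ κ j ≤ bp q) fun hh => by have := hh.1; omega]
    exact h.val q hq
  · rw [haft 0 (by omega)]
    exact h.first
  · intro q hq
    rw [tally_succ_of_not (p := fun j => τ j = 1 ∧ κ j ≤ bp q) fun hh => by have := hh.1; omega]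
    have h1 := h.after q hq
    by_cases hqc : q + 1 < c
    · rw [haft _ hqc, tally_succ_of_not (p := fun j => τ j = 0 ∧ κ j ≤ bp q)
        fun hh => absurd hh.2 (not_le.2 (hlt q hqc))]
      exact h1
    · obtain rfl : q = c - 1 := by omega
      rw [show c - 1 + 1 = c by omega] at h1 ⊢
      have h2 : tally (fun j => τ j = 0 ∧ κ j ≤ bp (c - 1)) (i + 1) ≤
          tally (fun j => τ j = 0) N :=
        (tally_mono fun j _ hj => hj.1).trans (tally_le_tally _ hi)
      rw [tally_succ_of (p := fun j => τ j = 0 ∧ κ j ≤ bp (c - 1)) ⟨hτ, hlast.ge⟩] at h2 ⊢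
      rw [haftc]
      omega

/-- A rise affects the value at the last point and the piece after it. Since a drop does not touch
the value at the point, events with equal keys may be counted in any order. -/
theorem count_one (h : SweepInv κ τ base i (i + 1) c bp val aft)
    (hs : ∀ j j', j ≤ j' → j' < N → κ j ≤ κ j') (hi : i < N) (hτ : τ i = 1)
    (hval : ∀ q, q + 1 < c → val' q = val q) (hvalc : val' (c - 1) = val (c - 1) + 1)
    (haft : ∀ q < c, aft' q = aft q) (haftc : aft' c = aft c + 1) :
    SweepInv κ τ base (i + 1) (i + 1) c bp val' aft' := by
  obtain ⟨hc, hlast⟩ := h.last_eq hs hi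
  have hlt : ∀ q, q + 1 < c → bp q < κ i := fun q hq => by
    rw [← hlast]; exact h.mono _ _ (by omega) (by omega)
  refine ⟨h.le, h.mono, h.listed, h.covers, ?_, ?_, ?_⟩
  · intro q hq
    rw [tally_succ_of_not (p := fun j => τ j = 0 ∧ κ j < bp q) fun hh => by have := hh.1; omega]
    have h1 := h.val q hq
    by_cases hqc : q + 1 < c
    · rw [hval _ hqc, tally_succ_of_not (p := fun j => τ j = 1 ∧ κ j ≤ bp q)
        fun hh => absurd hh.2 (not_le.2 (hlt q hqc))]
      exact h1
    · obtain rfl : q = c - 1 := by omega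
      rw [tally_succ_of (p := fun j => τ j = 1 ∧ κ j ≤ bp (c - 1)) ⟨hτ, hlast.ge⟩, hvalc]
      omega
  · rw [haft 0 (by omega)]
    exact h.first
  · intro q hq
    rw [tally_succ_of_not (p := fun j => τ j = 0 ∧ κ j ≤ bp q) fun hh => by have := hh.1; omega]
    have h1 := h.after q hq
    by_cases hqc : q + 1 < c
    · rw [haft _ hqc, tally_succ_of_not (p := fun j => τ j = 1 ∧ κ j ≤ bp q)
        fun hh => absurd hh.2 (not_le.2 (hlt q hqc))]
      exact h1
    · obtain rfl : q = c - 1 := by omega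
      rw [show c - 1 + 1 = c by omega] at h1 ⊢
      rw [tally_succ_of (p := fun j => τ j = 1 ∧ κ j ≤ bp (c - 1)) ⟨hτ, hlast.ge⟩, haftc]
      omega

theorem val_le (h : SweepInv κ τ base i k c bp val aft) {q : ℕ} (hq : q < c) :
    val q ≤ base + i := by
  have h1 := h.val q hq
  have h2 := tally_le (fun j => τ j = 1 ∧ κ j ≤ bp q) i
  omega

theorem aft_le (h : SweepInv κ τ base i k c bp val aft) {q : ℕ} (hq : q ≤ c) :
    aft q ≤ base + i := by
  rcases q with _ | q
  · rw [h.first]; omega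
  · have h1 := h.after q hq
    have h2 := tally_le (fun j => τ j = 1 ∧ κ j ≤ bp q) i
    omega

end SweepInv

/-! ### Tables of piecewise constant functions -/

/-- The points `bp 0 < … < bp (c - 1)` are the breakpoints of `f` on `[0, L]`; the values of `f` at
them are listed by `val`, and its values before, between and after them by `aft`. -/
structure IsTable (f : ℝ → ℕ) (L : ℝ) (c : ℕ) (bp : ℕ → ℝ) (val aft : ℕ → ℕ) : Prop where
  breakpoints_eq : bp '' Set.Iio c = breakpoints f L
  strictMonoOn : StrictMonoOn bp (Set.Iio c)
  val_eq : ∀ q < c, val q = f (bp q)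
  aft_eq : ∀ t ∈ Icc 0 L, t ∉ breakpoints f L → f t = aft {b | b ∈ breakpoints f L ∧ b < t}.ncard
  exists_le_iff : 0 ≤ L → ∀ k, (∃ t ∈ Icc 0 L, k ≤ f t) ↔ k ≤ aft 0 ∨ ∃ q < c, k ≤ val q

theorem IsTable.ncard {f : ℝ → ℕ} {L : ℝ} {c : ℕ} {bp : ℕ → ℝ} {val aft : ℕ → ℕ}
    (h : IsTable f L c bp val aft) : (breakpoints f L).ncard = c := by
  rw [← h.breakpoints_eq, h.strictMonoOn.injOn.ncard_image, Set.ncard_eq_toFinset_card']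
  simp

/-- When all events are counted, the identities of the sweep at and between the points coincide with
those defining the function. -/
theorem SweepInv.isTable {κ : ℕ → ℝ} {τ : ℕ → ℕ} {base c N : ℕ} {bp : ℕ → ℝ} {val aft : ℕ → ℕ}
    (h : SweepInv κ τ base N N c bp val aft) {f : ℝ → ℕ} {L : ℝ}
    (hf : IsEvents f L N base κ τ) : IsTable f L c bp val aft := by
  have hbp : breakpoints f L = bp '' Set.Iio c := by
    rw [hf.breakpoints_eq]
    ext t
    constructor
    · rintro ⟨j, hj, rfl⟩
      obtain ⟨q, hq, he⟩ := h.covers j hj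
      exact ⟨q, hq, he.symm⟩
    · rintro ⟨q, hq, rfl⟩
      obtain ⟨j, hj, he⟩ := h.listed q hq
      exact ⟨j, hj, he.symm⟩
  have hmono : StrictMonoOn bp (Set.Iio c) := fun q _ q' hq' hqq => h.mono q q' hqq hq'
  have hmem : ∀ q < c, bp q ∈ Icc 0 L := by
    intro q hq
    obtain ⟨j, hj, he⟩ := h.listed q hq
    rw [he]
    exact hf.mem_Icc hj
  have hval : ∀ q < c, val q = f (bp q) := by
    intro q hq
    have h1 := h.val q hq
    have h2 := hf.count _ (hmem q hq)
    omega
  refine ⟨hbp.symm, hmono, hval, ?_, ?_⟩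
  · intro t ht htb
    have hne : ∀ q < c, bp q ≠ t := fun q hq he => htb (hbp ▸ ⟨q, hq, he⟩)
    have hkne : ∀ j < N, κ j ≠ t := by
      intro j hj
      obtain ⟨q, hq, he⟩ := h.covers j hj
      rw [he]
      exact hne q hq
    set r := {b | b ∈ breakpoints f L ∧ b < t}.ncard with hr
    have hset : {b | b ∈ breakpoints f L ∧ b < t} = bp '' {q | q < c ∧ bp q < t} := by
      rw [hbp]
      ext b
      constructor
      · rintro ⟨⟨q, hq, rfl⟩, hb⟩
        exact ⟨q, ⟨hq, hb⟩, rfl⟩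
      · rintro ⟨q, ⟨hq, hb⟩, rfl⟩
        exact ⟨⟨q, hq, rfl⟩, hb⟩
    have hrc : {q | q < c ∧ bp q < t}.ncard = r := by
      rw [hr, hset]
      exact ((hmono.injOn.mono fun q hq => hq.1).ncard_image).symm
    -- The points before `t` are exactly those with index less than `z`, so `z` is the index of the
    -- piece containing `t`.
    obtain ⟨z, hz, hz1, hz2⟩ : ∃ z ≤ c, (∀ q < z, bp q < t) ∧ ∀ q, z ≤ q → q < c → t < bp q := by
      by_cases hex : ∃ q, q < c ∧ t < bp q
      · classical
        refine ⟨Nat.find hex, (Nat.find_spec hex).1.le, fun q hq => ?_, fun q hq hqc => ?_⟩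
        · have h1 := Nat.find_min hex hq
          have h2 : q < c := hq.trans (Nat.find_spec hex).1
          exact lt_of_le_of_ne (not_lt.1 fun hc => h1 ⟨h2, hc⟩) (hne q h2)
        · exact (Nat.find_spec hex).2.trans_le (h.mono_le hq hqc)
      · push Not at hex
        exact ⟨c, le_rfl, fun q hq => lt_of_le_of_ne (hex q hq) (hne q hq), fun q hq hqc => by omega⟩
    have hzr : z = r := by
      rw [← hrc, show {q | q < c ∧ bp q < t} = Set.Iio z from ?_, Set.ncard_eq_toFinset_card']
      · simp
      · ext q
        constructor
        · rintro ⟨hq, hb⟩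
          by_contra hcon
          exact lt_asymm hb (hz2 q (not_lt.1 hcon) hq)
        · exact fun hq => ⟨lt_of_lt_of_le hq hz, hz1 q hq⟩
    rw [← hzr]
    have hcount := hf.count t ht
    rcases z with _ | z
    · rw [h.first]
      have hlt : ∀ j < N, t < κ j := by
        intro j hj
        obtain ⟨q, hq, he⟩ := h.covers j hj
        rw [he]
        exact hz2 q (Nat.zero_le _) hq
      rw [tally_eq_zero fun j hj hc => lt_asymm hc.2 (hlt j hj),
        tally_eq_zero fun j hj hc => absurd hc.2 (not_le.2 (hlt j hj))] at hcount
      omega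
    · have h1 := h.after z (by omega)
      have hiff : ∀ j < N, (κ j < t ↔ κ j ≤ bp z) ∧ (κ j ≤ t ↔ κ j ≤ bp z) := by
        intro j hj
        obtain ⟨q, hq, he⟩ := h.covers j hj
        rw [he]
        by_cases hqz : q ≤ z
        · have h2 := hz1 q (by omega)
          have h3 := h.mono_le hqz (by omega)
          exact ⟨iff_of_true h2 h3, iff_of_true h2.le h3⟩
        · have h2 := hz2 q (by omega) hq
          have h3 := h.mono z q (by omega) hq
          exact ⟨iff_of_false h2.not_gt h3.not_ge, iff_of_false h2.not_ge h3.not_ge⟩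
      rw [tally_congr fun j hj => and_congr_right fun _ => (hiff j hj).1,
        tally_congr (p := fun j => τ j = 1 ∧ κ j ≤ t)
          fun j hj => and_congr_right fun _ => (hiff j hj).2] at hcount
      omega
  · intro hL k
    constructor
    · rintro ⟨t, ht, hk⟩
      rcases hf.le_base_or_le ht with h1 | ⟨j, hj, h1⟩
      · left
        rw [h.first]
        omega
      · obtain ⟨q, hq, he⟩ := h.covers j hj
        right
        refine ⟨q, hq, ?_⟩
        rw [hval q hq, ← he]
        omega
    · rintro (hk | ⟨q, hq, hk⟩)
      · refine ⟨0, ⟨le_rfl, hL⟩, ?_⟩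
        rw [hf.map_zero hL, ← h.first]
        exact hk
      · exact ⟨bp q, hmem q hq, by rwa [← hval q hq]⟩

/-! ### Programs for the intervals of the vertices and their events -/

section EdgeProgram

theorem Memory.setNat_nat_of_ne (s : Memory) {a b : ℕ} (h : b ≠ a) (i x : ℕ) :
    (s.setNat a i x).nat b = s.nat b := Function.update_of_ne h _ _

variable {n m : ℕ}

/-- The distance of the end vertex of the edge `e` (variable 3) given by the array `A`, and the
vertex given by the variable 4. -/
def endDist (A : ℕ) : RealExpr := .load 3 (.add (.mul (.load A (.var 3)) (.var 0)) (.var 4))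

/-- The distance from the first end vertex of `e` at which the two ways to a vertex have the same
length. -/
def tieExpr : RealExpr := .div (.sub (.add (.load 2 (.var 3)) (endDist 2)) (endDist 1)) (.lit 2)

/-- Compute the intervals on which the vertices are reached from the left. -/
def leftProgram : Program :=
  .seq (.setVar 4 (.lit 0)) (.loop (.not (.natLe (.var 0) (.var 4)))
    (.seq (.storeReal 6 (.var 4) tieExpr)
    (.seq (.branch (.realLe (.load 5 (.var 4)) (.load 6 (.var 4)))
      (.storeReal 6 (.var 4) (.load 5 (.var 4))) .skip) (.incr 4))))

/-- Compute the intervals on which the vertices are reached from the right. -/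
def rightProgram : Program :=
  .seq (.setVar 4 (.lit 0)) (.loop (.not (.natLe (.var 0) (.var 4)))
    (.seq (.storeReal 7 (.var 4) tieExpr)
    (.seq (.branch (.realLe (.load 7 (.var 4)) (.sub (.load 2 (.var 3)) (.load 5 (.var 4))))
      (.storeReal 7 (.var 4) (.sub (.load 2 (.var 3)) (.load 5 (.var 4)))) .skip) (.incr 4))))

/-- Append an event. -/
def pushEvent (A τ : ℕ) : Program :=
  .seq (.storeReal 4 (.var 5) (.load A (.var 4)))
    (.seq (.storeNat 10 (.var 5) (.lit τ)) (.incr 5))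

/-- The vertex is not reached everywhere on the edge. -/
def activeTest : Test :=
  .and (.not (.realLe (.load 7 (.var 4)) (.load 6 (.var 4))))
    (.and (.not (.realLe (.load 7 (.var 4)) (.lit 0)))
      (.not (.realLe (.load 2 (.var 3)) (.load 6 (.var 4)))))

def collectLeft : Program :=
  .branch activeTest (.branch (.realLe (.lit 0) (.load 6 (.var 4))) (pushEvent 6 0)
    (.setVar 11 (.sub (.var 11) (.lit 1)))) .skip

def collectRight : Program :=
  .branch (.and activeTest (.realLe (.load 7 (.var 4)) (.load 2 (.var 3)))) (pushEvent 7 1) .skip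

/-- Collect the events of all vertices. -/
def collectProgram : Program :=
  .seq (.setVar 5 (.lit 0)) (.seq (.setVar 11 (.var 0)) (.seq (.setVar 4 (.lit 0))
    (.loop (.not (.natLe (.var 0) (.var 4))) (.seq collectLeft (.seq collectRight (.incr 4))))))

/-- Make the key of the item `j` (variable 17) a point of the table if it is larger than the last
point. -/
def addPoint : Program :=
  .branch (.and (.natLe (.lit 1) (.var 12))
      (.realLe (.load 4 (.var 17)) (.load 9 (.sub (.var 12) (.lit 1)))))
    .skip
    (.seq (.storeReal 9 (.var 12) (.load 4 (.var 17)))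
    (.seq (.storeNat 13 (.var 12) (.load 14 (.var 12)))
    (.seq (.storeNat 14 (.add (.var 12) (.lit 1)) (.load 14 (.var 12))) (.incr 12))))

/-- Count the event `j` (variable 17). -/
def countEvent : Program :=
  .branch (.natLe (.load 10 (.var 17)) (.lit 0))
    (.storeNat 14 (.var 12) (.sub (.load 14 (.var 12)) (.lit 1)))
    (.seq (.storeNat 13 (.sub (.var 12) (.lit 1))
      (.add (.load 13 (.sub (.var 12) (.lit 1))) (.lit 1)))
      (.storeNat 14 (.var 12) (.add (.load 14 (.var 12)) (.lit 1))))

/-- Compute the table of the function given by the sorted events. -/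
def sweepProgram : Program :=
  .seq (.setVar 12 (.lit 0)) (.seq (.storeNat 14 (.lit 0) (.var 11)) (.seq (.setVar 4 (.lit 0))
    (.loop (.not (.natLe (.var 5) (.var 4)))
      (.seq (.setVar 17 (.load 7 (.var 4))) (.seq addPoint (.seq countEvent (.incr 4)))))))

/-- Compute the table of the number of vertices that are reached from the points of the edge `e`
(variable 3). -/
def edgeProgram : Program :=
  .seq (.setVar 9 (.load 1 (.var 3))) (.seq boundsProgram (.seq leftProgram
    (.seq (.setVar 9 (.load 2 (.var 3))) (.seq boundsProgram (.seq rightProgram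
      (.seq collectProgram (.seq sortProgram sweepProgram)))))))

variable {N : Network (Fin n)} {ends : Fin m → Fin n × Fin n} {lam : ℝ} {s : Memory} {W : ℕ}
  {e : Fin m}

/-- The value of `tieExpr`. -/
noncomputable def tie (N : Network (Fin n)) (u v w : Fin n) : ℝ :=
  (N.len u v + N.vdist v w - N.vdist u w) / 2

theorem HasInput.eval_tieExpr (h : HasInput N ends lam s) (he : s.nat 3 0 = e) {w : Fin n}
    (hw : s.nat 4 0 = w) : tieExpr.eval s = tie N (ends e).1 (ends e).2 w := by
  simp only [tieExpr, endDist, RealExpr.eval, NatExpr.eval, NatExpr.eval_var, he, hw, h.fst, h.snd,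
    h.card, h.len, h.dist, tie]
  norm_num

theorem cost_tieExpr : tieExpr.cost = 27 := by simp [tieExpr, endDist]

theorem wp_leftProgram (hin : HasInput N ends lam s) (he : s.nat 3 0 = e) (hW : n ≤ W) :
    Wp W leftProgram s fun s' t => (∀ w : Fin n, s'.real 6 w =
      min (tie N (ends e).1 (ends e).2 w) (s.real 5 w)) ∧ t ≤ 80 * (n + 1) := by
  refine wp_seq (wp_setVar (by simp) ?_)
  refine wp_loop (fun s' => s'.nat 4 0 ≤ n ∧ ∀ w : Fin n, (w : ℕ) < s'.nat 4 0 → s'.real 6 w =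
      min (tie N (ends e).1 (ends e).2 w) (s.real 5 w)) (fun s => n - s.nat 4 0) 60 (by simp) ?_ ?_
  · rintro s₁ hf ⟨h1, h2⟩ hb
    have hin₁ : HasInput N ends lam s₁ := hin.congr
      (fun a ha => by rw [hf.nat a (by simp; omega)]; ext; simp; omega)
      (fun a ha => by rw [hf.real a (by simp; omega)]; rfl)
    have he₁ : s₁.nat 3 0 = e := by rw [hf.nat 3 (by simp)]; simpa
    have h5 : s₁.real 5 = s.real 5 := by rw [hf.real 5 (by simp)]; rfl
    simp only [Test.eval, NatExpr.eval_var, hin₁.card, not_le] at hb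
    set i := s₁.nat 4 0 with hi
    have htie := hin₁.eval_tieExpr he₁ (w := ⟨i, hb⟩) hi.symm
    have hfin : ∀ w : Fin n, (w : ℕ) = i → w = ⟨i, hb⟩ := fun w h => Fin.ext h
    refine wp_seq (wp_storeReal (by simp; omega) (wp_seq ?_))
    refine wp_branch (fun hc => ?_) (fun hc => ?_)
    · refine wp_storeReal (by simp; omega) (wp_incr (by simp; omega) ?_)
      simp [htie, h5, ← hi] at hc
      simp [h5, ← hi, cost_tieExpr]
      refine ⟨⟨by omega, fun w hw => ?_⟩, by omega⟩
      split_ifs with hwi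
      · rw [hfin w hwi]
        exact (min_eq_right hc).symm
      · exact h2 w (by omega)
    · refine wp_skip (wp_incr (by simp; omega) ?_)
      simp [htie, h5, ← hi] at hc
      simp [← hi, cost_tieExpr, htie]
      refine ⟨⟨by omega, fun w hw => ?_⟩, by omega⟩
      split_ifs with hwi
      · rw [hfin w hwi]
        exact (min_eq_left hc.le).symm
      · exact h2 w (by omega)
  · rintro s₁ t hf ⟨h1, h2⟩ hb ht
    have h0 : s₁.nat 0 0 = n := by rw [hf.nat 0 (by simp)]; simpa using hin.card
    simp only [Test.eval, NatExpr.eval_var, h0, not_le, not_lt] at hb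
    refine ⟨fun w => h2 w (by omega), ?_⟩
    simp at ht ⊢
    omega

theorem wp_rightProgram (hin : HasInput N ends lam s) (he : s.nat 3 0 = e) (hW : n ≤ W) :
    Wp W rightProgram s fun s' t => (∀ w : Fin n, s'.real 7 w =
      max (tie N (ends e).1 (ends e).2 w) (N.len (ends e).1 (ends e).2 - s.real 5 w)) ∧
      t ≤ 80 * (n + 1) := by
  refine wp_seq (wp_setVar (by simp) ?_)
  refine wp_loop (fun s' => s'.nat 4 0 ≤ n ∧ ∀ w : Fin n, (w : ℕ) < s'.nat 4 0 → s'.real 7 w =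
      max (tie N (ends e).1 (ends e).2 w) (N.len (ends e).1 (ends e).2 - s.real 5 w))
      (fun s => n - s.nat 4 0) 60 (by simp) ?_ ?_
  · rintro s₁ hf ⟨h1, h2⟩ hb
    have hin₁ : HasInput N ends lam s₁ := hin.congr
      (fun a ha => by rw [hf.nat a (by simp; omega)]; ext; simp; omega)
      (fun a ha => by rw [hf.real a (by simp; omega)]; rfl)
    have he₁ : s₁.nat 3 0 = e := by rw [hf.nat 3 (by simp)]; simpa
    have h5 : s₁.real 5 = s.real 5 := by rw [hf.real 5 (by simp)]; rfl
    have hlen := hin₁.len e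
    simp only [Test.eval, NatExpr.eval_var, hin₁.card, not_le] at hb
    set i := s₁.nat 4 0 with hi
    have htie := hin₁.eval_tieExpr he₁ (w := ⟨i, hb⟩) hi.symm
    have hfin : ∀ w : Fin n, (w : ℕ) = i → w = ⟨i, hb⟩ := fun w h => Fin.ext h
    refine wp_seq (wp_storeReal (by simp; omega) (wp_seq ?_))
    refine wp_branch (fun hc => ?_) (fun hc => ?_)
    · refine wp_storeReal (by simp; omega) (wp_incr (by simp; omega) ?_)
      simp [htie, h5, ← hi, he₁, hlen] at hc
      simp [h5, ← hi, cost_tieExpr, he₁, hlen]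
      refine ⟨⟨by omega, fun w hw => ?_⟩, by omega⟩
      split_ifs with hwi
      · rw [hfin w hwi]
        exact (max_eq_right hc).symm
      · exact h2 w (by omega)
    · refine wp_skip (wp_incr (by simp; omega) ?_)
      simp [htie, h5, ← hi, he₁, hlen] at hc
      simp [← hi, cost_tieExpr, htie]
      refine ⟨⟨by omega, fun w hw => ?_⟩, by omega⟩
      split_ifs with hwi
      · rw [hfin w hwi]
        exact (max_eq_left hc.le).symm
      · exact h2 w (by omega)
  · rintro s₁ t hf ⟨h1, h2⟩ hb ht
    have h0 : s₁.nat 0 0 = n := by rw [hf.nat 0 (by simp)]; simpa using hin.card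
    simp only [Test.eval, NatExpr.eval_var, h0, not_le, not_lt] at hb
    refine ⟨fun w => h2 w (by omega), ?_⟩
    simp at ht ⊢
    omega

theorem wp_pushEvent {A τ : ℕ} (hW : s.nat 5 0 + 1 ≤ W) (hτ : τ ≤ W) (Q : Memory → ℕ → Prop)
    (h : ∀ s', (∀ j < s.nat 5 0, s'.real 4 j = s.real 4 j) →
      (∀ j < s.nat 5 0, s'.nat 10 j = s.nat 10 j) →
      s'.real 4 (s.nat 5 0) = s.real A (s.nat 4 0) → s'.nat 10 (s.nat 5 0) = τ →
      s'.nat 5 0 = s.nat 5 0 + 1 → s'.nat 11 0 = s.nat 11 0 → Q s' 16) :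
    Wp W (pushEvent A τ) s Q := by
  refine wp_seq (wp_storeReal (by simp; omega) (wp_seq (wp_storeNat (by simp; omega)
    (by simpa using hτ) (wp_incr (by simpa using hW) ?_))))
  refine h _ (fun j hj => ?_) (fun j hj => ?_) ?_ ?_ ?_ ?_
  · simp [hj.ne]
  · simp [hj.ne]
  · simp
  · simp
  · simp
  · simp

/-- The collection of events, as a property of the memory. -/
def Collects (L : ℝ) (n a b : ℕ) (s : Memory) : Prop :=
  CollectInv (s.real 6) (s.real 7) L n a b (s.nat 5 0) (s.nat 11 0) (s.real 4) (s.nat 10)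

theorem activeTest_iff {L : ℝ} (hL : s.real 2 (s.nat 3 0) = L) : activeTest.eval s ↔
    s.real 6 (s.nat 4 0) < s.real 7 (s.nat 4 0) ∧ 0 < s.real 7 (s.nat 4 0) ∧
      s.real 6 (s.nat 4 0) < L := by
  simp [activeTest, hL]

theorem cost_activeTest : activeTest.cost = 24 := by simp [activeTest]

theorem wp_collectLeft {L : ℝ} (hL : s.real 2 (s.nat 3 0) = L) {i : ℕ} (hi : s.nat 4 0 = i)
    (hin : i < n) (hW : 3 * n + 2 ≤ W) (h : Collects L n i i s) :
    Wp W collectLeft s fun s' t => Collects L n (i + 1) i s' ∧ t ≤ 60 := by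
  have hN := h.card_le
  subst hi
  refine wp_branch (fun hact => ?_) (fun hact => ?_)
  · rw [activeTest_iff hL] at hact
    refine wp_branch (fun h0 => ?_) (fun h0 => ?_)
    · simp at h0
      refine (wp_pushEvent (by omega) (by omega) _ fun s' h1 h2 h3 h4 h5 h6 => ?_ :
        Wp W (pushEvent 6 0) s fun s' t => CollectInv (s.real 6) (s.real 7) L n (s.nat 4 0 + 1)
          (s.nat 4 0) (s'.nat 5 0) (s'.nat 11 0) (s'.real 4) (s'.nat 10) ∧ t = 16).mono ?_
      · rw [h5, h6]
        exact ⟨h.push_left hin hact h0 h1 h2 h3 h4, rfl⟩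
      · rintro s' t hf ⟨h1, rfl⟩
        refine ⟨?_, by simp [cost_activeTest]⟩
        unfold Collects
        rw [hf.real 6 (by simp [pushEvent]), hf.real 7 (by simp [pushEvent])]
        exact h1
    · simp at h0
      have := h.base_le
      refine wp_setVar (by simp; omega) ⟨?_, by simp [cost_activeTest]⟩
      have h1 := h.decr_left hin hact h0
      simpa [Collects, Memory.setNat_nat_of_ne] using h1
  · rw [activeTest_iff hL] at hact
    exact wp_skip ⟨h.skip_left hact, by simp [cost_activeTest]⟩

theorem wp_collectRight {L : ℝ} (hL : s.real 2 (s.nat 3 0) = L) {i a : ℕ} (hi : s.nat 4 0 = i)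
    (hin : i < n) (ha : a ≤ n) (hW : 3 * n + 2 ≤ W) (h : Collects L n a i s) :
    Wp W collectRight s fun s' t => Collects L n a (i + 1) s' ∧ t ≤ 60 := by
  have hN := h.card_le
  subst hi
  refine wp_branch (fun hact => ?_) (fun hact => ?_)
  · have hact' : activeTest.eval s ∧ s.real 7 (s.nat 4 0) ≤ L := by
      simpa [hL] using hact
    rw [activeTest_iff hL] at hact'
    refine (wp_pushEvent (by omega) (by omega) _ fun s' h1 h2 h3 h4 h5 h6 => ?_ :
      Wp W (pushEvent 7 1) s fun s' t => CollectInv (s.real 6) (s.real 7) L n a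
        (s.nat 4 0 + 1) (s'.nat 5 0) (s'.nat 11 0) (s'.real 4) (s'.nat 10) ∧ t = 16).mono ?_
    · rw [h5, h6]
      exact ⟨h.push_right hact'.1 hact'.2 h1 h2 h3 h4, rfl⟩
    · rintro s' t hf ⟨h1, rfl⟩
      refine ⟨?_, by simp [cost_activeTest]⟩
      unfold Collects
      rw [hf.real 6 (by simp [pushEvent]), hf.real 7 (by simp [pushEvent])]
      exact h1
  · have hact' : ¬ (activeTest.eval s ∧ s.real 7 (s.nat 4 0) ≤ L) := by
      simpa [hL] using hact
    rw [activeTest_iff hL] at hact'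
    exact wp_skip ⟨h.skip_right hact', by simp [cost_activeTest]⟩

@[simp] theorem writesNat_collectLeft (a : ℕ) :
    collectLeft.WritesNat a ↔ a = 5 ∨ a = 10 ∨ a = 11 := by
  simp [collectLeft, pushEvent]; tauto

@[simp] theorem writesReal_collectLeft (a : ℕ) : collectLeft.WritesReal a ↔ a = 4 := by
  simp [collectLeft, pushEvent]

@[simp] theorem writesNat_collectRight (a : ℕ) :
    collectRight.WritesNat a ↔ a = 5 ∨ a = 10 := by
  simp [collectRight, pushEvent]; tauto

@[simp] theorem writesReal_collectRight (a : ℕ) : collectRight.WritesReal a ↔ a = 4 := by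
  simp [collectRight, pushEvent]

theorem wp_collectProgram {L : ℝ} (hL : s.real 2 (s.nat 3 0) = L) (hn : s.nat 0 0 = n)
    (hW : 3 * n + 2 ≤ W) :
    Wp W collectProgram s fun s' t => CollectInv (s.real 6) (s.real 7) L n n n (s'.nat 5 0)
      (s'.nat 11 0) (s'.real 4) (s'.nat 10) ∧ t ≤ 200 * (n + 1) := by
  refine wp_seq (wp_setVar (by simp) (wp_seq (wp_setVar (by simp [hn]; omega)
    (wp_seq (wp_setVar (by simp) ?_)))))
  refine wp_loop (fun s' => s'.nat 4 0 ≤ n ∧ Collects L n (s'.nat 4 0) (s'.nat 4 0) s')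
    (fun s => n - s.nat 4 0) 150 ?_ ?_ ?_
  · refine ⟨by simp, ?_⟩
    simpa [Collects, hn] using CollectInv.init _ _ L n _ _
  · rintro s₁ hf ⟨h1, h2⟩ hb
    have h0 : s₁.nat 0 0 = n := by rw [hf.nat 0 (by simp)]; simpa using hn
    have hL₁ : s₁.real 2 (s₁.nat 3 0) = L := by
      rw [hf.real 2 (by simp), hf.nat 3 (by simp)]; simpa using hL
    simp only [Test.eval, NatExpr.eval_var, h0, not_le] at hb
    refine wp_seq ((wp_collectLeft hL₁ rfl hb hW h2).mono ?_)
    rintro s₂ t₂ hf₂ ⟨h3, ht₂⟩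
    have hL₂ : s₂.real 2 (s₂.nat 3 0) = L := by
      rw [hf₂.real 2 (by simp), hf₂.nat 3 (by simp)]; exact hL₁
    have h4₂ : s₂.nat 4 0 = s₁.nat 4 0 := by rw [hf₂.nat 4 (by simp)]
    refine wp_seq ((wp_collectRight hL₂ h4₂ hb hb hW h3).mono ?_)
    rintro s₃ t₃ hf₃ ⟨h4, ht₃⟩
    have h4₃ : s₃.nat 4 0 = s₁.nat 4 0 := by rw [hf₃.nat 4 (by simp), h4₂]
    refine wp_incr (by omega) ⟨⟨?_, ?_⟩, ?_, by omega⟩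
    · simp [h4₃]; omega
    · simpa [Collects, h4₃, Memory.setNat_nat_of_ne] using h4
    · simp [h4₃]; omega
  · rintro s₁ t hf ⟨h1, h2⟩ hb ht
    have h0 : s₁.nat 0 0 = n := by rw [hf.nat 0 (by simp)]; simpa using hn
    have h6 : s₁.real 6 = s.real 6 := by rw [hf.real 6 (by simp)]; rfl
    have h7 : s₁.real 7 = s.real 7 := by rw [hf.real 7 (by simp)]; rfl
    simp only [Test.eval, NatExpr.eval_var, h0, not_le, not_lt] at hb
    have h3 : s₁.nat 4 0 = n := le_antisymm h1 hb
    unfold Collects at h2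
    rw [h3, h6, h7] at h2
    refine ⟨h2, ?_⟩
    simp at ht ⊢
    omega

end EdgeProgram

/-! ### Correctness of the sweep program -/

section SweepProgram

variable {s : Memory} {W : ℕ}

/-- The state of the sweep, as a property of the memory. -/
def Sweeps (κ : ℕ → ℝ) (τ : ℕ → ℕ) (base i k : ℕ) (s : Memory) : Prop :=
  SweepInv κ τ base i k (s.nat 12 0) (s.real 9) (s.nat 13) (s.nat 14)

variable {κ : ℕ → ℝ} {τ : ℕ → ℕ} {base N i : ℕ}

theorem wp_addPoint (hs : ∀ j j', j ≤ j' → j' < N → κ j ≤ κ j') (hi : i < N)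
    (hκ : s.real 4 (s.nat 17 0) = κ i) (hW : base + N + 2 ≤ W) (h : Sweeps κ τ base i i s) :
    Wp W addPoint s fun s' t => Sweeps κ τ base i (i + 1) s' ∧ t ≤ 70 := by
  have hc := h.le
  have haft := h.aft_le (q := s.nat 12 0) le_rfl
  refine wp_branch (fun hb => ?_) (fun hb => ?_)
  · simp [hκ] at hb
    exact wp_skip ⟨h.old_point hs hi hb.1 hb.2, by simp⟩
  · have hb' : ¬ (1 ≤ s.nat 12 0 ∧ κ i ≤ s.real 9 (s.nat 12 0 - 1)) := by
      simpa [hκ] using hb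
    refine wp_seq (wp_storeReal (by simp; omega) (wp_seq (wp_storeNat (by simp; omega)
      (by simp; omega) (wp_seq (wp_storeNat (by simp; omega) (by simp; omega)
      (wp_incr (by simp; omega) ⟨?_, by simp⟩))))))
    have := h.new_point hb' (bp' := fun q => if q = s.nat 12 0 then κ i else s.real 9 q)
      (val' := fun q => if q = s.nat 12 0 then s.nat 14 (s.nat 12 0) else s.nat 13 q)
      (aft' := fun q => if q = s.nat 12 0 + 1 then s.nat 14 (s.nat 12 0) else s.nat 14 q)
      (fun q hq => if_neg hq.ne) (if_pos rfl) (fun q hq => if_neg hq.ne) (if_pos rfl)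
      (fun q hq => if_neg (by omega)) (if_pos rfl)
    unfold Sweeps
    convert this using 1
    · simp
    · ext q; simp [hκ]
    · ext q; simp
    · ext q; simp

theorem wp_countEvent (hs : ∀ j j', j ≤ j' → j' < N → κ j ≤ κ j') (hi : i < N)
    (hτi : s.nat 10 (s.nat 17 0) = τ i) (hτ : τ i = 0 ∨ τ i = 1)
    (hbase : tally (fun j => τ j = 0) N ≤ base) (hW : base + N + 2 ≤ W)
    (h : Sweeps κ τ base i (i + 1) s) :
    Wp W countEvent s fun s' t => Sweeps κ τ base (i + 1) (i + 1) s' ∧ t ≤ 40 := by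
  have hc := h.le
  have haft := h.aft_le (q := s.nat 12 0) le_rfl
  obtain ⟨hc1, -⟩ := h.last_eq hs hi
  have hval := h.val_le (q := s.nat 12 0 - 1) (by omega)
  refine wp_branch (fun hb => ?_) (fun hb => ?_)
  · simp [hτi] at hb
    refine wp_storeNat (by simp; omega) (by simp; omega) ⟨?_, by simp⟩
    have := h.count_zero hs hi hb hbase
      (aft' := fun q => if q = s.nat 12 0 then s.nat 14 (s.nat 12 0) - 1 else s.nat 14 q)
      (fun q hq => if_neg hq.ne) (if_pos rfl)
    unfold Sweeps
    convert this using 1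
    · simp
    · rfl
    · ext q; simp
    · ext q; simp
  · simp [hτi] at hb
    refine wp_seq (wp_storeNat (by simp; omega) (by simp; omega)
      (wp_storeNat (by simp; omega) (by simp; omega) ⟨?_, by simp⟩))
    have := h.count_one hs hi (hτ.resolve_left hb)
      (val' := fun q => if q = s.nat 12 0 - 1 then s.nat 13 (s.nat 12 0 - 1) + 1 else s.nat 13 q)
      (aft' := fun q => if q = s.nat 12 0 then s.nat 14 (s.nat 12 0) + 1 else s.nat 14 q)
      (fun q hq => if_neg (by omega)) (if_pos rfl) (fun q hq => if_neg hq.ne) (if_pos rfl)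
    unfold Sweeps
    convert this using 1
    · simp
    · rfl
    · ext q; simp
    · ext q; simp

theorem wp_sweepProgram {f : ℝ → ℕ} {L : ℝ} (hN : s.nat 5 0 = N) (hbase : s.nat 11 0 = base)
    (hsort : IsSorting N (s.real 4) (s.nat 7))
    (hf : IsEvents f L N base (s.real 4) (s.nat 10)) (hW : base + N + 2 ≤ W) :
    Wp W sweepProgram s fun s' t => IsTable f L (s'.nat 12 0) (s'.real 9) (s'.nat 13) (s'.nat 14) ∧
      s'.nat 12 0 ≤ N ∧ (∀ q < s'.nat 12 0, s'.nat 13 q ≤ base + N) ∧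
      (∀ q ≤ s'.nat 12 0, s'.nat 14 q ≤ base + N) ∧ t ≤ 200 * (N + 1) := by
  refine wp_seq (wp_setVar (by simp) (wp_seq (wp_storeNat (by simp) (by simp [hbase]; omega)
    (wp_seq (wp_setVar (by simp) ?_)))))
  set κ : ℕ → ℝ := fun j => s.real 4 (s.nat 7 j) with hκ
  set τ : ℕ → ℕ := fun j => s.nat 10 (s.nat 7 j) with hτ
  have hf' : IsEvents f L N base κ τ := hf.comp_sorting hsort
  refine wp_loop (fun s' => s'.nat 4 0 ≤ N ∧ Sweeps κ τ base (s'.nat 4 0) (s'.nat 4 0) s')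
    (fun s => N - s.nat 4 0) 150 ?_ ?_ ?_
  · refine ⟨by simp, ?_⟩
    have := SweepInv.init κ τ (s.real 9) (s.nat 13) (base := base)
      (aft := fun q => if q = 0 then base else s.nat 14 q) (if_pos rfl)
    unfold Sweeps
    convert this using 1
    all_goals first | rfl | simp
    ext q; simp [hbase]
  · rintro s₁ hf₁ ⟨h1, h2⟩ hb
    have h5 : s₁.nat 5 0 = N := by rw [hf₁.nat 5 (by simp [addPoint, countEvent])]; simpa
    have h7 : s₁.nat 7 = s.nat 7 := by
      rw [hf₁.nat 7 (by simp [addPoint, countEvent])]; ext; simp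
    have h10 : s₁.nat 10 = s.nat 10 := by
      rw [hf₁.nat 10 (by simp [addPoint, countEvent])]; ext; simp
    have h4 : s₁.real 4 = s.real 4 := by
      rw [hf₁.real 4 (by simp [addPoint, countEvent])]; rfl
    simp only [Test.eval, NatExpr.eval_var, h5, not_le] at hb
    set i := s₁.nat 4 0 with hi
    have hπ := hsort.lt i hb
    refine wp_seq (wp_setVar (by simp [h7, ← hi]; omega) ?_)
    have hi₁ : ((s₁.setNat 17 0 ((NatExpr.load 7 (.var 4)).eval s₁)).nat 17 0) = s.nat 7 i := by
      simp [h7, hi]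
    refine wp_seq ((wp_addPoint (s := s₁.setNat 17 0 ((NatExpr.load 7 (.var 4)).eval s₁))
      (κ := κ) (τ := τ) hsort.mono hb (by rw [hi₁, Memory.setNat_real, h4]) hW ?_).mono ?_)
    · simpa [Sweeps, Memory.setNat_nat_of_ne] using h2
    rintro s₂ t₂ hf₂ ⟨h8, ht₂⟩
    have h17 : s₂.nat 17 0 = s.nat 7 i := by rw [hf₂.nat 17 (by simp [addPoint]), hi₁]
    have h10₂ : s₂.nat 10 = s.nat 10 := by
      rw [hf₂.nat 10 (by simp [addPoint]), ← h10]; ext; simp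
    have h4₂ : s₂.nat 4 0 = i := by rw [hf₂.nat 4 (by simp [addPoint])]; simp [hi]
    refine wp_seq ((wp_countEvent hsort.mono hb (by rw [h17, h10₂]) ?_ hf'.le_base hW h8).mono ?_)
    · rcases hf'.type i hb with h | h
      · exact Or.inl h.1
      · exact Or.inr h.1
    rintro s₃ t₃ hf₃ ⟨h9, ht₃⟩
    have h4₃ : s₃.nat 4 0 = i := by rw [hf₃.nat 4 (by simp [countEvent]), h4₂]
    refine wp_incr (by omega) ⟨⟨?_, ?_⟩, ?_, by simp; omega⟩
    · simp [h4₃]; omega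
    · simpa [Sweeps, h4₃, Memory.setNat_nat_of_ne] using h9
    · simp [h4₃]; omega
  · rintro s₁ t hf₁ ⟨h1, h2⟩ hb ht
    have h5 : s₁.nat 5 0 = N := by rw [hf₁.nat 5 (by simp [addPoint, countEvent])]; simpa
    simp only [Test.eval, NatExpr.eval_var, h5, not_le, not_lt] at hb
    have h3 : s₁.nat 4 0 = N := le_antisymm h1 hb
    rw [h3] at h2
    refine ⟨h2.isTable hf', h2.le, fun q hq => h2.val_le hq, fun q hq => h2.aft_le hq, ?_⟩
    simp at ht ⊢
    omega

@[simp] theorem writesNat_sweepProgram (a : ℕ) :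
    sweepProgram.WritesNat a ↔ a = 4 ∨ a = 12 ∨ a = 13 ∨ a = 14 ∨ a = 17 := by
  simp [sweepProgram, addPoint, countEvent]
  tauto

@[simp] theorem writesReal_sweepProgram (a : ℕ) : sweepProgram.WritesReal a ↔ a = 9 := by
  simp [sweepProgram, addPoint, countEvent]

end SweepProgram

/-! ### Correctness and running time of the program for one edge -/

section EdgeProgramCorrect

variable {n m : ℕ} {N : Network (Fin n)} {ends : Fin m → Fin n × Fin n} {lam : ℝ} {s : Memory}
  {W : ℕ} {e : Fin m}

@[simp] theorem writesNat_leftProgram (a : ℕ) : leftProgram.WritesNat a ↔ a = 4 := by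
  simp [leftProgram]

@[simp] theorem writesReal_leftProgram (a : ℕ) : leftProgram.WritesReal a ↔ a = 6 := by
  simp [leftProgram]

@[simp] theorem writesNat_rightProgram (a : ℕ) : rightProgram.WritesNat a ↔ a = 4 := by
  simp [rightProgram]

@[simp] theorem writesReal_rightProgram (a : ℕ) : rightProgram.WritesReal a ↔ a = 7 := by
  simp [rightProgram]

@[simp] theorem writesNat_collectProgram (a : ℕ) :
    collectProgram.WritesNat a ↔ a = 4 ∨ a = 5 ∨ a = 10 ∨ a = 11 := by
  simp [collectProgram]; tauto

@[simp] theorem writesReal_collectProgram (a : ℕ) : collectProgram.WritesReal a ↔ a = 4 := by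
  simp [collectProgram]

/-- The number of vertices that are reached from the point of the edge `e` at distance `t` from its
first end vertex. -/
noncomputable def reachCount (N : Network (Fin n)) (ends : Fin m → Fin n × Fin n) (lam : ℝ)
    (e : Fin m) (t : ℝ) : ℕ :=
  (N.reachSet lam (ends e).1 (ends e).2 t).ncard

/-- Both conditions in `reachSet` are bounds on `t`: the comparison of the two ways says on which
side of the tie `t` lies, and being reached is a bound by `A` or, measured from the other end, by
`B`. -/
theorem reachCount_eq_tally {α β : ℕ → ℝ} {A B : Fin n → ℝ}
    (hA : ∀ t : ℝ, 0 ≤ t → ∀ w, t ≤ A w ↔ N.Reach lam (ends e).1 t w)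
    (hB : ∀ t : ℝ, 0 ≤ t → ∀ w, t ≤ B w ↔ N.Reach lam (ends e).2 t w)
    (hα : ∀ w : Fin n, α w = min (tie N (ends e).1 (ends e).2 w) (A w))
    (hβ : ∀ w : Fin n, β w = max (tie N (ends e).1 (ends e).2 w)
      (N.len (ends e).1 (ends e).2 - B w))
    {t : ℝ} (ht : t ∈ Icc 0 (N.len (ends e).1 (ends e).2)) :
    reachCount N ends lam e t = tally (fun w => t ≤ α w ∨ β w ≤ t) n := by
  rw [tally_eq_ncard]
  unfold reachCount
  congr 1
  ext w
  have h1 := hA t ht.1 w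
  have h2 := hB (N.len (ends e).1 (ends e).2 - t) (by linarith [ht.2]) w
  simp only [Network.reachSet, Set.mem_ofPred_eq, hα, hβ, le_min_iff, max_le_iff, ← h1, ← h2, tie]
  refine or_congr (and_congr ?_ Iff.rfl) (and_congr ?_ ?_)
  · constructor <;> intro h <;> linarith
  · constructor <;> intro h <;> linarith
  · constructor <;> intro h <;> linarith

/-- The bounds of both ends are computed in the real array 5, so those of the first end are turned
into left interval ends (array 6) before the second run. Keys are in the real array 4 for both kinds
of sorting. The table consists of the number of points (variable 12), the points (real array 9), and
the values at and after them (arrays 13 and 14). -/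
theorem wp_edgeProgram (hin : HasInput N ends lam s) (hends : IsEdgeList N.graph ends)
    (he : s.nat 3 0 = e) (hW : 5 * (n + m) + 5 ≤ W) :
    Wp W edgeProgram s fun s' t =>
      IsTable (reachCount N ends lam e) (N.len (ends e).1 (ends e).2) (s'.nat 12 0) (s'.real 9)
        (s'.nat 13) (s'.nat 14) ∧
      s'.nat 12 0 ≤ 2 * n ∧ (∀ q < s'.nat 12 0, s'.nat 13 q ≤ 3 * n) ∧
      (∀ q ≤ s'.nat 12 0, s'.nat 14 q ≤ 3 * n) ∧
      t ≤ 5000 * (n + m + 1) * (Nat.log 2 (4 * (n + m)) + 1) := by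
  have hne : (ends e).1.val < n := (ends e).1.2
  have hne' : (ends e).2.val < n := (ends e).2.2
  refine wp_seq (wp_setVar (by simp [he, hin.fst]; omega) ?_)
  have hfst : (NatExpr.load 1 (.var 3)).eval s = (ends e).1 := by simp [he, hin.fst]
  rw [hfst]
  set s₀ := s.setNat 9 0 (ends e).1 with hs₀
  have hin₀ : HasInput N ends lam s₀ := hin.congr
    (fun a ha => Memory.setNat_nat_of_ne _ (by omega) _ _) (fun a ha => rfl)
  have he₀ : s₀.nat 3 0 = e := by simp [hs₀, he]
  refine wp_seq ((wp_boundsProgram (u := (ends e).1) hin₀ hends (by simp [hs₀]) (by omega)).mono ?_)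
  rintro s₁ t₁ hf₁ ⟨hA, ht₁⟩
  have hin₁ : HasInput N ends lam s₁ := hin₀.congr
    (fun a ha => hf₁.nat a (by simp; omega)) (fun a ha => hf₁.real a (by simp; omega))
  have he₁ : s₁.nat 3 0 = e := by rw [hf₁.nat 3 (by simp), he₀]
  refine wp_seq ((wp_leftProgram hin₁ he₁ (by omega)).mono ?_)
  rintro s₂ t₂ hf₂ ⟨hα, ht₂⟩
  have hin₂ : HasInput N ends lam s₂ := hin₁.congr
    (fun a ha => hf₂.nat a (by simp; omega)) (fun a ha => hf₂.real a (by simp; omega))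
  have he₂ : s₂.nat 3 0 = e := by rw [hf₂.nat 3 (by simp), he₁]
  refine wp_seq (wp_setVar (by simp [he₂, hin₂.snd]; omega) ?_)
  have hsnd : (NatExpr.load 2 (.var 3)).eval s₂ = (ends e).2 := by simp [he₂, hin₂.snd]
  rw [hsnd]
  set s₃ := s₂.setNat 9 0 (ends e).2 with hs₃
  have hin₃ : HasInput N ends lam s₃ := hin₂.congr
    (fun a ha => Memory.setNat_nat_of_ne _ (by omega) _ _) (fun a ha => rfl)
  have he₃ : s₃.nat 3 0 = e := by simp [hs₃, he₂]
  refine wp_seq ((wp_boundsProgram (u := (ends e).2) hin₃ hends (by simp [hs₃]) (by omega)).mono ?_)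
  rintro s₄ t₄ hf₄ ⟨hB, ht₄⟩
  have hin₄ : HasInput N ends lam s₄ := hin₃.congr
    (fun a ha => hf₄.nat a (by simp; omega)) (fun a ha => hf₄.real a (by simp; omega))
  have he₄ : s₄.nat 3 0 = e := by rw [hf₄.nat 3 (by simp), he₃]
  have hα₄ : s₄.real 6 = s₂.real 6 := hf₄.real 6 (by simp)
  refine wp_seq ((wp_rightProgram hin₄ he₄ (by omega)).mono ?_)
  rintro s₅ t₅ hf₅ ⟨hβ, ht₅⟩
  have hα₅ : s₅.real 6 = s₂.real 6 := by rw [hf₅.real 6 (by simp), hα₄]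
  have hL₅ : s₅.real 2 (s₅.nat 3 0) = N.len (ends e).1 (ends e).2 := by
    rw [hf₅.real 2 (by simp), hf₅.nat 3 (by simp), he₄]
    exact hin₄.len e
  have hn₅ : s₅.nat 0 0 = n := by rw [hf₅.nat 0 (by simp)]; exact hin₄.card
  refine wp_seq ((wp_collectProgram hL₅ hn₅ (by omega)).mono ?_)
  rintro s₆ t₆ hf₆ ⟨hC, ht₆⟩
  have hev := hC.isEvents (f := reachCount N ends lam e) fun t ht => by
    rw [hα₅]
    exact reachCount_eq_tally (A := fun w => s₁.real 5 w) (B := fun w => s₄.real 5 w)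
      hA hB hα hβ ht
  have hN₆ : s₆.nat 5 0 ≤ 2 * n := by have := hC.card_le; omega
  have hbase := hC.base_le
  refine wp_seq ((wp_sortProgram (N := s₆.nat 5 0) rfl (by omega)).mono ?_)
  rintro s₇ t₇ hf₇ ⟨hS, ht₇⟩
  have h4 : s₇.real 4 = s₆.real 4 := hf₇.real 4 (by simp)
  have h10 : s₇.nat 10 = s₆.nat 10 := hf₇.nat 10 (by simp)
  have h11 : s₇.nat 11 = s₆.nat 11 := hf₇.nat 11 (by simp)
  have h5 : s₇.nat 5 = s₆.nat 5 := hf₇.nat 5 (by simp)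
  rw [← h4] at hS
  rw [← h4, ← h10] at hev
  refine (wp_sweepProgram (N := s₆.nat 5 0) (base := s₆.nat 11 0) (by rw [h5]) (by rw [h11])
    hS hev (by omega)).mono ?_
  rintro s₈ t₈ - ⟨hT, hc, hv, ha, ht₈⟩
  refine ⟨hT, by omega, fun q hq => (hv q hq).trans (by omega),
    fun q hq => (ha q hq).trans (by omega), ?_⟩
  -- Two sorts of `m` edges and one of at most `2 * n` events dominate the running time; their
  -- logarithms are bounded by a common one.
  have hlog1 : Nat.log 2 (2 * m) ≤ Nat.log 2 (4 * (n + m)) := Nat.log_mono_right (by omega)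
  have hlog2 : Nat.log 2 (2 * s₆.nat 5 0) ≤ Nat.log 2 (4 * (n + m)) :=
    Nat.log_mono_right (by omega)
  have hb1 : (m + n + 1) * (Nat.log 2 (2 * m) + 1) ≤
      (n + m + 1) * (Nat.log 2 (4 * (n + m)) + 1) := Nat.mul_le_mul (by omega) (by omega)
  have hb2 : (s₆.nat 5 0 + 1) * (Nat.log 2 (2 * s₆.nat 5 0) + 1) ≤
      (2 * (n + m + 1)) * (Nat.log 2 (4 * (n + m)) + 1) := Nat.mul_le_mul (by omega) (by omega)
  have hb3 : (n + m + 1) * 1 ≤ (n + m + 1) * (Nat.log 2 (4 * (n + m)) + 1) :=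
    Nat.mul_le_mul_left _ (by omega)
  simp only [mul_assoc] at *
  simp only [NatExpr.cost, NatExpr.cost_var]
  omega

@[simp] theorem writesNat_edgeProgram (a : ℕ) :
    edgeProgram.WritesNat a ↔ a = 4 ∨ a = 5 ∨ a = 6 ∨ a = 7 ∨ a = 8 ∨ a = 9 ∨ a = 10 ∨ a = 11 ∨
      a = 12 ∨ a = 13 ∨ a = 14 ∨ a = 17 := by
  simp [edgeProgram]
  tauto

@[simp] theorem writesReal_edgeProgram (a : ℕ) :
    edgeProgram.WritesReal a ↔ a = 4 ∨ a = 5 ∨ a = 6 ∨ a = 7 ∨ a = 8 ∨ a = 9 := by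
  simp [edgeProgram]
  tauto

end EdgeProgramCorrect

/-- The neighbourhoods are relative to the interval, so agreement on it is enough; `reachCount`
describes `edgeFun` only there. -/
theorem breakpoints_congr {f g : ℝ → ℕ} {L : ℝ} (h : ∀ t ∈ Icc 0 L, f t = g t) :
    breakpoints f L = breakpoints g L := by
  ext t
  refine and_congr_right fun ht => not_congr ?_
  refine eventually_congr ?_
  filter_upwards [self_mem_nhdsWithin] with t' ht'
  rw [h t ht, h t' ht']

theorem IsTable.congr {f g : ℝ → ℕ} {L : ℝ} {c : ℕ} {bp : ℕ → ℝ} {val aft : ℕ → ℕ}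
    (h : IsTable f L c bp val aft) (hfg : ∀ t ∈ Icc 0 L, f t = g t) :
    IsTable g L c bp val aft where
  breakpoints_eq := by rw [← breakpoints_congr hfg]; exact h.breakpoints_eq
  strictMonoOn := h.strictMonoOn
  val_eq q hq := by
    have hb : bp q ∈ breakpoints f L := h.breakpoints_eq ▸ ⟨q, hq, rfl⟩
    rw [← hfg _ hb.1]
    exact h.val_eq q hq
  aft_eq t ht hb := by
    rw [← breakpoints_congr hfg] at hb ⊢
    rw [← hfg t ht]
    exact h.aft_eq t ht hb
  exists_le_iff hL k := by
    rw [← h.exists_le_iff hL k]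
    exact exists_congr fun t => and_congr_right fun ht => by rw [hfg t ht]

/-! ### Input format, word bound and logarithms -/

section Main

variable {n m : ℕ} {N : Network (Fin n)} {ends : Fin m → Fin n × Fin n} {lam : ℝ} {s : Memory}
  {W : ℕ} {e : Fin m}

theorem hasInput_inputMemory (N : Network (Fin n)) (ends : Fin m → Fin n × Fin n) (p : ℕ)
    (lam : ℝ) : HasInput N ends lam (inputMemory N ends p lam) where
  card := rfl
  edges := rfl
  fst e := by simp [inputMemory, inputNat]
  snd e := by simp [inputMemory, inputNat]
  lam := rfl
  weight v := by simp [inputMemory, inputReal]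
  len e := by simp [inputMemory, inputReal]
  dist u v := by
    have h : u.val * n + v < n * n := by
      calc u.val * n + v < u.val * n + n := by omega
        _ = (u.val + 1) * n := by ring
        _ ≤ n * n := Nat.mul_le_mul_right _ u.2
    have hn : 0 < n := by have := v.2; omega
    have h1 : (u.val * n + v) / n = u := by
      rw [mul_comm, Nat.mul_add_div hn, Nat.div_eq_of_lt v.2, add_zero]
    have h2 : (u.val * n + v) % n = v := by
      rw [mul_comm, Nat.mul_add_mod, Nat.mod_eq_of_lt v.2]
    simp only [inputMemory, inputReal, h, dif_pos]
    congr 1 <;> exact Fin.ext (by assumption)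

/-- All indices and stored naturals are linear in `n + m`; the cube absorbs the constants. -/
theorem word_bound (hn : 1 ≤ n) : 5 * (n + m) + 5 ≤ (n + m + 2) ^ 3 := by
  nlinarith [Nat.zero_le m, sq_nonneg (n + m), Nat.zero_le (n + m)]

theorem IsEdgeList.card_le {G : SimpleGraph (Fin n)} (h : IsEdgeList G ends) : m ≤ n * n := by
  have hinj : Function.Injective ends := fun e e' he => h.1 (by simp only [he])
  simpa using Fintype.card_le_of_injective ends hinj

theorem IsEdgeList.two_le {G : SimpleGraph (Fin n)} (h : IsEdgeList G ends) (e : Fin m) :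
    2 ≤ n := by
  have h1 := (h.adj e).ne
  have h2 := (ends e).1.2
  have h3 := (ends e).2.2
  by_contra hn
  exact h1 (Fin.ext (by omega))

/-- As m ≤ n² and n ≥ 2, the argument is at most 8n² ≤ n⁵. So the left side is at most 6 log n / log
2, and log 2 > 1/2. -/
theorem log_bound {G : SimpleGraph (Fin n)} (h : IsEdgeList G ends) (hn : 2 ≤ n) :
    ((Nat.log 2 (4 * (n + m)) + 1 : ℕ) : ℝ) ≤ 12 * Real.log n := by
  have hm := h.card_le
  have h5 : 4 * (n + m) ≤ n ^ 5 := by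
    calc 4 * (n + m) ≤ 2 * 2 * 2 * (n * n) := by nlinarith
      _ ≤ n * n * n * (n * n) := by gcongr
      _ = n ^ 5 := by ring
  have h2 : 2 ^ Nat.log 2 (4 * (n + m)) ≤ n ^ 5 :=
    (Nat.pow_log_le_self 2 (by omega)).trans h5
  have h3 : ((2 : ℝ) ^ Nat.log 2 (4 * (n + m))) ≤ (n : ℝ) ^ 5 := by exact_mod_cast h2
  have h4 := Real.log_le_log (by positivity) h3
  rw [Real.log_pow, Real.log_pow] at h4
  have h6 : Real.log 2 ≤ Real.log n := Real.log_le_log (by norm_num) (by exact_mod_cast hn)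
  have h7 := Real.log_two_gt_d9
  push_cast at h4 ⊢
  nlinarith [Nat.cast_nonneg (α := ℝ) (Nat.log 2 (4 * (n + m)))]

/-! ### Tabulating the function of an edge -/

/-- Copy the table of an edge to the output. -/
def copyProgram : Program :=
  .seq (.setVar 4 (.lit 0))
    (.seq (.loop (.not (.natLe (.var 12) (.var 4)))
      (.seq (.storeReal 0 (.var 4) (.load 9 (.var 4)))
        (.seq (.storeNat 1 (.var 4) (.load 13 (.var 4)))
          (.seq (.storeNat 2 (.var 4) (.load 14 (.var 4))) (.incr 4)))))
    (.seq (.storeNat 2 (.var 12) (.load 14 (.var 12))) (.setVar 0 (.var 12))))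

theorem wp_copyProgram {c w : ℕ} (hc : s.nat 12 0 = c) (hval : ∀ q < c, s.nat 13 q ≤ w)
    (haft : ∀ q ≤ c, s.nat 14 q ≤ w) (hcW : c + 1 ≤ W) (hw : w ≤ W) :
    Wp W copyProgram s fun s' t => s'.nat 0 0 = c ∧ (∀ q < c, s'.real 0 q = s.real 9 q) ∧
      (∀ q < c, s'.nat 1 q = s.nat 13 q) ∧ (∀ q ≤ c, s'.nat 2 q = s.nat 14 q) ∧
      t ≤ 60 * (c + 1) := by
  refine wp_seq (wp_setVar (by simp) (wp_seq ?_))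
  refine wp_loop (fun s' => s'.nat 4 0 ≤ c ∧ ∀ q < s'.nat 4 0, s'.real 0 q = s.real 9 q ∧
    s'.nat 1 q = s.nat 13 q ∧ s'.nat 2 q = s.nat 14 q) (fun s' => c - s'.nat 4 0) 40
    (by simp) ?_ ?_
  · rintro s₁ hf ⟨h1, h2⟩ hb
    have h12 : s₁.nat 12 0 = c := by rw [hf.nat 12 (by simp)]; simpa
    have h13 : s₁.nat 13 = s.nat 13 := by rw [hf.nat 13 (by simp)]; ext; simp
    have h14 : s₁.nat 14 = s.nat 14 := by rw [hf.nat 14 (by simp)]; ext; simp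
    have h9 : s₁.real 9 = s.real 9 := by rw [hf.real 9 (by simp)]; rfl
    simp only [Test.eval, NatExpr.eval_var, h12, not_le] at hb
    have hv := (hval _ hb).trans hw
    have ha := (haft _ hb.le).trans hw
    refine wp_seq (wp_storeReal (by simp; omega) (wp_seq (wp_storeNat (by simp; omega)
      (by simp [h13]; omega) (wp_seq (wp_storeNat (by simp; omega) (by simp [h14]; omega)
      (wp_incr (by simp; omega) ⟨⟨?_, ?_⟩, ?_, by simp⟩))))))
    · simp; omega
    · intro q hq
      simp at hq
      by_cases hq' : q = s₁.nat 4 0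
      · simp [hq', h13, h14, h9]
      · have := h2 q (by omega)
        simpa [hq'] using this
    · simp; omega
  · rintro s₁ t hf ⟨h1, h2⟩ hb ht
    have h12 : s₁.nat 12 0 = c := by rw [hf.nat 12 (by simp)]; simpa
    have h14 : s₁.nat 14 = s.nat 14 := by rw [hf.nat 14 (by simp)]; ext; simp
    simp only [Test.eval, NatExpr.eval_var, h12, not_le, not_lt] at hb
    have h4 : s₁.nat 4 0 = c := le_antisymm h1 hb
    have ha := (haft c le_rfl).trans hw
    rw [h4] at h2
    -- There is one more piece than there are points, so the last value is copied after the loop.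
    -- The number of points is stored in the output last.
    refine wp_seq (wp_storeNat (by simp; omega) (by simp [h12, h14]; omega)
      (wp_setVar (by simp; omega) ⟨by simp [h12], fun q hq => by simp [h2 q hq],
        fun q hq => by simp [h2 q hq], fun q hq => ?_, ?_⟩))
    · rcases hq.eq_or_lt with rfl | hq
      · simp [h12, h14]
      · simp [h2 q hq, h12, h14, hq.ne]
    · simp at ht ⊢
      omega

/-- Tabulate the number of reached vertices along the edge that is given by the parameter. -/
def tableProgram : Program :=
  .seq (.setVar 3 (.load 0 (.lit 2))) (.seq edgeProgram copyProgram)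

theorem holdsFunction_of_isTable {f : ℝ → ℕ} {L : ℝ} {bp : ℕ → ℝ} {val aft : ℕ → ℕ} {c : ℕ}
    (h : IsTable f L c bp val aft) (h0 : s.nat 0 0 = c) (hbp : ∀ q < c, s.real 0 q = bp q)
    (hval : ∀ q < c, s.nat 1 q = val q) (haft : ∀ q ≤ c, s.nat 2 q = aft q) :
    HoldsFunction s f L := by
  have hfin : (breakpoints f L).Finite := by
    rw [← h.breakpoints_eq]; exact (Set.finite_Iio c).image _
  have heq : Set.EqOn (s.real 0) bp (Set.Iio c) := fun q hq => hbp q hq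
  refine ⟨hfin, by rw [h0, h.ncard], ?_, ?_, ?_, ?_⟩
  · rw [h0]; exact h.strictMonoOn.congr heq.symm
  · rw [h0, heq.image_eq]; exact h.breakpoints_eq
  · rw [h0]
    intro q hq
    rw [hval q hq, hbp q hq]
    exact h.val_eq q hq
  · intro t ht htb
    rw [haft, h.aft_eq t ht htb]
    rw [← h.ncard]
    exact Set.ncard_le_ncard (fun b hb => hb.1) hfin

theorem reachCount_eq_edgeFun (h : IsEdgeList N.graph ends) (lam : ℝ) (e : Fin m) :
    ∀ t ∈ Icc 0 (N.len (ends e).1 (ends e).2), reachCount N ends lam e t =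
      edgeFun N ends h lam e t := fun _ ht =>
  (Network.largestCovered_edgePoint lam (h.adj e) ht.1 ht.2).symm

theorem wp_tableProgram (hends : IsEdgeList N.graph ends) (hW : 5 * (n + m) + 5 ≤ W) :
    Wp W tableProgram (inputMemory N ends e lam) fun s t =>
      HoldsFunction s (edgeFun N ends hends lam e) (N.len (ends e).1 (ends e).2) ∧
      (breakpoints (edgeFun N ends hends lam e) (N.len (ends e).1 (ends e).2)).ncard ≤ 2 * n ∧
      t ≤ 6000 * ((n + m + 1) * (Nat.log 2 (4 * (n + m)) + 1)) := by
  have hp : (NatExpr.load 0 (.lit 2)).eval (inputMemory N ends e lam) = e := rfl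
  have he := e.2
  refine wp_seq (wp_setVar (by rw [hp]; omega) ?_)
  rw [hp]
  have hin : HasInput N ends lam ((inputMemory N ends e lam).setNat 3 0 e) :=
    (hasInput_inputMemory N ends e lam).congr
      (fun a ha => Memory.setNat_nat_of_ne _ (by omega) _ _) (fun a ha => rfl)
  refine wp_seq ((wp_edgeProgram (e := e) hin hends (by simp) hW).mono ?_)
  rintro s₁ t₁ - ⟨hT, hc, hv, ha, ht₁⟩
  refine (wp_copyProgram rfl hv ha (by omega) (by omega)).mono ?_
  rintro s₂ t₂ - ⟨h1, h2, h3, h4, ht₂⟩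
  have hT' := hT.congr (reachCount_eq_edgeFun hends lam e)
  refine ⟨holdsFunction_of_isTable hT' h1 h2 h3 h4, hT'.ncard.trans_le hc, ?_⟩
  have hb : (n + m + 1) * 1 ≤ (n + m + 1) * (Nat.log 2 (4 * (n + m)) + 1) :=
    Nat.mul_le_mul_left _ (by omega)
  simp only [mul_assoc] at *
  simp only [NatExpr.cost]
  omega

/-! ### Deciding a bound on the optimum -/

/-- Raise the flag (variable 16) if the table of an edge has an entry that is at least the
parameter. -/
def checkProgram : Program :=
  .seq (.branch (.natLe (.load 0 (.lit 2)) (.var 14)) (.setVar 16 (.lit 1)) .skip)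
    (.seq (.setVar 4 (.lit 0))
      (.loop (.not (.natLe (.var 12) (.var 4)))
        (.seq (.branch (.natLe (.load 0 (.lit 2)) (.load 13 (.var 4))) (.setVar 16 (.lit 1)) .skip)
          (.incr 4))))

theorem wp_raiseFlag {b : Test} (hW : 1 ≤ W) :
    Wp W (.branch b (.setVar 16 (.lit 1)) .skip) s fun s' t =>
      (s.nat 16 0 ≤ 1 → s'.nat 16 0 ≤ 1) ∧
      (s'.nat 16 0 = 1 ↔ s.nat 16 0 = 1 ∨ b.eval s) ∧ t ≤ b.cost + 4 := by
  refine wp_branch (fun hb => ?_) (fun hb => ?_)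
  · exact wp_setVar (by simpa) ⟨by simp, by simp [hb], by simp⟩
  · exact wp_skip ⟨id, by simp [hb], by omega⟩

/-- By `IsTable.exists_le_iff`, the values on the pieces after the first need not be inspected. -/
theorem wp_checkProgram {c k : ℕ} (hc : s.nat 12 0 = c) (hk : s.nat 0 2 = k) (hW : c + 1 ≤ W) :
    Wp W checkProgram s fun s' t => (s.nat 16 0 ≤ 1 → s'.nat 16 0 ≤ 1) ∧
      (s'.nat 16 0 = 1 ↔ s.nat 16 0 = 1 ∨ k ≤ s.nat 14 0 ∨ ∃ q < c, k ≤ s.nat 13 q) ∧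
      t ≤ 60 * (c + 1) := by
  refine wp_seq ((wp_raiseFlag (by omega)).mono ?_)
  rintro s₁ t₁ hf₁ ⟨h1, h2, ht₁⟩
  have hk₁ : s₁.nat 0 = s.nat 0 := hf₁.nat 0 (by simp)
  have hc₁ : s₁.nat 12 = s.nat 12 := hf₁.nat 12 (by simp)
  have hv₁ : s₁.nat 13 = s.nat 13 := hf₁.nat 13 (by simp)
  simp only [Test.eval, NatExpr.eval, NatExpr.eval_var, hk] at h2
  refine wp_seq (wp_setVar (by simp) ?_)
  refine wp_loop (fun s' => s'.nat 4 0 ≤ c ∧ (s.nat 16 0 ≤ 1 → s'.nat 16 0 ≤ 1) ∧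
    (s'.nat 16 0 = 1 ↔ s₁.nat 16 0 = 1 ∨ ∃ q < s'.nat 4 0, k ≤ s.nat 13 q))
    (fun s' => c - s'.nat 4 0) 40 ?_ ?_ ?_
  · exact ⟨by simp, by simpa using h1, by simp⟩
  · rintro s₂ hf₂ ⟨h3, h4, h5⟩ hb
    have h0 : s₂.nat 0 2 = k := by rw [hf₂.nat 0 (by simp)]; simp [hk₁, hk]
    have h12 : s₂.nat 12 0 = c := by rw [hf₂.nat 12 (by simp)]; simp [hc₁, hc]
    have h13 : s₂.nat 13 = s.nat 13 := by rw [hf₂.nat 13 (by simp)]; ext; simp [hv₁]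
    simp only [Test.eval, NatExpr.eval_var, h12, not_le] at hb
    refine wp_seq ((wp_raiseFlag (by omega)).mono ?_)
    rintro s₃ t₃ hf₃ ⟨h6, h7, ht₃⟩
    have h8 : s₃.nat 4 0 = s₂.nat 4 0 := by rw [hf₃.nat 4 (by simp)]
    simp only [Test.eval, NatExpr.eval, NatExpr.eval_var, h0, h13] at h7
    refine wp_incr (by omega) ⟨⟨by simp; omega, by simpa using fun h => h6 (h4 h), ?_⟩,
      by simp; omega, by simp at ht₃; omega⟩
    simp only [Memory.setNat_nat, and_true, if_true, h8]
    simp only [Nat.reduceEqDiff, if_false]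
    rw [h7, h5, Nat.exists_lt_succ_right, or_assoc]
  · rintro s₂ t hf₂ ⟨h3, h4, h5⟩ hb ht
    have h12 : s₂.nat 12 0 = c := by rw [hf₂.nat 12 (by simp)]; simp [hc₁, hc]
    simp only [Test.eval, NatExpr.eval_var, h12, not_le, not_lt] at hb
    rw [le_antisymm h3 hb, h2, or_assoc] at h5
    refine ⟨h4, h5, ?_⟩
    simp at ht ht₁ ⊢
    omega

/-- Decide whether the optimum is at most the given number. -/
def decideProgram : Program :=
  .seq (.setVar 16 (.lit 0))
    (.seq (.branch (.and (.natLe (.var 0) (.lit 1)) (.realLe (.lit 0) (.var 0)))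
      (.setVar 16 (.lit 1)) .skip)
    (.seq (.setVar 3 (.lit 0))
    (.seq (.loop (.not (.natLe (.load 0 (.lit 1)) (.var 3)))
      (.seq edgeProgram (.seq checkProgram (.incr 3))))
    (.setVar 0 (.var 16)))))

/-- With at least two vertices, connectedness makes every vertex an end of some edge, so points at
vertices are included in the edges. A single vertex has no edges and is covered exactly by
nonnegative bounds. -/
theorem lambdaStar_le_iff_edge (hends : IsEdgeList N.graph ends) {k : ℕ} (hk : 1 ≤ k)
    (hkn : k ≤ n) (lam : ℝ) :
    N.lambdaStar k ≤ lam ↔ (n ≤ 1 ∧ 0 ≤ lam) ∨ ∃ e : Fin m,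
      ∃ t ∈ Icc 0 (N.len (ends e).1 (ends e).2), k ≤ reachCount N ends lam e t := by
  rw [Network.lambdaStar_le_iff hk (by simpa using hkn)]
  have hedge : ∀ u v, N.graph.Adj u v → ∀ t ∈ Icc 0 (N.len u v),
      k ≤ (N.reachSet lam u v t).ncard → ∃ e : Fin m,
      ∃ t ∈ Icc 0 (N.len (ends e).1 (ends e).2), k ≤ reachCount N ends lam e t := by
    intro u v adj t ht hc
    have hmem : s(u, v) ∈ Set.range (fun e => s((ends e).1, (ends e).2)) := by
      rw [hends.2]; exact adj
    obtain ⟨e, he⟩ := hmem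
    refine ⟨e, ?_⟩
    unfold reachCount
    rcases Sym2.eq_iff.1 he with ⟨h1, h2⟩ | ⟨h1, h2⟩
    · rw [h1, h2]; exact ⟨t, ht, hc⟩
    · rw [h1, h2]
      -- The list holds the edge with the opposite orientation, so the position is measured from the
      -- other end.
      refine ⟨N.len v u - t, ?_, by rwa [Network.reachSet_swap]⟩
      rw [N.len_symm v u]
      exact ⟨by linarith [ht.2], by linarith [ht.1]⟩
  constructor
  · rintro (⟨u, hu⟩ | ⟨u, v, adj, t, ht, hc⟩)
    · rcases Nat.lt_or_ge 1 n with hn | hn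
      · right
        have : Nontrivial (Fin n) := Fin.nontrivial_iff_two_le.2 hn
        obtain ⟨v, adj⟩ := N.connected.preconnected.exists_adj_of_nontrivial u
        refine hedge u v adj 0 ⟨le_rfl, (N.len_pos u v adj).le⟩ ?_
        rwa [Network.reachSet_zero lam adj]
      · left
        refine ⟨hn, ?_⟩
        obtain ⟨w, hw⟩ : {w | N.Reach lam u 0 w}.Nonempty :=
          Set.nonempty_of_ncard_ne_zero (by omega)
        have : Subsingleton (Fin n) := Fin.subsingleton_iff_le_one.2 hn
        cases hw with
        | root h => simpa using h
        | step ha hab h => exact absurd (Subsingleton.elim _ _) hab.1.ne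
    · exact Or.inr (hedge u v adj t ht hc)
  · rintro (⟨hn, h0⟩ | ⟨e, t, ht, hc⟩)
    · left
      obtain ⟨u⟩ := N.connected.nonempty
      refine ⟨u, ?_⟩
      have : 0 < {w | N.Reach lam u 0 w}.ncard :=
        (Set.ncard_pos).2 ⟨u, .root (by simpa using h0)⟩
      omega
    · exact Or.inr ⟨_, _, hends.adj e, t, ht, hc⟩

theorem wp_decideProgram (hends : IsEdgeList N.graph ends) {k : ℕ} (hk : 1 ≤ k) (hkn : k ≤ n)
    (hW : 5 * (n + m) + 5 ≤ W) :
    Wp W decideProgram (inputMemory N ends k lam) fun s t =>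
      (s.nat 0 0 = 1 ↔ N.lambdaStar k ≤ lam) ∧
      t ≤ 7000 * (m * ((n + m + 1) * (Nat.log 2 (4 * (n + m)) + 1))) + 100 := by
  rw [lambdaStar_le_iff_edge hends hk hkn]
  set s₀ := inputMemory N ends k lam with hs₀
  have hin := hasInput_inputMemory N ends k lam
  have hp : s₀.nat 0 2 = k := rfl
  refine wp_seq (wp_setVar (by simp) (wp_seq ((wp_raiseFlag (by omega)).mono ?_)))
  rintro s₁ t₁ hf₁ ⟨h1, h2, ht₁⟩
  have hin₁ : HasInput N ends lam s₁ := hin.congr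
    (fun a ha => by rw [hf₁.nat a (by simp; omega), Memory.setNat_nat_of_ne _ (by omega)])
    (fun a ha => by rw [hf₁.real a (by simp)]; rfl)
  have hp₁ : s₁.nat 0 2 = k := by rw [hf₁.nat 0 (by simp)]; simpa using hp
  have h1' : s₁.nat 16 0 ≤ 1 := h1 (by simp)
  have h2' : s₁.nat 16 0 = 1 ↔ n ≤ 1 ∧ 0 ≤ lam := by
    rw [h2]; simp [hin.card, hin.lam, hs₀]
  refine wp_seq (wp_setVar (by simp) (wp_seq ?_))
  set T := (n + m + 1) * (Nat.log 2 (4 * (n + m)) + 1) with hT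
  have hb : (n + m + 1) * 1 ≤ T := Nat.mul_le_mul_left _ (by omega)
  refine wp_loop (fun s' => s'.nat 3 0 ≤ m ∧ s'.nat 16 0 ≤ 1 ∧ (s'.nat 16 0 = 1 ↔
    (n ≤ 1 ∧ 0 ≤ lam) ∨ ∃ e : Fin m, e.val < s'.nat 3 0 ∧
      ∃ t ∈ Icc 0 (N.len (ends e).1 (ends e).2), k ≤ reachCount N ends lam e t))
    (fun s' => m - s'.nat 3 0) (6000 * T) ?_ ?_ ?_
  · exact ⟨by simp, by simpa using h1', by simpa using h2'⟩
  · rintro s₂ hf₂ ⟨h3, h4, h5⟩ hlt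
    have hin₂ : HasInput N ends lam s₂ := hin₁.congr
      (fun a ha => by
        rw [hf₂.nat a (by simp [checkProgram]; omega), Memory.setNat_nat_of_ne _ (by omega)])
      (fun a ha => by rw [hf₂.real a (by simp [checkProgram]; omega)]; rfl)
    have hp₂ : s₂.nat 0 2 = k := by rw [hf₂.nat 0 (by simp [checkProgram])]; simpa using hp₁
    simp only [Test.eval, NatExpr.eval, NatExpr.eval_var, hin₂.edges, not_le] at hlt
    set e : Fin m := ⟨s₂.nat 3 0, hlt⟩ with he
    refine wp_seq ((wp_edgeProgram (e := e) hin₂ hends rfl hW).mono ?_)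
    rintro s₃ t₃ hf₃ ⟨h6, h7, -, -, ht₃⟩
    have hp₃ : s₃.nat 0 2 = k := by rw [hf₃.nat 0 (by simp), hp₂]
    have hflag : s₃.nat 16 0 = s₂.nat 16 0 := by rw [hf₃.nat 16 (by simp)]
    refine wp_seq ((wp_checkProgram rfl hp₃ (by omega)).mono ?_)
    rintro s₄ t₄ hf₄ ⟨h8, h9, ht₄⟩
    have he₄ : s₄.nat 3 0 = e := by
      rw [hf₄.nat 3 (by simp [checkProgram]), hf₃.nat 3 (by simp)]
    rw [hflag, h5, ← h6.exists_le_iff (N.len_pos _ _ (hends.adj e)).le k] at h9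
    refine wp_incr (by omega) ⟨⟨?_, ?_, ?_⟩, ?_, ?_⟩
    · simp [he₄]
    · simpa using h8 (by omega)
    · simp only [Memory.setNat_nat, and_true, if_true, he₄]
      simp only [Nat.reduceEqDiff, if_false]
      rw [h9, or_assoc]
      refine or_congr_right ?_
      constructor
      · rintro (⟨e', h, h'⟩ | h')
        · exact ⟨e', by simp [he]; omega, h'⟩
        · exact ⟨e, by simp, h'⟩
      · rintro ⟨e', h, h'⟩
        rcases Nat.lt_succ_iff_lt_or_eq.1 h with h | h
        · exact Or.inl ⟨e', h, h'⟩
        · exact Or.inr (by rwa [Fin.ext h] at h')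
    · simp [he₄, he]; omega
    · simp only [mul_assoc] at ht₃
      rw [← hT] at ht₃
      clear_value T
      omega
  · rintro s₂ t hf₂ ⟨h3, h4, h5⟩ hlt ht
    have hm : s₂.nat 0 1 = m := by
      rw [hf₂.nat 0 (by simp [checkProgram])]; simpa using hin₁.edges
    simp only [Test.eval, NatExpr.eval, NatExpr.eval_var, hm, not_le, not_lt] at hlt
    have h6 : s₂.nat 3 0 = m := le_antisymm h3 hlt
    refine wp_setVar (by simp; omega) ⟨?_, ?_⟩
    · simp only [Memory.setNat_nat, and_self, if_true, NatExpr.eval_var, h5]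
      refine or_congr_right (exists_congr fun e => ?_)
      rw [h6]
      simp
    · have hmT : m * (6000 * T + 9) ≤ 7000 * (m * T) := by nlinarith
      simp at ht ht₁ ⊢
      have : m * (6000 * T + 6 + 1) ≤ m * (6000 * T + 9) :=
        Nat.mul_le_mul_left _ (by omega)
      clear_value T
      omega

end Main

end KCenter

theorem mainTheorem5 :
    (∃ (P : KCenter.Program) (c : ℕ) (C : ℝ),
      ∀ (n m : ℕ) (N : KCenter.Network (Fin n)) (ends : Fin m → Fin n × Fin n)
        (_ : KCenter.IsEdgeList N.graph ends) (k : ℕ) (_ : 1 ≤ k) (_ : k ≤ n) (lam : ℝ),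
        IsLeast (Set.range (N.phi k)) (N.lambdaStar k) ∧
        ∃ (s : KCenter.Memory) (t : ℕ),
          KCenter.Runs ((n + m + 2) ^ c) P (KCenter.inputMemory N ends k lam) s t ∧
          (s.nat 0 0 = 1 ↔ lam ≥ N.lambdaStar k) ∧
          (t : ℝ) ≤ C * (m * n * Real.log n + m ^ 2 * Real.log n + 1)) ∧
    (∃ (Q : KCenter.Program) (c : ℕ) (C : ℝ),
      ∀ (n m : ℕ) (N : KCenter.Network (Fin n)) (ends : Fin m → Fin n × Fin n)
        (h : KCenter.IsEdgeList N.graph ends) (lam : ℝ) (e : Fin m),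
        ((KCenter.breakpoints (KCenter.edgeFun N ends h lam e)
          (N.len (ends e).1 (ends e).2)).ncard : ℝ) ≤ C * n ∧
        ∃ (s : KCenter.Memory) (t : ℕ),
          KCenter.Runs ((n + m + 2) ^ c) Q (KCenter.inputMemory N ends e lam) s t ∧
          KCenter.HoldsFunction s (KCenter.edgeFun N ends h lam e)
            (N.len (ends e).1 (ends e).2) ∧
          (t : ℝ) ≤ C * ((m + n) * Real.log n)) := by
  -- The exponent 3 comes from `word_bound`. The constant exceeds 168000 = 7000 · 2 · 12 and 144000
  -- = 6000 · 2 · 12, where 2 absorbs the summand 1 in n + m + 1 and 12 is from `log_bound`; it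
  -- leaves room for the additive 100.
  refine ⟨⟨KCenter.decideProgram, 3, 400000, ?_⟩, ⟨KCenter.tableProgram, 3, 400000, ?_⟩⟩
  · intro n m N ends hends k hk hkn lam
    refine ⟨KCenter.Network.isLeast_lambdaStar hk (by simpa using hkn), ?_⟩
    obtain ⟨s, t, hr, hs, ht⟩ := KCenter.wp_decideProgram (lam := lam) hends hk hkn
      (KCenter.word_bound (hk.trans hkn))
    refine ⟨s, t, hr, hs, ?_⟩
    have ht' : (t : ℝ) ≤ 7000 * (m * ((n + m + 1) *
        ((Nat.log 2 (4 * (n + m)) + 1 : ℕ) : ℝ))) + 100 := by exact_mod_cast ht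
    refine ht'.trans ?_
    -- Without edges the time is constant and is paid by the summand 1, as the logarithm may vanish.
    rcases Nat.eq_zero_or_pos m with rfl | hm
    · norm_num
    · have hn := hends.two_le ⟨0, hm⟩
      have hlog := KCenter.log_bound hends hn
      have hn' : (2 : ℝ) ≤ n := by exact_mod_cast hn
      have hlog0 : 0 ≤ Real.log n := Real.log_nonneg (by linarith)
      calc 7000 * (m * ((n + m + 1) * ((Nat.log 2 (4 * (n + m)) + 1 : ℕ) : ℝ))) + 100
          ≤ 7000 * (m * ((n + m + (n + m)) * (12 * Real.log n))) + 100 := by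
            gcongr
            linarith [Nat.cast_nonneg (α := ℝ) m]
        _ = 168000 * (m * n * Real.log n + m ^ 2 * Real.log n) + 100 := by ring
        _ ≤ 400000 * (m * n * Real.log n + m ^ 2 * Real.log n + 1) := by
            have : 0 ≤ m * n * Real.log n + m ^ 2 * Real.log n := by positivity
            linarith
  · intro n m N ends hends lam e
    -- The existence of the edge forces `n ≥ 2`, so log n is bounded below and no additive constant
    -- is needed.
    have hn := hends.two_le e
    obtain ⟨s, t, hr, hs, hc, ht⟩ := KCenter.wp_tableProgram (lam := lam) (e := e) hends
      (KCenter.word_bound (by omega))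
    constructor
    · have hc' : ((KCenter.breakpoints (KCenter.edgeFun N ends hends lam e)
          (N.len (ends e).1 (ends e).2)).ncard : ℝ) ≤ 2 * n := by exact_mod_cast hc
      linarith [Nat.cast_nonneg (α := ℝ) n]
    · refine ⟨s, t, hr, hs, ?_⟩
      have ht' : (t : ℝ) ≤ 6000 * ((n + m + 1) *
          ((Nat.log 2 (4 * (n + m)) + 1 : ℕ) : ℝ)) := by exact_mod_cast ht
      have hlog := KCenter.log_bound hends hn
      have hn' : (2 : ℝ) ≤ n := by exact_mod_cast hn
      have hlog0 : 0 ≤ Real.log n := Real.log_nonneg (by linarith)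
      calc (t : ℝ) ≤ 6000 * ((n + m + 1) * ((Nat.log 2 (4 * (n + m)) + 1 : ℕ) : ℝ)) := ht'
        _ ≤ 6000 * ((n + m + (n + m)) * (12 * Real.log n)) := by
            gcongr
            linarith [Nat.cast_nonneg (α := ℝ) m]
        _ = 144000 * ((m + n) * Real.log n) := by ring
        _ ≤ 400000 * ((m + n) * Real.log n) := by
            have : 0 ≤ (m + n) * Real.log n := by positivity
            linarith
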